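/- Let $P(t,x)=\mathbf 1_{t>0}(4\pi t)^{-1/2}e^{-x^2/(4t)}$ be the heat kernel of $\partial_t-\partial_x^2$ on $\mathbb R$, let $\mathbb T=\mathbb R/\mathbb Z$, and let a prime on a kernel denote its derivative in the space variable. Assume the following. (i) $F:\mathbb R\to\mathbb R$ is even, and there are $\alpha\in(0,1)$ and $C,M>0$ such that $F$ is of class $C^{7}$ with $|F^{(\ell)}(u)|\le C(1+|u|)^M$ for $0\le \ell\le 7$ and $|F^{(7)}(u+h)-F^{(7)}(u)|\le C(1+|u|)^M|h|^\alpha$ for all $u\in\mathbb R$, $|h|<1$. (ii) $\rho:\mathbb R^2\to\mathbb R$ is smooth, compactly supported, even in the space variable $x$, and has integral $1$. Write $\rho_\varepsilon(t,x)=\varepsilon^{-3}\rho(t/\varepsilon^2,x/\varepsilon)$, periodised in space when regarded as a function on $\mathbb R\times\mathbb T$. (iii) $K:\mathbb R^2\to\mathbb R$ is a truncation of the heat kernel: it is compactly supported, smooth away from the origin, and in a punctured neighbourhood of the origin it equals $P$ up to a smooth function on $\mathbb R^2$ (which allows truncations both of the heat kernel on $\mathbb R$ and of that on $\mathbb T$).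 Let $\widehat\Psi=(P'*\rho)*\xi_0$, where $\xi_0$ is a space-time white noise on $\mathbb R\times\mathbb R$, put $a=\tfrac12\,\mathbb E F''(\widehat\Psi(0))$, and suppose $a\neq0$. For $\varepsilon\in(0,1)$ let $\Psi_\varepsilon=(P_{\mathbb T}'*\rho_\varepsilon)*\xi$, where $\xi$ is a space-time white noise on $\mathbb R\times\mathbb T$, $P_{\mathbb T}$ is the heat kernel on $\mathbb T$ and $*$ is space-time convolution on $\mathbb R\times\mathbb T$; regard $\Psi_\varepsilon$ as a field on $\mathbb R^2$ that is $1$-periodic in space. For $x,y,z\in\mathbb R^2$ write $X=\varepsilon^{1/2}\Psi_\varepsilon(x)$, $Y=\varepsilon^{1/2}\Psi_\varepsilon(y)$, $Z=\varepsilon^{1/2}\Psi_\varepsilon(z)$, and $\langle W\rangle=W-\mathbb EW$. Then the renormalisation constant $$C^{(\varepsilon)}=\frac{1}{2a^3\varepsilon^2}\int_{\mathbb R^2}\int_{\mathbb R^2}K'(x-y)\,K'(x-z)\,\mathbb E\big(\langle F''(X)\rangle\langle F(Y)\rangle\langle F(Z)\rangle\big)\,dy\,dz$$ is well defined (the expectation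 and the integral converge absolutely) and is bounded uniformly in $\varepsilon\in(0,1)$ (and in $x\in\mathbb R^2$, on which it does not depend by stationarity). -/

import Mathlib

open MeasureTheory ProbabilityTheory Filter Topology
open scoped Convolution

noncomputable section

namespace KPZRenorm

/-- The standing assumption on the nonlinearity `F`: it is even, of class `C^{7+α}` for some
`α ∈ (0,1)`, and its derivatives up to order `7` together with the local `α`-Hölder quotient of
the seventh derivative grow at most polynomially. -/
structure IsAdmissibleNonlinearity (F : ℝ → ℝ) : Prop where
  even : ∀ u, F (-u) = F u
  contDiff : ContDiff ℝ 7 F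
  growth : ∃ α ∈ Set.Ioo (0 : ℝ) 1, ∃ C > (0 : ℝ), ∃ M > (0 : ℝ),
    (∀ ℓ : ℕ, ℓ ≤ 7 → ∀ u : ℝ, |iteratedDeriv ℓ F u| ≤ C * (1 + |u|) ^ M) ∧
    (∀ u h : ℝ, |h| < 1 →
      |iteratedDeriv 7 F (u + h) - iteratedDeriv 7 F u| ≤ C * (1 + |u|) ^ M * |h| ^ α)

/-- The standing assumption on the mollifier `ρ(t, x)`. -/
structure IsMollifier (ρ : ℝ × ℝ → ℝ) : Prop where
  contDiff : ContDiff ℝ (⊤ : ℕ∞) ρ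
  hasCompactSupport : HasCompactSupport ρ
  symm : ∀ t x, ρ (t, -x) = ρ (t, x)
  integral_eq_one : ∫ z, ρ z = 1

/-- `ρ_ε(t, x) = ε⁻³ ρ(t/ε², x/ε)`. -/
def rescale (ρ : ℝ × ℝ → ℝ) (ε : ℝ) (z : ℝ × ℝ) : ℝ :=
  (ε ^ 3)⁻¹ * ρ (z.1 / ε ^ 2, z.2 / ε)

/-- The heat kernel `P(t, x)` of `∂ₜ - ∂ₓ²` on `ℝ × ℝ`, which vanishes for `t ≤ 0`. -/
def heatKernel (z : ℝ × ℝ) : ℝ :=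
  if 0 < z.1 then (Real.sqrt (4 * Real.pi * z.1))⁻¹ * Real.exp (-z.2 ^ 2 / (4 * z.1)) else 0

/-- The spatial derivative `∂ₓ f` of a function on space-time. -/
def spaceDeriv (f : ℝ × ℝ → ℝ) (z : ℝ × ℝ) : ℝ :=
  deriv (fun x => f (z.1, x)) z.2

/-- The function on `ℝ × 𝕋`, `𝕋 = ℝ / ℤ`, given by `(t, x) ↦ ∑ₙ f(t, x + n)`. -/
def periodize (f : ℝ × ℝ → ℝ) (z : ℝ × UnitAddCircle) : ℝ :=
  ∑' n : ℤ, f (z.1, (AddCircle.equivIco (1 : ℝ) 0 z.2 : ℝ) + n)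

/-- The projection from `ℝ × ℝ` to `ℝ × 𝕋`. -/
def proj (z : ℝ × ℝ) : ℝ × UnitAddCircle := (z.1, (z.2 : UnitAddCircle))

/-- `ξ` is a (real, Gaussian) white noise on the measure space `(S, μ)`: its values on
square integrable functions form a centred Gaussian process whose covariance is the scalar product
of `L²(μ)`. The random variable `ξ f` is the stochastic integral `∫ f dξ`. -/
structure IsWhiteNoise {S Ω : Type*} [MeasurableSpace S] [MeasurableSpace Ω]
    (ξ : (S → ℝ) → Ω → ℝ) (μ : Measure S) (P : Measure Ω) : Prop where
  gaussian : IsGaussianProcess (fun f : {f : S → ℝ // MemLp f 2 μ} => ξ f.1) P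
  mean : ∀ f, MemLp f 2 μ → ∫ ω, ξ f ω ∂P = 0
  covariance : ∀ f g, MemLp f 2 μ → MemLp g 2 μ →
    ∫ ω, ξ f ω * ξ g ω ∂P = ∫ s, f s * g s ∂μ

/-- The field `P' * (ξ * ρ) = (P' * ρ) * ξ` on the whole space `ℝ × ℝ`, where `ξ` is a white noise
on `ℝ × ℝ`. -/
def fieldPlane {Ω : Type*} (ξ : (ℝ × ℝ → ℝ) → Ω → ℝ) (ρ : ℝ × ℝ → ℝ) (z : ℝ × ℝ) : Ω → ℝ :=
  ξ fun w => (spaceDeriv heatKernel ⋆[ContinuousLinearMap.lsmul ℝ ℝ, volume] ρ) (z - w)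

/-- The field `Ψ_ε = P' * ξ_ε = (P' * ρ_ε) * ξ` on `ℝ × 𝕋`, where `ξ` is a white noise
on `ℝ × 𝕋` and `P'` is the spatial derivative of the heat kernel on `𝕋`. -/
def fieldTorus {Ω : Type*} (ξ : (ℝ × UnitAddCircle → ℝ) → Ω → ℝ) (ρ : ℝ × ℝ → ℝ) (ε : ℝ)
    (z : ℝ × UnitAddCircle) : Ω → ℝ :=
  ξ fun w => (periodize (spaceDeriv heatKernel)
    ⋆[ContinuousLinearMap.lsmul ℝ ℝ, volume] periodize (rescale ρ ε)) (z - w)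

/-- The coupling constant `a = ½ 𝔼 F''(Ψ̂)`, where `Ψ̂ = P' * (ξ * ρ)` is the field on the whole
space and `ξ` is a white noise on `ℝ × ℝ` under `P`. -/
def couplingConst {Ω : Type*} [MeasurableSpace Ω] (P : Measure Ω) (ξ : (ℝ × ℝ → ℝ) → Ω → ℝ)
    (ρ : ℝ × ℝ → ℝ) (F : ℝ → ℝ) : ℝ :=
  (1 / 2) * ∫ ω, iteratedDeriv 2 F (fieldPlane ξ ρ 0 ω) ∂P

/-- `K` is a truncation of the heat kernel: it is compactly supported, smooth away from the origin
and agrees near the origin with the heat kernel on `ℝ × ℝ`, up to a globally smooth function `R`.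
(`R = 0` is the truncation of the heat kernel of `ℝ`; if `K` agrees near the origin with the
heat kernel of `𝕋`, then `R` agrees near the origin with `∑_{n ≠ 0} P(t, x + n)`.) -/
structure IsTruncatedHeatKernel (K : ℝ × ℝ → ℝ) : Prop where
  contDiffOn : ContDiffOn ℝ (⊤ : ℕ∞) K {0}ᶜ
  hasCompactSupport : HasCompactSupport K
  near_zero : ∃ R : ℝ × ℝ → ℝ, ContDiff ℝ (⊤ : ℕ∞) R ∧ ∀ᶠ z in 𝓝[≠] 0, K z = heatKernel z + R z

/-- The recentred random variable `⟨X⟩ = X - 𝔼 X`. -/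
def cent {Ω : Type*} [MeasurableSpace Ω] (P : Measure Ω) (X : Ω → ℝ) (ω : Ω) : ℝ :=
  X ω - ∫ ω', X ω' ∂P

/-- The random variable `ε^{1/2} Ψ_ε(z)`, where `Ψ_ε` is viewed as a field on `ℝ × ℝ` that is
`1`-periodic in space. -/
def scaledField {Ω : Type*} (ξ : (ℝ × UnitAddCircle → ℝ) → Ω → ℝ) (ρ : ℝ × ℝ → ℝ) (ε : ℝ)
    (z : ℝ × ℝ) (ω : Ω) : ℝ :=
  Real.sqrt ε * fieldTorus ξ ρ ε (proj z) ω

/-- The random variable `⟨F''(X)⟩ ⟨F(Y)⟩ ⟨F(Z)⟩`, where `X`, `Y`, `Z` are the values of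
`ε^{1/2} Ψ_ε` at `x`, `y`, `z`. -/
def tripleProduct {Ω : Type*} [MeasurableSpace Ω] (P : Measure Ω)
    (ξ : (ℝ × UnitAddCircle → ℝ) → Ω → ℝ) (ρ : ℝ × ℝ → ℝ) (F : ℝ → ℝ) (ε : ℝ)
    (x y z : ℝ × ℝ) (ω : Ω) : ℝ :=
  cent P (fun ω' => iteratedDeriv 2 F (scaledField ξ ρ ε x ω')) ω *
    cent P (fun ω' => F (scaledField ξ ρ ε y ω')) ω *
    cent P (fun ω' => F (scaledField ξ ρ ε z ω')) ω

/-- The integrand `K'(x - y) K'(x - z) 𝔼(⟨F''(X)⟩ ⟨F(Y)⟩ ⟨F(Z)⟩)` as a function of `(y, z)`,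
where `K' = ∂ₓ K`. -/
def renormIntegrand {Ω : Type*} [MeasurableSpace Ω] (P : Measure Ω)
    (ξ : (ℝ × UnitAddCircle → ℝ) → Ω → ℝ) (ρ : ℝ × ℝ → ℝ) (F : ℝ → ℝ) (K : ℝ × ℝ → ℝ) (ε : ℝ)
    (x : ℝ × ℝ) (yz : (ℝ × ℝ) × (ℝ × ℝ)) : ℝ :=
  spaceDeriv K (x - yz.1) * spaceDeriv K (x - yz.2) *
    ∫ ω, tripleProduct P ξ ρ F ε x yz.1 yz.2 ω ∂P

/-- The renormalisation constant
`(2 a³ ε²)⁻¹ ∫ K'(x - y) K'(x - z) 𝔼(⟨F''(X)⟩ ⟨F(Y)⟩ ⟨F(Z)⟩) dy dz`, computed at the point `x`. -/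
def renormConst {Ω : Type*} [MeasurableSpace Ω] (P : Measure Ω)
    (ξ : (ℝ × UnitAddCircle → ℝ) → Ω → ℝ) (ρ : ℝ × ℝ → ℝ) (F : ℝ → ℝ) (K : ℝ × ℝ → ℝ) (a ε : ℝ)
    (x : ℝ × ℝ) : ℝ :=
  1 / (2 * a ^ 3 * ε ^ 2) * ∫ yz, renormIntegrand P ξ ρ F K ε x yz

end KPZRenorm

end

/-!
The integral in the renormalisation constant is of order `ε²`, uniformly in `ε`, because each of the
three factors of the integrand has the decay that scaling predicts.

*The three-point function.* Let `X, Y, Z` be jointly Gaussian and `f, g, h` even. Rotating `Z`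
towards an independent copy and integrating by parts in Gaussian space, one trades the dependence of
`Z` on `(X, Y)` for a covariance times an expectation with derivatives of the functions
(`KPZRenorm.abs_gaussTriple_sub_le`). If this is done repeatedly for recentred functions, the terms
of lower order drop out: those without a derivative have mean zero, and those with one derivative are
odd. The expectation of `⟨f(X)⟩⟨g(Y)⟩⟨h(Z)⟩` is therefore at most of third order in the covariances,
and of second order in the covariances of any chosen variable with the other two
(`KPZRenorm.abs_integral_cent_mul_le`). No expansion in Hermite polynomials is needed, only four
derivatives with at most exponential growth.

*The covariance.* The derivative of the heat kernel of the circle is bounded by a multiple of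
`|z|^{-2}` at all scales, where `|z|` is the parabolic distance; at large times this uses Poisson
summation, and the absence of a constant Fourier mode in the derivative
(`KPZRenorm.exists_abs_heatTorus_le`). Mollification replaces the bound by `(|z| + ε)^{-2}`
(`KPZRenorm.IsMollifier.exists_abs_fieldKernel_le`), and the covariance of `ε^{1/2} Ψ_ε` at two points
that differ by `u` is then bounded by a multiple of `σ(u) = ε / (|u| + ε)`
(`KPZRenorm.IsMollifier.exists_abs_fieldCov_le`).

In the triangle `x, y, z` the two longer sides are comparable, and the cubic bound that is quadratic
in their covariances is at most a multiple of the product `σ(x - y) σ(x - z) σ(y - z)`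
(`KPZRenorm.exists_abs_integral_tripleProduct_le`).

*The integral.* Since `|K'(z)|` is at most a multiple of `|z|^{-2}`
(`KPZRenorm.IsTruncatedHeatKernel.exists_abs_spaceDeriv_le`), it remains to integrate
`|y|^{-2} |z|^{-2} σ(y) σ(z) σ(y - z)`. According to which two sides of the triangle `0, y, z` are the
shortest, this is at most a sum of products of the weights `|·|^{-5/2} σ` and `|·|^{-3/2} σ²` of two
sides. The parabolic dimension being `3`, both weights are integrable, with integrals of order
`ε^{1/2}` and `ε^{3/2}`, and the product of the two is of order `ε²`
(`KPZRenorm.exists_setLIntegral_triangle_le`).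
-/

namespace KPZRenorm

open scoped NNReal ENNReal RealInnerProductSpace

/-! ### Gaussian integration by parts -/

lemma integrable_exp_mul_abs_gaussianReal (v : ℝ≥0) (k : ℝ) :
    Integrable (fun x => Real.exp (k * |x|)) (gaussianReal 0 v) := by
  refine ((integrable_exp_mul_gaussianReal (μ := 0) (v := v) k).add
    (integrable_exp_mul_gaussianReal (μ := 0) (v := v) (-k))).mono' (by fun_prop)
    (ae_of_all _ fun x => ?_)
  rw [Real.norm_of_nonneg (Real.exp_pos _).le]
  rcases abs_cases x with h | h <;> simp only [h.1, Pi.add_apply]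
  · linarith [Real.exp_pos (-k * x)]
  · rw [mul_neg, ← neg_mul]; linarith [Real.exp_pos (k * x)]

lemma abs_le_exp_abs (x : ℝ) : |x| ≤ Real.exp |x| :=
  (le_add_of_nonneg_right zero_le_one).trans (Real.add_one_le_exp _)

/-- Gaussian integration by parts on the line. -/
lemma integral_id_mul_gaussianReal (v : ℝ≥0) {φ φ' : ℝ → ℝ} {C k : ℝ}
    (hd : ∀ x, HasDerivAt φ (φ' x) x) (hc : Continuous φ')
    (hφ : ∀ x, |φ x| ≤ C * Real.exp (k * |x|)) (hφ' : ∀ x, |φ' x| ≤ C * Real.exp (k * |x|)) :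
    ∫ x, x * φ x ∂gaussianReal 0 v = v * ∫ x, φ' x ∂gaussianReal 0 v := by
  by_cases hv : v = 0
  · simp [hv]
  have hφc : Continuous φ := continuous_iff_continuousAt.2 fun x => (hd x).continuousAt
  have hv0 : (0 : ℝ) < v := by positivity
  have hconv : ∀ f : ℝ → ℝ, Integrable f (gaussianReal 0 v) →
      Integrable (fun x => gaussianPDFReal 0 v x * f x) := by
    intro f hf
    rw [gaussianReal_of_var_ne_zero _ hv, integrable_withDensity_iff_integrable_smul'
      (measurable_gaussianPDF _ _) (ae_of_all _ fun _ ↦ gaussianPDF_lt_top)] at hf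
    simpa using hf
  have hpd : ∀ x, HasDerivAt (gaussianPDFReal 0 v) (-(gaussianPDFReal 0 v x * (x / v))) x := by
    intro x
    have h1 : HasDerivAt (fun x : ℝ => -(x - 0) ^ 2 / (2 * v)) (-(x / v)) x := by
      have := ((((hasDerivAt_id x).sub_const 0).pow 2).neg).div_const (2 * (v : ℝ))
      refine this.congr_deriv ?_
      simp; field_simp
    have := (h1.exp).const_mul ((√(2 * Real.pi * v))⁻¹)
    rw [gaussianPDFReal_def]
    refine this.congr_deriv ?_
    ring
  have i1 : Integrable φ (gaussianReal 0 v) :=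
    ((integrable_exp_mul_abs_gaussianReal v k).const_mul C).mono' hφc.aestronglyMeasurable
      (ae_of_all _ fun x => hφ x)
  have i2 : Integrable φ' (gaussianReal 0 v) :=
    ((integrable_exp_mul_abs_gaussianReal v k).const_mul C).mono' hc.aestronglyMeasurable
      (ae_of_all _ fun x => hφ' x)
  have i3 : Integrable (fun x => x * φ x) (gaussianReal 0 v) := by
    refine ((integrable_exp_mul_abs_gaussianReal v (k + 1)).const_mul C).mono'
      (by fun_prop) (ae_of_all _ fun x => ?_)
    rw [Real.norm_eq_abs, abs_mul, add_mul, one_mul, Real.exp_add]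
    calc |x| * |φ x| ≤ Real.exp |x| * (C * Real.exp (k * |x|)) :=
          mul_le_mul (abs_le_exp_abs x) (hφ x) (abs_nonneg _) (Real.exp_pos _).le
      _ = _ := by ring
  have key := integral_mul_deriv_eq_deriv_mul_of_integrable (u := φ) (u' := φ')
    (v := gaussianPDFReal 0 v) (v' := fun x => -(gaussianPDFReal 0 v x * (x / v)))
    (fun x _ => hd x) (fun x _ => hpd x)
    (by
      refine ((hconv _ i3).const_mul (-(v : ℝ)⁻¹)).congr (ae_of_all _ fun x => ?_)
      simp; field_simp)
    (by
      refine (hconv _ i2).congr (ae_of_all _ fun x => ?_)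
      simp; ring)
    (by
      refine (hconv _ i1).congr (ae_of_all _ fun x => ?_)
      simp; ring)
  rw [integral_gaussianReal_eq_integral_smul hv, integral_gaussianReal_eq_integral_smul hv]
  simp only [smul_eq_mul]
  have e1 : ∫ x, gaussianPDFReal 0 v x * (x * φ x) =
      -(v : ℝ) * ∫ x, φ x * -(gaussianPDFReal 0 v x * (x / v)) := by
    rw [← integral_const_mul]
    congr 1; ext x; field_simp
  rw [e1, key]
  have e2 : ∫ x, φ' x * gaussianPDFReal 0 v x = ∫ x, gaussianPDFReal 0 v x * φ' x := by
    congr 1; ext x; ring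
  rw [e2]; ring

section Stein

variable {E : Type*} [NormedAddCommGroup E] [InnerProductSpace ℝ E] [FiniteDimensional ℝ E]
  [MeasurableSpace E] [BorelSpace E]

lemma integrable_exp_mul_norm_stdGaussian (k : ℝ) :
    Integrable (fun x : E => Real.exp (k * ‖x‖)) (stdGaussian E) := by
  obtain ⟨C, hC, hi⟩ := IsGaussian.exists_integrable_exp_sq (stdGaussian E)
  refine (hi.const_mul (Real.exp (k ^ 2 / (4 * C)))).mono' (by fun_prop)
    (ae_of_all _ fun x => ?_)
  rw [Real.norm_of_nonneg (Real.exp_pos _).le, ← Real.exp_add]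
  refine Real.exp_le_exp.2 ?_
  have : k ^ 2 / (4 * C) + C * ‖x‖ ^ 2 - k * ‖x‖ = (k - 2 * C * ‖x‖) ^ 2 / (4 * C) := by
    field_simp; ring
  have h2 : 0 ≤ (k - 2 * C * ‖x‖) ^ 2 / (4 * C) := by positivity
  linarith

lemma covariance_inner_stdGaussian (v w : E) :
    cov[fun x => ⟪v, x⟫, fun x => ⟪w, x⟫; stdGaussian E] = ⟪v, w⟫ := by
  rw [← covarianceBilin_apply_eq_cov IsGaussian.memLp_two_id, covarianceBilin_stdGaussian]
  simp [innerSL_apply_apply ℝ]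

lemma map_inner_stdGaussian (v : E) :
    (stdGaussian E).map (fun x => ⟪v, x⟫) = gaussianReal 0 (‖v‖ ^ 2).toNNReal := by
  have h := IsGaussian.map_eq_gaussianReal (μ := stdGaussian E) (innerSL ℝ v)
  have hL : ‖innerSL ℝ v‖ = ‖v‖ := innerSL_apply_norm ℝ v
  rw [integral_strongDual_stdGaussian, variance_dual_stdGaussian, hL] at h
  exact h

/-- Gaussian integration by parts in the direction `v`: the component of `x` along `v` is
independent of the component orthogonal to `v`, so the one-dimensional formula applies. -/
lemma integral_inner_mul_stdGaussian (v : E) {h h' : E → ℝ} {C k : ℝ} (hk : 0 ≤ k) (hC : 0 ≤ C)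
    (hc : Continuous h) (hc' : Continuous h')
    (hd : ∀ x, HasDerivAt (fun s : ℝ => h (x + s • v)) (h' x) 0)
    (hb : ∀ x, |h x| ≤ C * Real.exp (k * ‖x‖)) (hb' : ∀ x, |h' x| ≤ C * Real.exp (k * ‖x‖)) :
    ∫ x, ⟪v, x⟫ * h x ∂stdGaussian E = ∫ x, h' x ∂stdGaussian E := by
  by_cases hv : v = 0
  · have : ∀ x, h' x = 0 := fun x => by
      have := hd x
      simp only [hv, smul_zero, add_zero] at this
      exact this.unique (hasDerivAt_const _ _)
    simp [hv, this]
  have hs : 0 < ‖v‖ ^ 2 := by positivity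
  set s := ‖v‖ ^ 2 with hs_def
  let N : E → ℝ := fun x => ⟪v, x⟫
  let L : E →L[ℝ] E := ContinuousLinearMap.id ℝ E - (innerSL ℝ v).smulRight (s⁻¹ • v)
  have hL : ∀ x, L x = x - (N x / s) • v := fun x => by
    simp [L, N, smul_smul, div_eq_mul_inv]
  have hdec : ∀ x, L x + (N x / s) • v = x := fun x => by rw [hL]; simp
  have hgl : HasGaussianLaw (fun x => (N x, L x)) (stdGaussian E) := by
    have := (IsGaussian.hasGaussianLaw_id (μ := stdGaussian E)).map_fun
      ((innerSL ℝ v).prod L)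
    simpa [N] using this
  have hind : IndepFun N L (stdGaussian E) := by
    refine hgl.indepFun_of_covariance_inner fun a y => ?_
    have e1 : (fun x => ⟪a, N x⟫) = fun x : E => ⟪a • v, x⟫ := by
      ext x; simp [N, real_inner_smul_left, mul_comm]
    have e2 : (fun x => ⟪y, L x⟫) = fun x : E => ⟪y - (⟪y, v⟫ / s) • v, x⟫ := by
      ext x
      rw [hL, inner_sub_right, inner_sub_left, real_inner_smul_left, real_inner_smul_right]
      simp only [N]; ring
    rw [e1, e2, covariance_inner_stdGaussian, real_inner_smul_left, inner_sub_right,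
      real_inner_smul_right, real_inner_self_eq_norm_sq, ← hs_def, real_inner_comm]
    field_simp; ring
  have hNm : Measurable N := by simp only [N]; fun_prop
  have hLm : Measurable L := by fun_prop
  have hprod := (indepFun_iff_map_prod_eq_prod_map_map hNm.aemeasurable hLm.aemeasurable).1 hind
  have hN : (stdGaussian E).map N = gaussianReal 0 s.toNNReal := map_inner_stdGaussian v
  have hcoe : ((s.toNNReal : ℝ≥0) : ℝ) = s := Real.coe_toNNReal _ hs.le
  have : IsProbabilityMeasure ((stdGaussian E).map L) :=
    Measure.isProbabilityMeasure_map hLm.aemeasurable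
  -- integrals of functions of `x` as iterated integrals over the two components
  have fub : ∀ F : E → ℝ, Continuous F → Integrable F (stdGaussian E) →
      ∀ G : ℝ → ℝ, Continuous G → Integrable (fun x => G (N x) * F x) (stdGaussian E) →
      ∫ x, G (N x) * F x ∂stdGaussian E = ∫ p, ∫ n, G n * F (p + (n / s) • v)
        ∂gaussianReal 0 s.toNNReal ∂((stdGaussian E).map L) := by
    intro F hF _ G hG hi
    have e : (fun x => G (N x) * F x) =
        (fun q : ℝ × E => G q.1 * F (q.2 + (q.1 / s) • v)) ∘ fun x => (N x, L x) := by
      ext x; simp [hdec]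
    have hcm : Continuous (fun q : ℝ × E => G q.1 * F (q.2 + (q.1 / s) • v)) := by fun_prop
    rw [e] at hi ⊢
    rw [← integrable_map_measure hcm.aestronglyMeasurable (hNm.prodMk hLm).aemeasurable,
      hprod, hN] at hi
    simp only [Function.comp_def]
    rw [← integral_map (φ := fun x => (N x, L x)) (hNm.prodMk hLm).aemeasurable
      (f := fun q : ℝ × E => G q.1 * F (q.2 + (q.1 / s) • v)) hcm.aestronglyMeasurable,
      hprod, hN, integral_prod_symm _ hi]
  have ih : Integrable h (stdGaussian E) :=
    ((integrable_exp_mul_norm_stdGaussian k).const_mul C).mono' hc.aestronglyMeasurable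
      (ae_of_all _ hb)
  have ih' : Integrable h' (stdGaussian E) :=
    ((integrable_exp_mul_norm_stdGaussian k).const_mul C).mono' hc'.aestronglyMeasurable
      (ae_of_all _ hb')
  have inh : Integrable (fun x => N x * h x) (stdGaussian E) := by
    refine ((integrable_exp_mul_norm_stdGaussian (k + 1)).const_mul (‖v‖ * C)).mono'
      (by fun_prop) (ae_of_all _ fun x => ?_)
    have h1 : |N x| ≤ ‖v‖ * Real.exp ‖x‖ :=
      (abs_real_inner_le_norm v x).trans (by
        gcongr; exact (le_add_of_nonneg_right zero_le_one).trans (Real.add_one_le_exp _))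
    rw [Real.norm_eq_abs, abs_mul, add_mul, one_mul, Real.exp_add]
    calc |N x| * |h x| ≤ (‖v‖ * Real.exp ‖x‖) * (C * Real.exp (k * ‖x‖)) :=
          mul_le_mul h1 (hb x) (abs_nonneg _) (by positivity)
      _ = _ := by ring
  have a1 := fub h hc ih id continuous_id inh
  have a2 := fub h' hc' ih' (fun _ => 1) continuous_const (by simpa using ih')
  simp only [one_mul, id] at a1 a2
  rw [show ∫ x, ⟪v, x⟫ * h x ∂stdGaussian E = ∫ x, N x * h x ∂stdGaussian E from rfl, a1, a2]
  congr 1; ext p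
  -- for a fixed orthogonal component `p`, this is the one-dimensional formula with variance `s`
  have hder : ∀ n : ℝ, HasDerivAt (fun n => h (p + (n / s) • v)) (s⁻¹ * h' (p + (n / s) • v)) n := by
    intro n
    have h1 := hd (p + (n / s) • v)
    have h2 : HasDerivAt (fun m : ℝ => (m - n) / s) (s⁻¹) n := by
      simpa using ((hasDerivAt_id n).sub_const n).div_const s
    have h3 : HasDerivAt (fun r : ℝ => h (p + (n / s) • v + r • v)) (h' (p + (n / s) • v))
        ((n - n) / s) := by
      rw [sub_self, zero_div]; exact h1
    have := h3.comp n h2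
    refine (this.congr_deriv (by ring)).congr_of_eventuallyEq (Eventually.of_forall fun m => ?_)
    simp only [Function.comp]
    rw [add_assoc, ← add_smul]; congr 3; ring
  have hest : ∀ F : E → ℝ, (∀ x, |F x| ≤ C * Real.exp (k * ‖x‖)) → ∀ n : ℝ,
      |F (p + (n / s) • v)| ≤ C * Real.exp (k * ‖p‖) * Real.exp (k * ‖v‖ / s * |n|) := by
    intro F hF n
    refine (hF _).trans ?_
    rw [mul_assoc, ← Real.exp_add]
    gcongr
    have : ‖p + (n / s) • v‖ ≤ ‖p‖ + |n| / s * ‖v‖ := by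
      refine (norm_add_le _ _).trans ?_
      rw [norm_smul, Real.norm_eq_abs, abs_div, abs_of_pos hs]
    calc k * ‖p + (n / s) • v‖ ≤ k * (‖p‖ + |n| / s * ‖v‖) := by gcongr
      _ = _ := by ring
  have := integral_id_mul_gaussianReal s.toNNReal (C := max 1 s⁻¹ * (C * Real.exp (k * ‖p‖)))
    (k := k * ‖v‖ / s) hder (by fun_prop)
    (fun n => (hest h hb n).trans (by
      rw [mul_assoc (max _ _)]; exact le_mul_of_one_le_left (by positivity) (le_max_left _ _)))
    (fun n => by
      rw [abs_mul, abs_of_pos (inv_pos.2 hs), mul_assoc (max _ _)]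
      exact mul_le_mul (le_max_right _ _) (hest h' hb' n) (abs_nonneg _) (by positivity))
  rw [this, hcoe, integral_const_mul, ← mul_assoc, mul_inv_cancel₀ hs.ne', one_mul]

end Stein

/-! ### Decoupling of Gaussian variables -/

/-- `f` is of class `C^n` and its derivatives of order at most `n` are bounded by `C e^{|u|}`. -/
structure ExpBdd (n : ℕ) (C : ℝ) (f : ℝ → ℝ) : Prop where
  contDiff : ContDiff ℝ n f
  bound : ∀ l ≤ n, ∀ u, |iteratedDeriv l f u| ≤ C * Real.exp |u|

namespace ExpBdd

variable {n : ℕ} {C : ℝ} {f : ℝ → ℝ}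

lemma abs_le (hf : ExpBdd n C f) (u : ℝ) : |f u| ≤ C * Real.exp |u| := by
  simpa using hf.bound 0 (Nat.zero_le _) u

lemma nonneg (hf : ExpBdd n C f) : 0 ≤ C := by
  simpa using (abs_nonneg _).trans (hf.abs_le 0)

lemma continuous (hf : ExpBdd n C f) : Continuous f := hf.contDiff.continuous

lemma deriv (hf : ExpBdd (n + 1) C f) : ExpBdd n C (deriv f) where
  contDiff := by
    have := hf.contDiff
    push_cast at this
    exact (contDiff_succ_iff_deriv.1 this).2.2
  bound l hl u := by
    rw [← iteratedDeriv_succ']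
    exact hf.bound (l + 1) (by omega) u

lemma of_le {m : ℕ} (hf : ExpBdd n C f) (h : m ≤ n) : ExpBdd m C f where
  contDiff := hf.contDiff.of_le (by exact_mod_cast h)
  bound l hl u := hf.bound l (hl.trans h) u

lemma mono {C' : ℝ} (hf : ExpBdd n C f) (h : C ≤ C') : ExpBdd n C' f where
  contDiff := hf.contDiff
  bound l hl u := (hf.bound l hl u).trans (by gcongr)

lemma hasDerivAt (hf : ExpBdd (n + 1) C f) (u : ℝ) : HasDerivAt f (_root_.deriv f u) u :=
  (hf.contDiff.differentiable (by simp) u).hasDerivAt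

lemma sub_const (hf : ExpBdd n C f) (m : ℝ) : ExpBdd n (C + |m|) (fun u => f u - m) where
  contDiff := hf.contDiff.sub contDiff_const
  bound l hl u := by
    rcases l with _ | l
    · simp only [iteratedDeriv_zero]
      have h1 := hf.abs_le u
      have h2 : 1 ≤ Real.exp |u| := Real.one_le_exp (abs_nonneg _)
      calc |f u - m| ≤ |f u| + |m| := abs_sub _ _
        _ ≤ C * Real.exp |u| + |m| * Real.exp |u| := by
            gcongr; exact le_mul_of_one_le_right (abs_nonneg _) h2
        _ = _ := by ring
    · rw [iteratedDeriv_succ', deriv_sub_const_fun, ← iteratedDeriv_succ']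
      refine (hf.bound _ hl u).trans ?_
      gcongr
      exact le_add_of_nonneg_right (abs_nonneg _)

lemma one (hC : 1 ≤ C) : ExpBdd n C (fun _ => 1) where
  contDiff := contDiff_const
  bound l _ u := by
    have : 1 ≤ Real.exp |u| := Real.one_le_exp (abs_nonneg _)
    rcases l with _ | l
    · simpa using one_le_mul_of_one_le_of_one_le hC this
    · rw [iteratedDeriv_succ']
      simp only [deriv_const', iteratedDeriv_const]
      split_ifs <;> simp <;> positivity

end ExpBdd

section Interpolation

variable {E : Type*} [NormedAddCommGroup E] [InnerProductSpace ℝ E] [FiniteDimensional ℝ E]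
  [MeasurableSpace E] [BorelSpace E]

/-- The expectation of `f(X) g(Y) h(Z)` for the jointly Gaussian variables `X = ⟪a, ·⟫`,
`Y = ⟪b, ·⟫`, `Z = ⟪c, ·⟫`, whose covariances are the inner products of `a`, `b`, `c`. -/
noncomputable def gaussTriple (f g h : ℝ → ℝ) (a b c : E) : ℝ :=
  ∫ x, f ⟪a, x⟫ * g ⟪b, x⟫ * h ⟪c, x⟫ ∂stdGaussian E

variable (E) in
/-- The exponential moment `𝔼 e^{3R‖x‖}` of the standard Gaussian measure. -/
noncomputable def expMoment (R : ℝ) : ℝ := ∫ x : E, Real.exp (3 * R * ‖x‖) ∂stdGaussian E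

lemma one_le_expMoment {R : ℝ} (hR : 0 ≤ R) : 1 ≤ expMoment E R := by
  have : ∫ _ : E, (1 : ℝ) ∂stdGaussian E ≤ expMoment E R := by
    refine integral_mono (integrable_const _) (integrable_exp_mul_norm_stdGaussian _) fun x => ?_
    exact Real.one_le_exp (by positivity)
  simpa using this

section

variable {f g h : ℝ → ℝ} {a b c : E} {C R : ℝ}

omit [FiniteDimensional ℝ E] [MeasurableSpace E] [BorelSpace E] in
lemma abs_comp_inner_le {n : ℕ} (hf : ExpBdd n C f) (ha : ‖a‖ ≤ R) (x : E) :
    |f ⟪a, x⟫| ≤ C * Real.exp (R * ‖x‖) := by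
  refine (hf.abs_le _).trans ?_
  have := hf.nonneg
  gcongr
  exact (abs_real_inner_le_norm a x).trans (by gcongr)

omit [FiniteDimensional ℝ E] [MeasurableSpace E] [BorelSpace E] in
lemma abs_triple_le {l m n : ℕ} (hf : ExpBdd l C f) (hg : ExpBdd m C g) (hh : ExpBdd n C h)
    (ha : ‖a‖ ≤ R) (hb : ‖b‖ ≤ R) (hc : ‖c‖ ≤ R) (x : E) :
    |f ⟪a, x⟫ * g ⟪b, x⟫ * h ⟪c, x⟫| ≤ C ^ 3 * Real.exp (3 * R * ‖x‖) := by
  have := hf.nonneg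
  calc |f ⟪a, x⟫ * g ⟪b, x⟫ * h ⟪c, x⟫| = |f ⟪a, x⟫| * |g ⟪b, x⟫| * |h ⟪c, x⟫| := by
        rw [abs_mul, abs_mul]
    _ ≤ (C * Real.exp (R * ‖x‖)) * (C * Real.exp (R * ‖x‖)) * (C * Real.exp (R * ‖x‖)) := by
        gcongr
        · exact abs_comp_inner_le hf ha x
        · exact abs_comp_inner_le hg hb x
        · exact abs_comp_inner_le hh hc x
    _ = C ^ 3 * (Real.exp (R * ‖x‖) * Real.exp (R * ‖x‖) * Real.exp (R * ‖x‖)) := by ring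
    _ = _ := by rw [← Real.exp_add, ← Real.exp_add]; ring_nf

lemma integrable_triple {l m n : ℕ} (hf : ExpBdd l C f) (hg : ExpBdd m C g) (hh : ExpBdd n C h)
    (a b c : E) :
    Integrable (fun x => f ⟪a, x⟫ * g ⟪b, x⟫ * h ⟪c, x⟫) (stdGaussian E) := by
  have hf' := hf.continuous
  have hg' := hg.continuous
  have hh' := hh.continuous
  refine ((integrable_exp_mul_norm_stdGaussian (3 * max ‖a‖ (max ‖b‖ ‖c‖))).const_mul
    (C ^ 3)).mono' (Continuous.aestronglyMeasurable (by fun_prop)) (ae_of_all _ fun x => ?_)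
  exact abs_triple_le hf hg hh (by simp) (by simp) (by simp) x

lemma abs_gaussTriple_le {l m n : ℕ} (hf : ExpBdd l C f) (hg : ExpBdd m C g) (hh : ExpBdd n C h)
    (ha : ‖a‖ ≤ R) (hb : ‖b‖ ≤ R) (hc : ‖c‖ ≤ R) :
    |gaussTriple f g h a b c| ≤ C ^ 3 * expMoment E R := by
  rw [gaussTriple, expMoment, ← integral_const_mul]
  refine (abs_integral_le_integral_abs).trans (integral_mono (integrable_triple hf hg hh a b c).abs
    ((integrable_exp_mul_norm_stdGaussian _).const_mul _) fun x => ?_)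
  exact abs_triple_le hf hg hh ha hb hc x

/-- The derivative of the expectation along the rotation `sin θ • c + cos θ • c'` from an orthogonal
vector `c'` to `c`, after Gaussian integration by parts. -/
lemma hasDerivAt_gaussTriple {l m n : ℕ} (hf : ExpBdd (l + 1) C f) (hg : ExpBdd (m + 1) C g)
    (hh : ExpBdd (n + 1) C h) (c' : E) (hac : ⟪a, c'⟫ = 0) (hbc : ⟪b, c'⟫ = 0) (hcc : ⟪c, c'⟫ = 0)
    (hn : ‖c'‖ = ‖c‖) (θ : ℝ) :
    HasDerivAt (fun θ => gaussTriple f g h a b (Real.sin θ • c + Real.cos θ • c'))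
      (Real.cos θ * (⟪a, c⟫ * gaussTriple (deriv f) g (deriv h) a b
          (Real.sin θ • c + Real.cos θ • c') +
        ⟪b, c⟫ * gaussTriple f (deriv g) (deriv h) a b (Real.sin θ • c + Real.cos θ • c'))) θ := by
  have hC := hf.nonneg
  have cf := hf.continuous
  have cg := hg.continuous
  have ch := hh.continuous
  have cf' := hf.deriv.continuous
  have cg' := hg.deriv.continuous
  have ch' := hh.deriv.continuous
  set R := ‖a‖ + ‖b‖ + 2 * ‖c‖ with hR
  have hRa : ‖a‖ ≤ R := by linarith [norm_nonneg a, norm_nonneg b, norm_nonneg c]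
  have hRb : ‖b‖ ≤ R := by linarith [norm_nonneg a, norm_nonneg b, norm_nonneg c]
  have hR0 : 0 ≤ R := (norm_nonneg _).trans hRa
  let w : ℝ → E := fun θ => Real.sin θ • c + Real.cos θ • c'
  let w' : ℝ → E := fun θ => Real.cos θ • c - Real.sin θ • c'
  have hcomb : ∀ p q : ℝ, |p| ≤ 1 → |q| ≤ 1 → ‖p • c + q • c'‖ ≤ R := by
    intro p q hp hq
    refine (norm_add_le _ _).trans ?_
    rw [norm_smul, norm_smul, hn, Real.norm_eq_abs, Real.norm_eq_abs]
    have := mul_le_mul_of_nonneg_right hp (norm_nonneg c)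
    have := mul_le_mul_of_nonneg_right hq (norm_nonneg c)
    linarith [norm_nonneg a, norm_nonneg b]
  have hw : ∀ θ, ‖w θ‖ ≤ R := fun θ => hcomb _ _ (Real.abs_sin_le_one _) (Real.abs_cos_le_one _)
  have hw' : ∀ θ, ‖w' θ‖ ≤ R := fun θ => by
    simp only [w', sub_eq_add_neg, ← neg_smul]
    exact hcomb _ _ (Real.abs_cos_le_one _) (by rw [abs_neg]; exact Real.abs_sin_le_one _)
  have hder : ∀ x θ, HasDerivAt (fun θ => f ⟪a, x⟫ * g ⟪b, x⟫ * h ⟪w θ, x⟫)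
      (⟪w' θ, x⟫ * (f ⟪a, x⟫ * g ⟪b, x⟫ * deriv h ⟪w θ, x⟫)) θ := by
    intro x θ
    have h1 : HasDerivAt (fun θ => ⟪w θ, x⟫) ⟪w' θ, x⟫ θ := by
      simp only [w, w', inner_add_left, inner_sub_left, real_inner_smul_left]
      exact (((Real.hasDerivAt_sin θ).mul_const _).add
        ((Real.hasDerivAt_cos θ).mul_const _)).congr_deriv (by ring)
    refine (((hh.hasDerivAt _).comp θ h1).const_mul _).congr_deriv (by ring)
  have key := (hasDerivAt_integral_of_dominated_loc_of_deriv_le (μ := stdGaussian E)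
    (F := fun θ x => f ⟪a, x⟫ * g ⟪b, x⟫ * h ⟪w θ, x⟫)
    (F' := fun θ x => ⟪w' θ, x⟫ * (f ⟪a, x⟫ * g ⟪b, x⟫ * deriv h ⟪w θ, x⟫)) (x₀ := θ)
    (s := Set.univ) (bound := fun x => R * C ^ 3 * Real.exp ((3 * R + 1) * ‖x‖)) univ_mem
    (Eventually.of_forall fun θ => (integrable_triple hf hg hh a b (w θ)).aestronglyMeasurable)
    (integrable_triple hf hg hh a b (w θ))
    (Continuous.aestronglyMeasurable (by fun_prop))
    (ae_of_all _ fun x θ _ => ?_)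
    ((integrable_exp_mul_norm_stdGaussian _).const_mul _)
    (ae_of_all _ fun x θ _ => hder x θ)).2
  swap
  · rw [Real.norm_eq_abs, abs_mul, add_mul (3 * R), one_mul, Real.exp_add]
    have h1 : |⟪w' θ, x⟫| ≤ R * Real.exp ‖x‖ :=
      (abs_real_inner_le_norm _ x).trans (mul_le_mul (hw' θ)
        ((le_add_of_nonneg_right zero_le_one).trans (Real.add_one_le_exp _)) (norm_nonneg _) hR0)
    calc _ ≤ (R * Real.exp ‖x‖) * (C ^ 3 * Real.exp (3 * R * ‖x‖)) :=
          mul_le_mul h1 (abs_triple_le hf hg hh.deriv hRa hRb (hw θ) x) (abs_nonneg _)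
            (by positivity)
      _ = _ := by ring
  refine key.congr_deriv ?_
  have hwa : ⟪a, w' θ⟫ = Real.cos θ * ⟪a, c⟫ := by
    simp [w', inner_sub_right, real_inner_smul_right, hac]
  have hwb : ⟪b, w' θ⟫ = Real.cos θ * ⟪b, c⟫ := by
    simp [w', inner_sub_right, real_inner_smul_right, hbc]
  -- the velocity is orthogonal to the interpolated vector, so `h'` is not differentiated
  have hww : ⟪w θ, w' θ⟫ = 0 := by
    simp only [w, w', inner_sub_right, inner_add_left, real_inner_smul_right,
      real_inner_smul_left, hcc, real_inner_comm c c', real_inner_self_eq_norm_sq, hn]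
    ring
  have st := integral_inner_mul_stdGaussian (w' θ)
    (h := fun x => f ⟪a, x⟫ * g ⟪b, x⟫ * deriv h ⟪w θ, x⟫)
    (h' := fun x => ⟪a, w' θ⟫ * (deriv f ⟪a, x⟫ * g ⟪b, x⟫ * deriv h ⟪w θ, x⟫) +
      ⟪b, w' θ⟫ * (f ⟪a, x⟫ * deriv g ⟪b, x⟫ * deriv h ⟪w θ, x⟫))
    (C := (1 + |⟪a, w' θ⟫| + |⟪b, w' θ⟫|) * C ^ 3) (k := 3 * R) (by positivity) (by positivity)
    (by fun_prop) (by fun_prop) (fun x => ?_) (fun x => ?_) (fun x => ?_)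
  · rw [st, integral_add ((integrable_triple hf.deriv hg hh.deriv a b _).const_mul _)
      ((integrable_triple hf hg.deriv hh.deriv a b _).const_mul _), integral_const_mul,
      integral_const_mul, hwa, hwb]
    simp only [gaussTriple, w]
    ring
  · simp only [inner_add_right, real_inner_smul_right, hww, mul_zero, add_zero]
    have h1 : ∀ a : E, HasDerivAt (fun s : ℝ => ⟪a, x⟫ + s * ⟪a, w' θ⟫) ⟪a, w' θ⟫ 0 := fun a => by
      simpa using ((hasDerivAt_id (0 : ℝ)).mul_const ⟪a, w' θ⟫).const_add ⟪a, x⟫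
    have hf1 := HasDerivAt.comp (h₂ := f) (h := fun s : ℝ => ⟪a, x⟫ + s * ⟪a, w' θ⟫) (0 : ℝ)
      (hf.hasDerivAt _) (h1 a)
    have hg1 := HasDerivAt.comp (h₂ := g) (h := fun s : ℝ => ⟪b, x⟫ + s * ⟪b, w' θ⟫) (0 : ℝ)
      (hg.hasDerivAt _) (h1 b)
    refine ((hf1.mul hg1).mul_const (deriv h ⟪w θ, x⟫)).congr_deriv ?_
    simp only [zero_mul, add_zero, Function.comp]
    ring
  · refine (abs_triple_le hf hg hh.deriv hRa hRb (hw θ) x).trans ?_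
    rw [mul_assoc (1 + |⟪a, w' θ⟫| + |⟪b, w' θ⟫|)]
    refine le_mul_of_one_le_left (by positivity) ?_
    linarith [abs_nonneg ⟪a, w' θ⟫, abs_nonneg ⟪b, w' θ⟫]
  · refine (abs_add_le _ _).trans ?_
    rw [abs_mul ⟪a, w' θ⟫, abs_mul ⟪b, w' θ⟫]
    calc _ ≤ |⟪a, w' θ⟫| * (C ^ 3 * Real.exp (3 * R * ‖x‖)) +
          |⟪b, w' θ⟫| * (C ^ 3 * Real.exp (3 * R * ‖x‖)) := by
          exact add_le_add
            (mul_le_mul_of_nonneg_left (abs_triple_le hf.deriv hg hh.deriv hRa hRb (hw θ) x)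
              (abs_nonneg _))
            (mul_le_mul_of_nonneg_left (abs_triple_le hf hg.deriv hh.deriv hRa hRb (hw θ) x)
              (abs_nonneg _))
      _ ≤ _ := by
          have : 0 ≤ C ^ 3 * Real.exp (3 * R * ‖x‖) := by positivity
          linarith

/-- If `c'` is orthogonal to `a` and `b`, then `⟪c', ·⟫` is independent of `⟪a, ·⟫`, `⟪b, ·⟫`. -/
lemma gaussTriple_of_orthogonal (f g h : ℝ → ℝ) (hf : Continuous f) (hg : Continuous g)
    (hh : Continuous h) {c' : E} (hac : ⟪a, c'⟫ = 0) (hbc : ⟪b, c'⟫ = 0) :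
    gaussTriple f g h a b c' =
      (∫ x, f ⟪a, x⟫ * g ⟪b, x⟫ ∂stdGaussian E) * ∫ x, h ⟪c', x⟫ ∂stdGaussian E := by
  have hgl : HasGaussianLaw (fun x : E => ((⟪a, x⟫, ⟪b, x⟫), ⟪c', x⟫)) (stdGaussian E) := by
    have := (IsGaussian.hasGaussianLaw_id (μ := stdGaussian E)).map_fun
      (((innerSL ℝ a).prod (innerSL ℝ b)).prod (innerSL ℝ c'))
    simpa using this
  have hind : IndepFun (fun x : E => (⟪a, x⟫, ⟪b, x⟫)) (fun x => ⟪c', x⟫) (stdGaussian E) := by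
    refine hgl.indepFun_of_covariance_strongDual fun L₁ L₂ => ?_
    have e1 : L₁ ∘ (fun x : E => (⟪a, x⟫, ⟪b, x⟫)) =
        fun x => ⟪L₁ (1, 0) • a + L₁ (0, 1) • b, x⟫ := by
      ext x
      have : ((⟪a, x⟫, ⟪b, x⟫) : ℝ × ℝ) = ⟪a, x⟫ • (1, 0) + ⟪b, x⟫ • (0, 1) := by simp
      simp only [Function.comp, this, map_add, map_smul, inner_add_left, real_inner_smul_left,
        smul_eq_mul]
      ring
    have e2 : L₂ ∘ (fun x : E => ⟪c', x⟫) = fun x => ⟪L₂ 1 • c', x⟫ := by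
      ext x
      have : ⟪c', x⟫ = ⟪c', x⟫ • (1 : ℝ) := by simp
      simp only [Function.comp]
      rw [this, map_smul, real_inner_smul_left, smul_eq_mul]; ring
    rw [e1, e2, covariance_inner_stdGaussian]
    simp [inner_add_left, real_inner_smul_left, real_inner_smul_right, hac, hbc]
  have hfg : Continuous (fun p : ℝ × ℝ => f p.1 * g p.2) := by fun_prop
  have := hind.comp hfg.measurable hh.measurable
  exact this.integral_fun_mul_eq_mul_integral
    (Continuous.aestronglyMeasurable (by simp only [Function.comp_def]; fun_prop))
    (Continuous.aestronglyMeasurable (by simp only [Function.comp_def]; fun_prop))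

lemma integral_comp_inner_eq (h : ℝ → ℝ) (hh : Continuous h) (c : E) :
    ∫ x, h ⟪c, x⟫ ∂stdGaussian E = ∫ u, h u ∂gaussianReal 0 (‖c‖ ^ 2).toNNReal := by
  rw [← map_inner_stdGaussian, integral_map (Continuous.aemeasurable (by fun_prop))
    hh.aestronglyMeasurable]

lemma integral_comp_inner_eq_zero_of_odd {h : ℝ → ℝ} (hh : Continuous h)
    (hodd : ∀ u, h (-u) = -h u) (c : E) : ∫ x, h ⟪c, x⟫ ∂stdGaussian E = 0 := by
  rw [integral_comp_inner_eq h hh]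
  have h1 : ∫ u, h u ∂gaussianReal 0 (‖c‖ ^ 2).toNNReal =
      ∫ u, h (-u) ∂gaussianReal 0 (‖c‖ ^ 2).toNNReal := by
    conv_lhs => rw [← neg_zero, ← gaussianReal_map_neg]
    rw [integral_map (by fun_prop) hh.aestronglyMeasurable]
  simp only [hodd, integral_neg] at h1
  linarith

omit [MeasurableSpace E] [BorelSpace E] in
lemma exists_orthogonal_norm_eq (hE : 3 < Module.finrank ℝ E) (a b c : E) :
    ∃ c' : E, ⟪a, c'⟫ = 0 ∧ ⟪b, c'⟫ = 0 ∧ ⟪c, c'⟫ = 0 ∧ ‖c'‖ = ‖c‖ := by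
  let W := Submodule.span ℝ (Set.range ![a, b, c])
  have h1 : Module.finrank ℝ W ≤ 3 :=
    finrank_range_le_card (R := ℝ) ![a, b, c]
  have h2 := W.finrank_add_finrank_orthogonal
  have : Nontrivial Wᗮ := Module.nontrivial_of_finrank_pos (R := ℝ) (by omega)
  obtain ⟨⟨u, hu⟩, hu0⟩ := exists_ne (0 : Wᗮ)
  have hu0 : u ≠ 0 := fun h => hu0 (by simp [h])
  have hn : 0 < ‖u‖ := norm_pos_iff.2 hu0
  rw [Submodule.mem_orthogonal] at hu
  have key : ∀ i, ⟪![a, b, c] i, u⟫ = 0 := fun i => hu _ (Submodule.subset_span ⟨i, rfl⟩)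
  refine ⟨(‖c‖ / ‖u‖) • u, ?_, ?_, ?_, ?_⟩
  · rw [real_inner_smul_right, show ⟪a, u⟫ = 0 from key 0, mul_zero]
  · rw [real_inner_smul_right, show ⟪b, u⟫ = 0 from key 1, mul_zero]
  · rw [real_inner_smul_right, show ⟪c, u⟫ = 0 from key 2, mul_zero]
  · rw [norm_smul, norm_div, norm_norm, norm_norm]; field_simp

/-- Decoupling the third variable: interpolating between `⟪c, ·⟫` and an independent copy, the
error is controlled by the covariances times expectations with differentiated functions. -/
lemma abs_gaussTriple_sub_le (hE : 3 < Module.finrank ℝ E) {l m n : ℕ}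
    (hf : ExpBdd (l + 1) C f) (hg : ExpBdd (m + 1) C g)
    (hh : ExpBdd (n + 1) C h) (a b c : E) {M₁ M₂ : ℝ}
    (h₁ : ∀ w : E, ‖w‖ = ‖c‖ → |⟪a, w⟫| ≤ |⟪a, c⟫| → |⟪b, w⟫| ≤ |⟪b, c⟫| →
      |gaussTriple (deriv f) g (deriv h) a b w| ≤ M₁)
    (h₂ : ∀ w : E, ‖w‖ = ‖c‖ → |⟪a, w⟫| ≤ |⟪a, c⟫| → |⟪b, w⟫| ≤ |⟪b, c⟫| →
      |gaussTriple f (deriv g) (deriv h) a b w| ≤ M₂) :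
    |gaussTriple f g h a b c -
      (∫ x, f ⟪a, x⟫ * g ⟪b, x⟫ ∂stdGaussian E) * ∫ x, h ⟪c, x⟫ ∂stdGaussian E| ≤
      2 * (|⟪a, c⟫| * M₁ + |⟪b, c⟫| * M₂) := by
  obtain ⟨c', hac, hbc, hcc, hn⟩ := exists_orthogonal_norm_eq hE a b c
  have hM₁ : 0 ≤ M₁ := (abs_nonneg _).trans (h₁ c rfl le_rfl le_rfl)
  have hM₂ : 0 ≤ M₂ := (abs_nonneg _).trans (h₂ c rfl le_rfl le_rfl)
  have hw : ∀ θ : ℝ, ‖Real.sin θ • c + Real.cos θ • c'‖ = ‖c‖ := fun θ => by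
    rw [← sq_eq_sq₀ (norm_nonneg _) (norm_nonneg _), norm_add_sq_real, norm_smul, norm_smul,
      real_inner_smul_left, real_inner_smul_right, hcc, hn]
    simp only [Real.norm_eq_abs, mul_pow, sq_abs]
    linear_combination ‖c‖ ^ 2 * Real.sin_sq_add_cos_sq θ
  have hin : ∀ d : E, ⟪d, c'⟫ = 0 → ∀ θ : ℝ,
      |⟪d, Real.sin θ • c + Real.cos θ • c'⟫| ≤ |⟪d, c⟫| := fun d hd θ => by
    rw [inner_add_right, real_inner_smul_right, real_inner_smul_right, hd, mul_zero, add_zero,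
      abs_mul]
    exact mul_le_of_le_one_left (abs_nonneg _) (Real.abs_sin_le_one θ)
  have key := Convex.norm_image_sub_le_of_norm_hasDerivWithin_le (𝕜 := ℝ)
    (f := fun θ => gaussTriple f g h a b (Real.sin θ • c + Real.cos θ • c'))
    (C := |⟪a, c⟫| * M₁ + |⟪b, c⟫| * M₂) (s := Set.univ) (x := 0) (y := Real.pi / 2)
    (fun θ _ => (hasDerivAt_gaussTriple hf hg hh c' hac hbc hcc hn θ).hasDerivWithinAt)
    (fun θ _ => by
      rw [Real.norm_eq_abs, abs_mul]
      refine (mul_le_of_le_one_left (abs_nonneg _) (Real.abs_cos_le_one θ)).trans ?_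
      refine (abs_add_le _ _).trans ?_
      rw [abs_mul, abs_mul]
      exact add_le_add
        (mul_le_mul_of_nonneg_left (h₁ _ (hw θ) (hin a hac θ) (hin b hbc θ)) (abs_nonneg _))
        (mul_le_mul_of_nonneg_left (h₂ _ (hw θ) (hin a hac θ) (hin b hbc θ)) (abs_nonneg _)))
    convex_univ (Set.mem_univ _) (Set.mem_univ _)
  simp only [Real.sin_pi_div_two, Real.cos_pi_div_two, Real.sin_zero, Real.cos_zero, one_smul,
    zero_smul, add_zero, zero_add, sub_zero, Real.norm_eq_abs] at key
  rw [gaussTriple_of_orthogonal f g h hf.continuous hg.continuous hh.continuous hac hbc,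
    integral_comp_inner_eq h hh.continuous c', hn, ← integral_comp_inner_eq h hh.continuous c] at key
  refine key.trans ?_
  rw [mul_comm]
  gcongr
  rw [abs_of_pos (by positivity)]
  linarith [Real.pi_le_four]

/-- The covariance of two functions: the case of the constant function in the first variable. -/
lemma abs_integral_mul_sub_le (hE : 3 < Module.finrank ℝ E) {m n : ℕ} (hC : 1 ≤ C)
    (hg : ExpBdd (m + 1) C g) (hh : ExpBdd (n + 1) C h) (hb : ‖b‖ ≤ R) (hc : ‖c‖ ≤ R) :
    |∫ x, g ⟪b, x⟫ * h ⟪c, x⟫ ∂stdGaussian E -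
      (∫ x, g ⟪b, x⟫ ∂stdGaussian E) * ∫ x, h ⟪c, x⟫ ∂stdGaussian E| ≤
      2 * (|⟪b, c⟫| * (C ^ 3 * expMoment E R)) := by
  have hR : 0 ≤ R := (norm_nonneg _).trans hb
  have h1 : ExpBdd 1 C (fun _ => 1) := ExpBdd.one hC
  have := abs_gaussTriple_sub_le hE (l := 0) h1 hg hh (0 : E) b c
    (M₁ := C ^ 3 * expMoment E R) (M₂ := C ^ 3 * expMoment E R)
    (fun w hw _ _ => abs_gaussTriple_le h1.deriv hg hh.deriv (by simpa) hb (hw.trans_le hc))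
    (fun w hw _ _ => abs_gaussTriple_le h1 hg.deriv hh.deriv (by simpa) hb (hw.trans_le hc))
  simpa [gaussTriple] using this

lemma deriv_odd_of_even {f : ℝ → ℝ} (hf : ∀ u, f (-u) = f u) (u : ℝ) : deriv f (-u) = -deriv f u := by
  have := deriv_comp_neg f u
  rw [show (fun x => f (-x)) = f from funext hf] at this
  rw [this, neg_neg]

lemma abs_integral_le_of_expBdd {n : ℕ} (hC : 1 ≤ C) (hh : ExpBdd n C h) (hc : ‖c‖ ≤ R) :
    |∫ x, h ⟪c, x⟫ ∂stdGaussian E| ≤ C ^ 3 * expMoment E R := by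
  have hR : 0 ≤ R := (norm_nonneg _).trans hc
  have h1 : ExpBdd 0 C (fun _ => 1) := ExpBdd.one hC
  have := abs_gaussTriple_le (E := E) h1 h1 hh (a := 0) (b := 0) (by simpa) (by simpa) hc
  simpa [gaussTriple] using this

/-- The key Gaussian estimate. Decoupling the third variable three times, the first two orders
carry a factor `|⟪a, c⟫| + |⟪b, c⟫|` each; at first order the decoupled term vanishes since `h'` is
odd, and at second order it is a covariance of functions of the first two variables. -/
lemma abs_gaussTriple_le_of_even (hE : 3 < Module.finrank ℝ E) (hC : 1 ≤ C)
    (hf : ExpBdd 4 C f) (hg : ExpBdd 4 C g) (hh : ExpBdd 4 C h)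
    (ef : ∀ u, f (-u) = f u) (eg : ∀ u, g (-u) = g u) (eh : ∀ u, h (-u) = h u)
    (ha : ‖a‖ ≤ R) (hb : ‖b‖ ≤ R) (hc : ‖c‖ ≤ R)
    (mf : ∫ x, f ⟪a, x⟫ ∂stdGaussian E = 0) (mg : ∫ x, g ⟪b, x⟫ ∂stdGaussian E = 0)
    (mh : ∫ x, h ⟪c, x⟫ ∂stdGaussian E = 0) :
    |gaussTriple f g h a b c| ≤ 8 * (C ^ 3 * expMoment E R) * (1 + C ^ 3 * expMoment E R) *
      (|⟪a, c⟫| + |⟪b, c⟫|) ^ 2 * (|⟪a, b⟫| + |⟪a, c⟫| + |⟪b, c⟫|) := by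
  have hR : 0 ≤ R := (norm_nonneg _).trans ha
  set D := C ^ 3 * expMoment E R with hD
  have hD0 : 0 ≤ D := by have := one_le_expMoment (E := E) hR; positivity
  set p := |⟪a, c⟫| + |⟪b, c⟫| with hp
  have hp0 : 0 ≤ p := by positivity
  set s := |⟪a, b⟫| with hs
  have hs0 : 0 ≤ s := abs_nonneg _
  have hf1 := hf.deriv
  have hf2 := hf1.deriv
  have hf3 := hf2.deriv
  have hg1 := hg.deriv
  have hg2 := hg1.deriv
  have hg3 := hg2.deriv
  have hh1 := hh.deriv
  have hh2 := hh1.deriv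
  have hh3 := hh2.deriv
  -- decoupling `h''` leaves the covariance of `F` and `G`, since one of their means vanishes
  have second : ∀ F G : ℝ → ℝ, ExpBdd 2 C F → ExpBdd 2 C G →
      (∫ x, F ⟪a, x⟫ ∂stdGaussian E) * (∫ x, G ⟪b, x⟫ ∂stdGaussian E) = 0 →
      ∀ w : E, ‖w‖ = ‖c‖ → |⟪a, w⟫| ≤ |⟪a, c⟫| → |⟪b, w⟫| ≤ |⟪b, c⟫| →
        |gaussTriple F G (deriv (deriv h)) a b w| ≤ 2 * D * (1 + D) * (s + p) := by
    intro F G hF hG h0 w hw hwa hwb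
    have hwR : ‖w‖ ≤ R := hw.trans_le hc
    have h1 := abs_gaussTriple_sub_le hE hF hG hh2 a b w (M₁ := D) (M₂ := D)
      (fun w' hw' _ _ => abs_gaussTriple_le hF.deriv hG hh3 ha hb (hw'.trans_le hwR))
      (fun w' hw' _ _ => abs_gaussTriple_le hF hG.deriv hh3 ha hb (hw'.trans_le hwR))
    have h2 := abs_integral_mul_sub_le (E := E) hE hC hF hG ha hb
    rw [h0, sub_zero] at h2
    have h3 := abs_integral_le_of_expBdd (E := E) hC hh2 hwR
    have h4 := abs_sub_abs_le_abs_sub (gaussTriple F G (deriv (deriv h)) a b w)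
      ((∫ x, F ⟪a, x⟫ * G ⟪b, x⟫ ∂stdGaussian E) * ∫ x, deriv (deriv h) ⟪w, x⟫ ∂stdGaussian E)
    rw [abs_mul] at h4
    have h5 := mul_le_mul h2 h3 (abs_nonneg _) (by positivity)
    have h6 : |⟪a, w⟫| * D + |⟪b, w⟫| * D ≤ p * D := by
      rw [← add_mul]; gcongr; exact add_le_add hwa hwb
    rw [← hD, ← hs] at h5
    have h7 : 0 ≤ D * p * D := by positivity
    have h8 : 0 ≤ D * s := by positivity
    nlinarith
  -- decoupling `h'` leaves nothing, since `h'` is odd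
  have first : ∀ F G : ℝ → ℝ, ExpBdd 3 C F → ExpBdd 3 C G →
      (∫ x, deriv F ⟪a, x⟫ ∂stdGaussian E) * (∫ x, G ⟪b, x⟫ ∂stdGaussian E) = 0 →
      (∫ x, F ⟪a, x⟫ ∂stdGaussian E) * (∫ x, deriv G ⟪b, x⟫ ∂stdGaussian E) = 0 →
      ∀ w : E, ‖w‖ = ‖c‖ → |⟪a, w⟫| ≤ |⟪a, c⟫| → |⟪b, w⟫| ≤ |⟪b, c⟫| →
        |gaussTriple F G (deriv h) a b w| ≤ 2 * (p * (2 * D * (1 + D) * (s + p))) := by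
    intro F G hF hG h0 h0' w hw hwa hwb
    have h1 := abs_gaussTriple_sub_le hE hF hG hh1 a b w
      (fun w' hw' ha' hb' => second _ _ hF.deriv (hG.of_le (by norm_num)) h0 w' (hw'.trans hw)
        (ha'.trans hwa) (hb'.trans hwb))
      (fun w' hw' ha' hb' => second _ _ (hF.of_le (by norm_num)) hG.deriv h0' w' (hw'.trans hw)
        (ha'.trans hwa) (hb'.trans hwb))
    rw [integral_comp_inner_eq_zero_of_odd hh1.continuous (deriv_odd_of_even eh), mul_zero,
      sub_zero, ← add_mul] at h1
    refine h1.trans ?_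
    gcongr
    exact add_le_add hwa hwb
  have of' := integral_comp_inner_eq_zero_of_odd hf1.continuous (deriv_odd_of_even ef) a
  have og' := integral_comp_inner_eq_zero_of_odd hg1.continuous (deriv_odd_of_even eg) b
  have h1 := abs_gaussTriple_sub_le hE hf hg hh a b c
    (first _ _ hf1 (hg.of_le (by norm_num)) (by rw [mg, mul_zero]) (by rw [of', zero_mul]))
    (first _ _ (hf.of_le (by norm_num)) hg1 (by rw [og', mul_zero]) (by rw [mf, zero_mul]))
  rw [mh, mul_zero, sub_zero, ← add_mul, ← hp] at h1
  refine h1.trans (le_of_eq ?_)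
  rw [add_assoc, ← hp]; ring

omit [BorelSpace E] in
lemma gaussTriple_swap_right (f g h : ℝ → ℝ) (a b c : E) :
    gaussTriple f g h a b c = gaussTriple f h g a c b := by
  simp only [gaussTriple, mul_right_comm]

omit [BorelSpace E] in
lemma gaussTriple_rotate (f g h : ℝ → ℝ) (a b c : E) :
    gaussTriple f g h a b c = gaussTriple g h f b c a := by
  simp only [gaussTriple]
  congr 1; ext x; ring

end

end Interpolation

/-! ### Three jointly Gaussian variables -/

open scoped MatrixOrder in
/-- A centred Gaussian measure on a Euclidean space is a linear image of the standard one. -/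
lemma exists_map_stdGaussian_eq {ι : Type*} [Fintype ι] [DecidableEq ι]
    (μ : Measure (EuclideanSpace ℝ ι)) [IsGaussian μ] (hμ : ∫ x, x ∂μ = 0) :
    ∃ A : EuclideanSpace ℝ ι →L[ℝ] EuclideanSpace ℝ ι,
      μ = (stdGaussian (EuclideanSpace ℝ ι)).map A := by
  let b := (EuclideanSpace.basisFun ι ℝ).toBasis
  let S := LinearMap.toMatrix₂ b b (covarianceBilin μ).toBilinForm
  have hS : S.PosSemidef := by
    refine Matrix.posSemidef_iff_dotProduct_mulVec.2 ⟨?_, fun x => ?_⟩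
    · ext i j
      simp [S, LinearMap.toMatrix₂_apply, covarianceBilin_comm]
    · have := dotProduct_toMatrix₂_mulVec b b (covarianceBilin μ).toBilinForm x x
      exact (covarianceBilin_self_nonneg (μ := μ) (b.equivFun.symm x)).trans_eq this.symm
  have h : μ = multivariateGaussian 0 S := by
    apply IsGaussian.ext
    · simp [hμ]
    · rw [← ContinuousLinearMap.toBilinForm_inj]
      refine LinearMap.BilinForm.ext_basis b fun i j => ?_
      rw [ContinuousLinearMap.toBilinForm_apply, ContinuousLinearMap.toBilinForm_apply,
        covarianceBilin_multivariateGaussian hS]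
      simp [S, b, LinearMap.toMatrix₂_apply]
  refine ⟨Matrix.toEuclideanCLM (𝕜 := ℝ) (CFC.sqrt S), ?_⟩
  conv_lhs => rw [h, multivariateGaussian]
  simp only [zero_add]

section Model

variable {Ω : Type*} [MeasurableSpace Ω] {P : Measure Ω} {X Y Z : Ω → ℝ}

/-- Three centred jointly Gaussian variables have the same law as three linear forms on a
four-dimensional Gaussian space; the spare dimension leaves room for an independent copy. -/
lemma exists_gaussian_model (h : HasGaussianLaw (fun ω => (X ω, Y ω, Z ω)) P)
    (mX : ∫ ω, X ω ∂P = 0) (mY : ∫ ω, Y ω ∂P = 0) (mZ : ∫ ω, Z ω ∂P = 0) :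
    ∃ a b c : EuclideanSpace ℝ (Fin 4), P.map (fun ω => (X ω, Y ω, Z ω)) =
      (stdGaussian (EuclideanSpace ℝ (Fin 4))).map (fun x => (⟪a, x⟫, ⟪b, x⟫, ⟪c, x⟫)) := by
  have := h.isProbabilityMeasure
  let E := EuclideanSpace ℝ (Fin 4)
  let e := EuclideanSpace.basisFun (Fin 4) ℝ
  let L : ℝ × ℝ × ℝ →L[ℝ] E := (ContinuousLinearMap.fst ℝ ℝ (ℝ × ℝ)).smulRight (e 0) +
    ((ContinuousLinearMap.fst ℝ ℝ ℝ).comp (ContinuousLinearMap.snd ℝ ℝ (ℝ × ℝ))).smulRight (e 1) +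
    ((ContinuousLinearMap.snd ℝ ℝ ℝ).comp (ContinuousLinearMap.snd ℝ ℝ (ℝ × ℝ))).smulRight (e 2)
  let π : E →L[ℝ] ℝ × ℝ × ℝ := (innerSL ℝ (e 0)).prod ((innerSL ℝ (e 1)).prod (innerSL ℝ (e 2)))
  have hπL : ∀ p, π (L p) = p := fun p => by
    simp [π, L, inner_add_right, real_inner_smul_right]
  have hV := h.map_fun L
  have hg := hV.isGaussian_map
  have hX : Integrable X P := h.fst.integrable
  have hY : Integrable Y P := h.snd.fst.integrable
  have hZ : Integrable Z P := h.snd.snd.integrable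
  have hmean : ∫ x, x ∂(P.map fun ω => L (X ω, Y ω, Z ω)) = 0 := by
    rw [integral_map hV.aemeasurable (by fun_prop), L.integral_comp_comm h.integrable]
    rw [integral_pair hX (hY.prodMk hZ), integral_pair hY hZ, mX, mY, mZ]
    exact map_zero L
  obtain ⟨A, hA⟩ := exists_map_stdGaussian_eq _ hmean
  refine ⟨A.adjoint (e 0), A.adjoint (e 1), A.adjoint (e 2), ?_⟩
  have h1 : P.map (fun ω => (X ω, Y ω, Z ω)) = (P.map fun ω => L (X ω, Y ω, Z ω)).map π := by
    rw [AEMeasurable.map_map_of_aemeasurable (by fun_prop) hV.aemeasurable]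
    congr 1
    ext1 ω
    exact (hπL _).symm
  rw [h1, hA, Measure.map_map (by fun_prop) (by fun_prop)]
  congr 1
  ext1 x
  simp [π, ContinuousLinearMap.adjoint_inner_left]

lemma integral_inner_mul_inner_stdGaussian {E : Type*} [NormedAddCommGroup E]
    [InnerProductSpace ℝ E] [FiniteDimensional ℝ E] [MeasurableSpace E] [BorelSpace E] (a b : E) :
    ∫ x, ⟪a, x⟫ * ⟪b, x⟫ ∂stdGaussian E = ⟪a, b⟫ := by
  have hm : ∀ a : E, MemLp (fun x => ⟪a, x⟫) 2 (stdGaussian E) := fun a =>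
    ((IsGaussian.hasGaussianLaw_id (μ := stdGaussian E)).map_fun (innerSL ℝ a)).memLp_two
  have h0 : ∀ a : E, ∫ x, ⟪a, x⟫ ∂stdGaussian E = 0 := fun a =>
    integral_strongDual_stdGaussian (innerSL ℝ a)
  have := covariance_eq_sub (hm a) (hm b)
  rw [covariance_inner_stdGaussian, h0, zero_mul, sub_zero] at this
  exact this.symm

/-- The constant in `abs_integral_cent_mul_le`. -/
noncomputable def tripleConst (C R : ℝ) : ℝ :=
  let M := expMoment (EuclideanSpace ℝ (Fin 4)) R
  let D := (C + C ^ 3 * M) ^ 3 * M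
  8 * D * (1 + D)

variable {f g h : ℝ → ℝ} {C R r₁₂ r₁₃ r₂₃ : ℝ}

/-- The three-point estimate: for even functions of jointly Gaussian variables, the expectation of
the product of the recentred variables is of third order in the covariances, and of second order
in the covariances of any one of the variables with the other two. -/
lemma abs_integral_cent_mul_le (hG : HasGaussianLaw (fun ω => (X ω, Y ω, Z ω)) P)
    (mX : ∫ ω, X ω ∂P = 0) (mY : ∫ ω, Y ω ∂P = 0) (mZ : ∫ ω, Z ω ∂P = 0) (hC : 1 ≤ C) (hR : 0 ≤ R)
    (hf : ExpBdd 4 C f) (hg : ExpBdd 4 C g) (hh : ExpBdd 4 C h)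
    (ef : ∀ u, f (-u) = f u) (eg : ∀ u, g (-u) = g u) (eh : ∀ u, h (-u) = h u)
    (vX : ∫ ω, X ω * X ω ∂P ≤ R ^ 2) (vY : ∫ ω, Y ω * Y ω ∂P ≤ R ^ 2)
    (vZ : ∫ ω, Z ω * Z ω ∂P ≤ R ^ 2) (h₁₂ : |∫ ω, X ω * Y ω ∂P| ≤ r₁₂)
    (h₁₃ : |∫ ω, X ω * Z ω ∂P| ≤ r₁₃) (h₂₃ : |∫ ω, Y ω * Z ω ∂P| ≤ r₂₃) :
    Integrable (fun ω => cent P (fun ω => f (X ω)) ω * cent P (fun ω => g (Y ω)) ω *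
      cent P (fun ω => h (Z ω)) ω) P ∧
    let I := |∫ ω, cent P (fun ω => f (X ω)) ω * cent P (fun ω => g (Y ω)) ω *
      cent P (fun ω => h (Z ω)) ω ∂P|
    I ≤ tripleConst C R * (r₁₃ + r₂₃) ^ 2 * (r₁₂ + r₁₃ + r₂₃) ∧
    I ≤ tripleConst C R * (r₁₂ + r₂₃) ^ 2 * (r₁₂ + r₁₃ + r₂₃) ∧
    I ≤ tripleConst C R * (r₁₂ + r₁₃) ^ 2 * (r₁₂ + r₁₃ + r₂₃) := by
  obtain ⟨a, b, c, hlaw⟩ := exists_gaussian_model hG mX mY mZ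
  have hE : 3 < Module.finrank ℝ (EuclideanSpace ℝ (Fin 4)) := by simp
  set γ := stdGaussian (EuclideanSpace ℝ (Fin 4)) with hγ
  have hlm : Measurable (fun x : EuclideanSpace ℝ (Fin 4) => (⟪a, x⟫, ⟪b, x⟫, ⟪c, x⟫)) := by
    fun_prop
  have tr : ∀ Φ : ℝ × ℝ × ℝ → ℝ, Continuous Φ →
      ∫ ω, Φ (X ω, Y ω, Z ω) ∂P = ∫ x, Φ (⟪a, x⟫, ⟪b, x⟫, ⟪c, x⟫) ∂γ := by
    intro Φ hΦ
    rw [← integral_map hG.aemeasurable hΦ.aestronglyMeasurable, hlaw,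
      integral_map hlm.aemeasurable hΦ.aestronglyMeasurable]
  have cf := hf.continuous
  have cg := hg.continuous
  have ch := hh.continuous
  have e12 : ∫ ω, X ω * Y ω ∂P = ⟪a, b⟫ := by
    rw [← integral_inner_mul_inner_stdGaussian]; exact tr (fun p => p.1 * p.2.1) (by fun_prop)
  have e13 : ∫ ω, X ω * Z ω ∂P = ⟪a, c⟫ := by
    rw [← integral_inner_mul_inner_stdGaussian]; exact tr (fun p => p.1 * p.2.2) (by fun_prop)
  have e23 : ∫ ω, Y ω * Z ω ∂P = ⟪b, c⟫ := by
    rw [← integral_inner_mul_inner_stdGaussian]; exact tr (fun p => p.2.1 * p.2.2) (by fun_prop)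
  have na : ‖a‖ ≤ R := by
    refine le_of_sq_le_sq ?_ hR
    rw [← real_inner_self_eq_norm_sq, ← integral_inner_mul_inner_stdGaussian]
    exact (tr (fun p => p.1 * p.1) (by fun_prop)).symm.trans_le vX
  have nb : ‖b‖ ≤ R := by
    refine le_of_sq_le_sq ?_ hR
    rw [← real_inner_self_eq_norm_sq, ← integral_inner_mul_inner_stdGaussian]
    exact (tr (fun p => p.2.1 * p.2.1) (by fun_prop)).symm.trans_le vY
  have nc : ‖c‖ ≤ R := by
    refine le_of_sq_le_sq ?_ hR
    rw [← real_inner_self_eq_norm_sq, ← integral_inner_mul_inner_stdGaussian]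
    exact (tr (fun p => p.2.2 * p.2.2) (by fun_prop)).symm.trans_le vZ
  rw [e12] at h₁₂
  rw [e13] at h₁₃
  rw [e23] at h₂₃
  set M := expMoment (EuclideanSpace ℝ (Fin 4)) R with hM
  have hM1 : 1 ≤ M := one_le_expMoment hR
  -- recentring preserves the exponential bounds, with a larger constant
  have mean : ∀ (F : ℝ → ℝ) (hF : ExpBdd 4 C F) (d : EuclideanSpace ℝ (Fin 4)), ‖d‖ ≤ R →
      ExpBdd 4 (C + C ^ 3 * M) (fun u => F u - ∫ x, F ⟪d, x⟫ ∂γ) ∧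
      ∫ x, (F ⟪d, x⟫ - ∫ x, F ⟪d, x⟫ ∂γ) ∂γ = 0 := by
    intro F hF d hd
    refine ⟨(hF.sub_const _).mono ?_, ?_⟩
    · gcongr; exact abs_integral_le_of_expBdd hC hF hd
    · have h1 : ExpBdd 0 C (fun _ => 1) := ExpBdd.one hC
      have hi : Integrable (fun x => F ⟪d, x⟫) γ := by
        simpa using integrable_triple h1 h1 hF (0 : EuclideanSpace ℝ (Fin 4)) 0 d
      rw [integral_sub hi (integrable_const _)]
      simp
  obtain ⟨hf', mf⟩ := mean f hf a na
  obtain ⟨hg', mg⟩ := mean g hg b nb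
  obtain ⟨hh', mh⟩ := mean h hh c nc
  have emf : ∫ ω, f (X ω) ∂P = ∫ x, f ⟪a, x⟫ ∂γ := tr (fun p => f p.1) (by fun_prop)
  have emg : ∫ ω, g (Y ω) ∂P = ∫ x, g ⟪b, x⟫ ∂γ := tr (fun p => g p.2.1) (by fun_prop)
  have emh : ∫ ω, h (Z ω) ∂P = ∫ x, h ⟪c, x⟫ ∂γ := tr (fun p => h p.2.2) (by fun_prop)
  simp -zeta only [cent, emf, emg, emh]
  set f' := fun u => f u - ∫ x, f ⟪a, x⟫ ∂γ with hf'_def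
  set g' := fun u => g u - ∫ x, g ⟪b, x⟫ ∂γ with hg'_def
  set h' := fun u => h u - ∫ x, h ⟪c, x⟫ ∂γ with hh'_def
  have cΦ : Continuous (fun p : ℝ × ℝ × ℝ => f' p.1 * g' p.2.1 * h' p.2.2) := by fun_prop
  have hC' : 1 ≤ C + C ^ 3 * M := hC.trans (le_add_of_nonneg_right (by positivity))
  have eI := tr _ cΦ
  have ef' : ∀ u, f' (-u) = f' u := fun u => by simp [f', ef]
  have eg' : ∀ u, g' (-u) = g' u := fun u => by simp [g', eg]
  have eh' : ∀ u, h' (-u) = h' u := fun u => by simp [h', eh]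
  refine ⟨?_, ?_⟩
  · have := integrable_triple hf' hg' hh' a b c
    have h2 : Integrable (fun p : ℝ × ℝ × ℝ => f' p.1 * g' p.2.1 * h' p.2.2)
        (P.map (fun ω => (X ω, Y ω, Z ω))) := by
      rw [hlaw, integrable_map_measure cΦ.aestronglyMeasurable hlm.aemeasurable]
      exact this
    rw [integrable_map_measure cΦ.aestronglyMeasurable hG.aemeasurable] at h2
    exact h2
  · intro I
    have hI : I = |gaussTriple f' g' h' a b c| := congrArg abs eI
    have hk : 0 ≤ tripleConst C R := by simp only [tripleConst]; positivity
    -- each of the three variables is decoupled in turn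
    have b1 := abs_gaussTriple_le_of_even hE hC' hf' hg' hh' ef' eg' eh' na nb nc mf mg mh
    have b2 := abs_gaussTriple_le_of_even hE hC' hf' hh' hg' ef' eh' eg' na nc nb mf mh mg
    have b3 := abs_gaussTriple_le_of_even hE hC' hg' hh' hf' eg' eh' ef' nb nc na mg mh mf
    rw [← gaussTriple_swap_right, ← hI, real_inner_comm b c] at b2
    rw [← gaussTriple_rotate, ← hI, real_inner_comm a b, real_inner_comm a c] at b3
    rw [← hI] at b1
    refine ⟨b1.trans ?_, b2.trans ?_, b3.trans ?_⟩
    · change tripleConst C R * _ * _ ≤ _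
      gcongr
    · change tripleConst C R * _ * _ ≤ _
      rw [add_comm r₁₂ r₁₃]
      gcongr
    · change tripleConst C R * _ * _ ≤ _
      rw [show r₁₂ + r₁₃ + r₂₃ = r₂₃ + r₁₂ + r₁₃ by ring]
      gcongr

end Model

section Continuity

variable {Ω : Type*} [MeasurableSpace Ω] {P : Measure Ω} [IsProbabilityMeasure P]

omit [IsProbabilityMeasure P] in
lemma integral_mul_le_sqrt_mul_sqrt {f g : Ω → ℝ} (hf0 : ∀ ω, 0 ≤ f ω) (hg0 : ∀ ω, 0 ≤ g ω)
    (hf : MemLp f 2 P) (hg : MemLp g 2 P) :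
    ∫ ω, f ω * g ω ∂P ≤ √(∫ ω, f ω ^ 2 ∂P) * √(∫ ω, g ω ^ 2 ∂P) := by
  have := integral_mul_le_Lp_mul_Lq_of_nonneg (μ := P) Real.HolderConjugate.two_two
    (ae_of_all _ hf0) (ae_of_all _ hg0) (by simpa using hf) (by simpa using hg)
  simpa [Real.sqrt_eq_rpow] using this

lemma ExpBdd.abs_sub_le {f : ℝ → ℝ} {C : ℝ} (hf : ExpBdd 1 C f) (x y : ℝ) :
    |f x - f y| ≤ C * |x - y| * Real.exp (|x| + |y|) := by
  have hC := hf.nonneg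
  have := Convex.norm_image_sub_le_of_norm_hasDerivWithin_le (𝕜 := ℝ) (f := f)
    (C := C * Real.exp (|x| + |y|)) (s := Set.uIcc y x) (x := y) (y := x)
    (fun z _ => (hf.hasDerivAt z).hasDerivWithinAt)
    (fun z hz => by
      refine (hf.deriv.abs_le z).trans ?_
      gcongr
      have h1 := abs_le_max_abs_abs (Set.uIcc_subset_Icc (a₂ := min y x) (b₂ := max y x)
        (by simp) (by simp) hz).1 (Set.uIcc_subset_Icc (a₂ := min y x) (b₂ := max y x)
        (by simp) (by simp) hz).2
      refine h1.trans (max_le ?_ ?_)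
      · rcases min_choice y x with h | h <;> rw [h] <;> simp
      · rcases max_choice y x with h | h <;> rw [h] <;> simp)
    (convex_uIcc _ _) (by simp) (by simp)
  rw [Real.norm_eq_abs, Real.norm_eq_abs] at this
  linarith

/-- Expectations of triple products depend continuously on the points of the process, if the
process has constant variance and is continuous in mean square. -/
lemma continuous_integral_triple {T : Type*} [TopologicalSpace T] {U : T → Ω → ℝ} {v : ℝ≥0}
    (hm : ∀ t, AEMeasurable (U t) P) (hlaw : ∀ t, P.map (U t) = gaussianReal 0 v)
    (hc : ∀ t, Tendsto (fun s => ∫ ω, (U s ω - U t ω) ^ 2 ∂P) (𝓝 t) (𝓝 0))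
    {f g h : ℝ → ℝ} {C : ℝ} (hf : ExpBdd 1 C f) (hg : ExpBdd 1 C g) (hh : ExpBdd 1 C h) (x : T) :
    Continuous fun p : T × T => ∫ ω, f (U x ω) * g (U p.1 ω) * h (U p.2 ω) ∂P := by
  have hC := hf.nonneg
  set K := ∫ u, Real.exp (10 * |u|) ∂gaussianReal 0 v with hK
  have hcexp : Continuous fun u : ℝ => Real.exp (10 * |u|) := by fun_prop
  have iexp : ∀ t, Integrable (fun ω => Real.exp (10 * |U t ω|)) P := fun t => by
    have := integrable_exp_mul_abs_gaussianReal v 10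
    rw [← hlaw t, integrable_map_measure hcexp.aestronglyMeasurable (hm t)] at this
    exact this
  have eexp : ∀ t, ∫ ω, Real.exp (10 * |U t ω|) ∂P = K := fun t => by
    rw [hK, ← hlaw t, integral_map (hm t) hcexp.aestronglyMeasurable]
  -- a square integrable variable that dominates all the exponentials in the bounds below
  let B : T × T → T × T → Ω → ℝ := fun p q ω =>
    Real.exp (|U x ω| + |U p.1 ω| + |U p.2 ω| + |U q.1 ω| + |U q.2 ω|)
  have B0 : ∀ p q ω, 0 ≤ B p q ω := fun p q ω => (Real.exp_pos _).le
  have hBm : ∀ p q, AEMeasurable (B p q) P := fun p q => by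
    have := hm x; have := hm p.1; have := hm p.2; have := hm q.1; have := hm q.2
    simp only [B]; fun_prop
  have hB2 : ∀ p q ω, B p q ω ^ 2 ≤ Real.exp (10 * |U x ω|) + Real.exp (10 * |U p.1 ω|) +
      Real.exp (10 * |U p.2 ω|) + Real.exp (10 * |U q.1 ω|) + Real.exp (10 * |U q.2 ω|) := by
    intro p q ω
    simp only [B, ← Real.exp_nat_mul]
    obtain ⟨m, hm1, hm2⟩ : ∃ m, |U x ω| + |U p.1 ω| + |U p.2 ω| + |U q.1 ω| + |U q.2 ω| ≤ 5 * m ∧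
        Real.exp (10 * m) ≤ Real.exp (10 * |U x ω|) + Real.exp (10 * |U p.1 ω|) +
      Real.exp (10 * |U p.2 ω|) + Real.exp (10 * |U q.1 ω|) + Real.exp (10 * |U q.2 ω|) := by
      have p1 := Real.exp_pos (10 * |U x ω|)
      have p2 := Real.exp_pos (10 * |U p.1 ω|)
      have p3 := Real.exp_pos (10 * |U p.2 ω|)
      have p4 := Real.exp_pos (10 * |U q.1 ω|)
      have p5 := Real.exp_pos (10 * |U q.2 ω|)
      obtain ⟨i, hi⟩ := Finite.exists_max
        ![|U x ω|, |U p.1 ω|, |U p.2 ω|, |U q.1 ω|, |U q.2 ω|]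
      refine ⟨![|U x ω|, |U p.1 ω|, |U p.2 ω|, |U q.1 ω|, |U q.2 ω|] i, ?_, ?_⟩
      · have h0 := hi 0; have h1 := hi 1; have h2 := hi 2; have h3 := hi 3; have h4 := hi 4
        simp only [Matrix.cons_val] at h0 h1 h2 h3 h4
        linarith
      · fin_cases i <;> simp only [Fin.reduceFinMk, Matrix.cons_val, Fin.zero_eta, Fin.mk_one] <;>
          linarith
    refine le_trans (Real.exp_le_exp.2 ?_) hm2
    push_cast; linarith
  have iB2 : ∀ p q, Integrable (fun ω => B p q ω ^ 2) P := fun p q => by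
    refine (((((iexp x).add (iexp p.1)).add (iexp p.2)).add (iexp q.1)).add (iexp q.2)).mono'
      ((hBm p q).pow_const 2).aestronglyMeasurable (ae_of_all _ fun ω => ?_)
    rw [Real.norm_of_nonneg (sq_nonneg _)]
    exact hB2 p q ω
  have hB2K : ∀ p q, ∫ ω, B p q ω ^ 2 ∂P ≤ 5 * K := fun p q => by
    refine (integral_mono (iB2 p q) (((((iexp x).add (iexp p.1)).add (iexp p.2)).add
      (iexp q.1)).add (iexp q.2)) (hB2 p q)).trans (le_of_eq ?_)
    simp only [Pi.add_apply]
    rw [integral_add, integral_add, integral_add, integral_add, eexp, eexp, eexp, eexp, eexp]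
    · ring
    all_goals first | exact iexp _ | skip
    · exact (iexp x).add (iexp p.1)
    · exact ((iexp x).add (iexp p.1)).add (iexp p.2)
    · exact (((iexp x).add (iexp p.1)).add (iexp p.2)).add (iexp q.1)
  have hBL : ∀ p q, MemLp (B p q) 2 P := fun p q =>
    (memLp_two_iff_integrable_sq (hBm p q).aestronglyMeasurable).2 (iB2 p q)
  have hUL : ∀ t, MemLp (U t) 2 P := fun t => by
    have : HasGaussianLaw (U t) P := ⟨by rw [hlaw]; infer_instance⟩
    exact this.memLp_two
  have hDL : ∀ s t, MemLp (fun ω => |U s ω - U t ω|) 2 P := fun s t =>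
    ((hUL s).sub (hUL t)).abs
  let Φ : T × T → Ω → ℝ := fun p ω => f (U x ω) * g (U p.1 ω) * h (U p.2 ω)
  have iΦ : ∀ p, Integrable (Φ p) P := fun p => by
    refine ((hBL p p).integrable (by norm_num)).const_mul (C ^ 3) |>.mono' ?_
      (ae_of_all _ fun ω => ?_)
    · have := hm x; have := hm p.1; have := hm p.2
      exact (((hf.continuous.measurable.comp_aemeasurable (hm x)).mul
        (hg.continuous.measurable.comp_aemeasurable (hm p.1))).mul
        (hh.continuous.measurable.comp_aemeasurable (hm p.2))).aestronglyMeasurable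
    · rw [Real.norm_eq_abs, abs_mul, abs_mul]
      calc _ ≤ (C * Real.exp |U x ω|) * (C * Real.exp |U p.1 ω|) * (C * Real.exp |U p.2 ω|) := by
            gcongr
            · exact hf.abs_le _
            · exact hg.abs_le _
            · exact hh.abs_le _
        _ = C ^ 3 * Real.exp (|U x ω| + |U p.1 ω| + |U p.2 ω|) := by
            rw [Real.exp_add, Real.exp_add]; ring
        _ ≤ C ^ 3 * B p p ω := by
            have := abs_nonneg (U p.1 ω); have := abs_nonneg (U p.2 ω)
            exact mul_le_mul_of_nonneg_left (Real.exp_le_exp.2 (by linarith)) (by positivity)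
  -- the two points are changed one at a time
  have hdiff : ∀ p q ω, |Φ q ω - Φ p ω| ≤
      C ^ 3 * (|U q.1 ω - U p.1 ω| * B p q ω) + C ^ 3 * (|U q.2 ω - U p.2 ω| * B p q ω) := by
    intro p q ω
    have e : Φ q ω - Φ p ω = f (U x ω) * (g (U q.1 ω) - g (U p.1 ω)) * h (U q.2 ω) +
        f (U x ω) * g (U p.1 ω) * (h (U q.2 ω) - h (U p.2 ω)) := by simp only [Φ]; ring
    rw [e]
    refine (abs_add_le _ _).trans (add_le_add ?_ ?_)
    · rw [abs_mul, abs_mul]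
      calc _ ≤ (C * Real.exp |U x ω|) *
            (C * |U q.1 ω - U p.1 ω| * Real.exp (|U q.1 ω| + |U p.1 ω|)) *
            (C * Real.exp |U q.2 ω|) := by
            gcongr
            · exact hf.abs_le _
            · exact hg.abs_sub_le _ _
            · exact hh.abs_le _
        _ = C ^ 3 * (|U q.1 ω - U p.1 ω| *
            Real.exp (|U x ω| + (|U q.1 ω| + |U p.1 ω|) + |U q.2 ω|)) := by
            rw [Real.exp_add (_ + _), Real.exp_add |U x ω|]; ring
        _ ≤ _ := by
            have := abs_nonneg (U p.2 ω)
            exact mul_le_mul_of_nonneg_left (mul_le_mul_of_nonneg_left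
              (Real.exp_le_exp.2 (by linarith)) (abs_nonneg _)) (by positivity)
    · rw [abs_mul, abs_mul]
      calc _ ≤ (C * Real.exp |U x ω|) * (C * Real.exp |U p.1 ω|) *
            (C * |U q.2 ω - U p.2 ω| * Real.exp (|U q.2 ω| + |U p.2 ω|)) := by
            gcongr
            · exact hf.abs_le _
            · exact hg.abs_le _
            · exact hh.abs_sub_le _ _
        _ = C ^ 3 * (|U q.2 ω - U p.2 ω| *
            Real.exp (|U x ω| + |U p.1 ω| + (|U q.2 ω| + |U p.2 ω|))) := by
            rw [Real.exp_add (_ + _), Real.exp_add |U x ω|]; ring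
        _ ≤ _ := by
            have := abs_nonneg (U q.1 ω)
            exact mul_le_mul_of_nonneg_left (mul_le_mul_of_nonneg_left
              (Real.exp_le_exp.2 (by linarith)) (abs_nonneg _)) (by positivity)
  rw [continuous_iff_continuousAt]
  intro p
  change Tendsto (fun q => ∫ ω, Φ q ω ∂P) (𝓝 p) (𝓝 (∫ ω, Φ p ω ∂P))
  rw [tendsto_iff_norm_sub_tendsto_zero]
  have hbound : ∀ q, ‖∫ ω, Φ q ω ∂P - ∫ ω, Φ p ω ∂P‖ ≤
      C ^ 3 * (√(∫ ω, (U q.1 ω - U p.1 ω) ^ 2 ∂P) * √(5 * K)) +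
      C ^ 3 * (√(∫ ω, (U q.2 ω - U p.2 ω) ^ 2 ∂P) * √(5 * K)) := by
    intro q
    rw [← integral_sub (iΦ q) (iΦ p)]
    have i1 : Integrable (fun ω => |U q.1 ω - U p.1 ω| * B p q ω) P :=
      (hDL q.1 p.1).integrable_mul (hBL p q)
    have i2 : Integrable (fun ω => |U q.2 ω - U p.2 ω| * B p q ω) P :=
      (hDL q.2 p.2).integrable_mul (hBL p q)
    have cs : ∀ s t, ∫ ω, |U s ω - U t ω| * B p q ω ∂P ≤
        √(∫ ω, (U s ω - U t ω) ^ 2 ∂P) * √(5 * K) := fun s t => by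
      refine (integral_mul_le_sqrt_mul_sqrt (fun _ => abs_nonneg _) (B0 p q) (hDL s t)
        (hBL p q)).trans ?_
      simp only [sq_abs]
      gcongr
      exact hB2K p q
    refine (norm_integral_le_integral_norm _).trans ((integral_mono ((iΦ q).sub (iΦ p)).norm
      ((i1.const_mul _).add (i2.const_mul _)) (hdiff p q)).trans ?_)
    simp only [Pi.add_apply]
    rw [integral_add (i1.const_mul _) (i2.const_mul _), integral_const_mul, integral_const_mul]
    gcongr
    · exact cs _ _
    · exact cs _ _
  refine squeeze_zero (fun _ => norm_nonneg _) hbound ?_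
  have t1 : Tendsto (fun q : T × T => √(∫ ω, (U q.1 ω - U p.1 ω) ^ 2 ∂P)) (𝓝 p) (𝓝 0) := by
    have := ((hc p.1).comp (continuous_fst.tendsto p)).sqrt
    simpa using this
  have t2 : Tendsto (fun q : T × T => √(∫ ω, (U q.2 ω - U p.2 ω) ^ 2 ∂P)) (𝓝 p) (𝓝 0) := by
    have := ((hc p.2).comp (continuous_snd.tendsto p)).sqrt
    simpa using this
  simpa using ((t1.mul_const (√(5 * K))).const_mul (C ^ 3)).add
    ((t2.mul_const (√(5 * K))).const_mul (C ^ 3))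

end Continuity

/-! ### The parabolic distance -/

/-- The parabolic distance to the origin on `ℝ × 𝕋`. -/
noncomputable def parNorm (z : ℝ × UnitAddCircle) : ℝ := √|z.1| + ‖z.2‖

/-- The scale-invariant weight `η / (|z| + η)`, equal to `1` at the origin and decaying like
`η / |z|` at scales larger than `η`. -/
noncomputable def decay (η : ℝ) (z : ℝ × UnitAddCircle) : ℝ := η / (parNorm z + η)

lemma parNorm_nonneg (z : ℝ × UnitAddCircle) : 0 ≤ parNorm z := by unfold parNorm; positivity

lemma parNorm_neg (z : ℝ × UnitAddCircle) : parNorm (-z) = parNorm z := by simp [parNorm]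

lemma parNorm_sub_comm (z w : ℝ × UnitAddCircle) : parNorm (z - w) = parNorm (w - z) := by
  rw [← neg_sub, parNorm_neg]

lemma parNorm_add_le (z w : ℝ × UnitAddCircle) : parNorm (z + w) ≤ parNorm z + parNorm w := by
  have h1 : √|z.1 + w.1| ≤ √|z.1| + √|w.1| := by
    refine Real.sqrt_le_iff.2 ⟨by positivity, (abs_add_le _ _).trans ?_⟩
    nlinarith [Real.sq_sqrt (abs_nonneg z.1), Real.sq_sqrt (abs_nonneg w.1),
      Real.sqrt_nonneg |z.1|, Real.sqrt_nonneg |w.1|,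
      mul_nonneg (Real.sqrt_nonneg |z.1|) (Real.sqrt_nonneg |w.1|)]
  have h2 := norm_add_le z.2 w.2
  simp only [parNorm, Prod.fst_add, Prod.snd_add]
  linarith

lemma parNorm_sub_le (x y z : ℝ × UnitAddCircle) :
    parNorm (x - z) ≤ parNorm (x - y) + parNorm (y - z) := by
  simpa using parNorm_add_le (x - y) (y - z)

lemma parNorm_zero : parNorm 0 = 0 := by simp [parNorm]

lemma parNorm_pos {z : ℝ × UnitAddCircle} (hz : z ≠ 0) : 0 < parNorm z := by
  refine (parNorm_nonneg z).lt_of_ne' fun h => hz ?_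
  unfold parNorm at h
  have h1 := Real.sqrt_nonneg |z.1|
  have h2 := norm_nonneg z.2
  have h3 : √|z.1| = 0 := by linarith
  have h4 : ‖z.2‖ = 0 := by linarith
  rw [Real.sqrt_eq_zero (abs_nonneg _), abs_eq_zero] at h3
  exact Prod.ext h3 (norm_eq_zero.1 h4)

lemma continuous_parNorm : Continuous parNorm := by unfold parNorm; fun_prop

lemma decay_pos {η : ℝ} (hη : 0 < η) (z : ℝ × UnitAddCircle) : 0 < decay η z := by
  have := parNorm_nonneg z
  unfold decay; positivity

lemma decay_le_one {η : ℝ} (hη : 0 < η) (z : ℝ × UnitAddCircle) : decay η z ≤ 1 := by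
  have := parNorm_nonneg z
  unfold decay
  rw [div_le_one (by positivity)]; linarith

lemma decay_neg (η : ℝ) (z : ℝ × UnitAddCircle) : decay η (-z) = decay η z := by
  simp [decay, parNorm_neg]

lemma measurable_decay (η : ℝ) : Measurable (decay η) := by
  have := continuous_parNorm.measurable
  unfold decay; fun_prop

lemma decay_anti {η : ℝ} (hη : 0 < η) {z w : ℝ × UnitAddCircle} (h : parNorm z ≤ parNorm w) :
    decay η w ≤ decay η z := by
  have := parNorm_nonneg z
  unfold decay; gcongr

/-! ### Integrals of parabolic weights -/

/-- The one-dimensional profile `|x|^{-b} (η / (|x| + η))^c`. -/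
noncomputable def profile (b c η x : ℝ) : ℝ≥0∞ :=
  ENNReal.ofReal |x| ^ (-b) * ENNReal.ofReal (η / (|x| + η)) ^ c

lemma profile_neg (b c η x : ℝ) : profile b c η (-x) = profile b c η x := by simp [profile]

lemma measurable_profile (b c η : ℝ) : Measurable (profile b c η) := by
  unfold profile; fun_prop

lemma lintegral_profile_one_lt_top {b c : ℝ} (hb : b < 1) (hc : 0 ≤ c) (hbc : 1 < b + c) :
    ∫⁻ x, profile b c 1 x < ∞ := by
  have h1 : ∫⁻ x in Set.Ioc 0 1, profile b c 1 x < ∞ := by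
    have hi : IntegrableOn (fun x : ℝ => x ^ (-b)) (Set.Ioc 0 1) :=
      (intervalIntegrable_iff_integrableOn_Ioc_of_le zero_le_one).1
        (intervalIntegral.intervalIntegrable_rpow' (by linarith))
    refine lt_of_le_of_lt (setLIntegral_mono' measurableSet_Ioc fun x hx => ?_) hi.lintegral_lt_top
    rw [profile, abs_of_pos hx.1, ENNReal.ofReal_rpow_of_pos hx.1]
    refine mul_le_of_le_one_right' (ENNReal.rpow_le_one ?_ hc)
    rw [ENNReal.ofReal_le_one, div_le_one (by linarith [hx.1])]
    linarith [hx.1]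
  have h2 : ∫⁻ x in Set.Ioi 1, profile b c 1 x < ∞ := by
    have hi : IntegrableOn (fun x : ℝ => x ^ (-(b + c))) (Set.Ioi 1) :=
      integrableOn_Ioi_rpow_of_lt (by linarith) zero_lt_one
    refine lt_of_le_of_lt (setLIntegral_mono' measurableSet_Ioi fun x hx => ?_) hi.lintegral_lt_top
    have hx0 : 0 < x := zero_lt_one.trans hx
    rw [profile, abs_of_pos hx0, ENNReal.ofReal_rpow_of_pos hx0, neg_add, Real.rpow_add hx0,
      ENNReal.ofReal_mul (by positivity)]
    gcongr
    rw [ENNReal.ofReal_rpow_of_pos (by positivity)]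
    refine ENNReal.ofReal_le_ofReal ?_
    rw [Real.rpow_neg hx0.le, ← Real.inv_rpow hx0.le, one_div]
    gcongr
    linarith
  have h3 : ∫⁻ x in Set.Ioi 0, profile b c 1 x < ∞ := by
    rw [← Set.Ioc_union_Ioi_eq_Ioi (zero_le_one (α := ℝ))]
    exact (lintegral_union_le _ _ _).trans_lt (ENNReal.add_lt_top.2 ⟨h1, h2⟩)
  have h4 : ∫⁻ x in Set.Iio 0, profile b c 1 x < ∞ := by
    have : ∫⁻ x in Set.Iio 0, profile b c 1 x = ∫⁻ x in Set.Ioi 0, profile b c 1 x := by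
      have := (Measure.measurePreserving_neg (volume : Measure ℝ)).setLIntegral_comp_preimage
        (measurableSet_Ioi (a := (0 : ℝ))) (measurable_profile b c 1)
      simp only [profile_neg] at this
      rw [← this]
      congr 2
      ext x; simp
    rwa [this]
  have h5 : (∫⁻ x, profile b c 1 x) = ∫⁻ x in ({0}ᶜ : Set ℝ), profile b c 1 x := by
    rw [restrict_compl_singleton]
  rw [h5, ← Set.Iio_union_Ioi]
  exact (lintegral_union_le _ _ _).trans_lt (ENNReal.add_lt_top.2 ⟨h4, h3⟩)

lemma lintegral_profile {b c η : ℝ} (hη : 0 < η) :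
    ∫⁻ x, profile b c η x = ENNReal.ofReal (η ^ (1 - b)) * ∫⁻ x, profile b c 1 x := by
  have h1 : ∀ x, profile b c η (η * x) = ENNReal.ofReal (η ^ (-b)) * profile b c 1 x := by
    intro x
    simp only [profile]
    rw [abs_mul, abs_of_pos hη, ENNReal.ofReal_mul hη.le,
      ENNReal.mul_rpow_of_ne_top (by simp) (by simp), ENNReal.ofReal_rpow_of_pos hη, mul_assoc]
    congr 4
    field_simp
  have h2 := lintegral_map (μ := volume) (measurable_profile b c η) (measurable_const_mul η)
  rw [Real.map_volume_mul_left hη.ne', lintegral_smul_measure, abs_of_pos (inv_pos.2 hη)] at h2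
  simp only [h1] at h2
  rw [lintegral_const_mul _ (measurable_profile _ _ _), smul_eq_mul] at h2
  have h3 : ENNReal.ofReal η * ENNReal.ofReal η⁻¹ = 1 := by
    rw [← ENNReal.ofReal_mul hη.le, mul_inv_cancel₀ hη.ne', ENNReal.ofReal_one]
  rw [← one_mul (∫⁻ x, profile b c η x), ← h3, mul_assoc, h2, ← mul_assoc,
    ← ENNReal.ofReal_mul hη.le, sub_eq_add_neg, Real.rpow_add hη, Real.rpow_one]

lemma lintegral_norm_unitAddCircle_le (G : ℝ → ℝ≥0∞) (hG : ∀ x, G |x| = G x) :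
    ∫⁻ x : UnitAddCircle, G ‖x‖ ≤ ∫⁻ x, G x := by
  rw [← UnitAddCircle.lintegral_preimage (-(1 / 2))]
  refine le_trans (le_of_eq ?_) (setLIntegral_le_lintegral (Set.Ioc (-(1 / 2)) (-(1 / 2) + 1)) _)
  refine setLIntegral_congr_fun measurableSet_Ioc fun x hx => ?_
  have : ‖(x : UnitAddCircle)‖ = |x| := by
    rw [AddCircle.norm_coe_eq_abs_iff _ one_ne_zero, abs_one, abs_le]
    constructor <;> linarith [hx.1, hx.2]
  simp only [this, hG]

/-- Integrals of parabolic weights: the singularity `|z|^{-p}` is integrable since `p < 3`, and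
`p + q > 3` makes the integral converge at infinity and scale like its values at scale `η`. -/
lemma exists_lintegral_weight_le {p q : ℝ} (hp0 : 0 ≤ p) (hp : p < 3) (hq : 0 ≤ q)
    (hpq : 3 < p + q) : ∃ C > 0, ∀ η > 0,
      ∫⁻ z, ENNReal.ofReal (parNorm z ^ (-p) * decay η z ^ q) ≤ ENNReal.ofReal (C * η ^ (3 - p)) := by
  set b := p / 3 with hb
  set c := q / 3 with hc
  have hI := lintegral_profile_one_lt_top (b := b) (c := c) (by rw [hb]; linarith)
    (by rw [hc]; linarith) (by rw [hb, hc]; linarith)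
  set I := ∫⁻ x, profile b c 1 x with hI_def
  refine ⟨I.toReal ^ 2 + 1, by positivity, fun η hη => ?_⟩
  -- the weight is bounded by a product of profiles in the time and space variables
  have hpt : ∀ z : ℝ × UnitAddCircle, ENNReal.ofReal (parNorm z ^ (-p) * decay η z ^ q) ≤
      profile b c (η ^ 2) z.1 * profile b c η ‖z.2‖ := by
    intro z
    have hd := parNorm_nonneg z
    have hs := (decay_pos hη z).le
    have ht : |z.1| ≤ parNorm z ^ 2 := by
      have h1 := Real.sq_sqrt (abs_nonneg z.1)
      have h2 : √|z.1| ≤ parNorm z := le_add_of_nonneg_right (norm_nonneg _)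
      nlinarith [Real.sqrt_nonneg |z.1|]
    have hx : ‖z.2‖ ≤ parNorm z := le_add_of_nonneg_left (Real.sqrt_nonneg _)
    rw [ENNReal.ofReal_mul (by positivity), profile, profile,
      mul_mul_mul_comm]
    have hb0 : 0 ≤ b := by positivity
    have hc0 : 0 ≤ c := by positivity
    have anti : ∀ x y : ℝ≥0∞, x ≤ y → y ^ (-b) ≤ x ^ (-b) := fun x y h => by
      rw [ENNReal.rpow_neg, ENNReal.rpow_neg]
      exact ENNReal.inv_le_inv.2 (ENNReal.rpow_le_rpow h hb0)
    have sq : ∀ (x : ℝ≥0∞) (e : ℝ), x ^ (3 * e) = (x ^ 2) ^ e * x ^ e := fun x e => by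
      have h3 : x ^ (3 * e) = (x ^ e) ^ 3 := by
        rw [mul_comm, ENNReal.rpow_mul, ← ENNReal.rpow_natCast]; norm_num
      have h2 : (x ^ 2) ^ e = (x ^ e) ^ 2 := by
        rw [← ENNReal.rpow_natCast, ← ENNReal.rpow_natCast, ← ENNReal.rpow_mul,
          ← ENNReal.rpow_mul, mul_comm]
      rw [h3, h2, pow_succ]
    have e1 : ENNReal.ofReal (parNorm z ^ (-p)) ≤
        ENNReal.ofReal |z.1| ^ (-b) * ENNReal.ofReal |‖z.2‖| ^ (-b) := by
      have h1 : ENNReal.ofReal (parNorm z ^ (-p)) ≤ ENNReal.ofReal (parNorm z) ^ (-p) := by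
        rcases hd.eq_or_lt with h0 | h0
        · rw [← h0]
          rcases hp0.eq_or_lt with h1 | h1
          · simp [← h1]
          · simp [Real.zero_rpow (neg_ne_zero.2 h1.ne')]
        · rw [ENNReal.ofReal_rpow_of_pos h0]
      refine h1.trans ?_
      rw [show -p = 3 * -b by rw [hb]; ring, sq, abs_norm]
      refine mul_le_mul' (anti _ _ ?_) (anti _ _ (ENNReal.ofReal_le_ofReal hx))
      rw [← ENNReal.ofReal_pow hd]
      exact ENNReal.ofReal_le_ofReal ht
    have e2 : ENNReal.ofReal (decay η z ^ q) ≤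
        ENNReal.ofReal (η ^ 2 / (|z.1| + η ^ 2)) ^ c * ENNReal.ofReal (η / (|‖z.2‖| + η)) ^ c := by
      rw [← ENNReal.ofReal_rpow_of_nonneg hs hq, show q = 3 * c by rw [hc]; ring, sq, abs_norm]
      refine mul_le_mul' (ENNReal.rpow_le_rpow ?_ hc0) (ENNReal.rpow_le_rpow ?_ hc0)
      · rw [← ENNReal.ofReal_pow hs]
        refine ENNReal.ofReal_le_ofReal ?_
        rw [decay, div_pow]
        gcongr
        nlinarith
      · refine ENNReal.ofReal_le_ofReal ?_
        rw [decay]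
        gcongr
    exact mul_le_mul' e1 e2
  calc ∫⁻ z, ENNReal.ofReal (parNorm z ^ (-p) * decay η z ^ q)
      ≤ ∫⁻ z : ℝ × UnitAddCircle, profile b c (η ^ 2) z.1 * profile b c η ‖z.2‖ :=
        lintegral_mono hpt
    _ = (∫⁻ t, profile b c (η ^ 2) t) * ∫⁻ x : UnitAddCircle, profile b c η ‖x‖ := by
        rw [Measure.volume_eq_prod]
        exact lintegral_prod_mul (measurable_profile _ _ _).aemeasurable
          ((measurable_profile _ _ _).comp measurable_norm).aemeasurable
    _ ≤ (ENNReal.ofReal ((η ^ 2) ^ (1 - b)) * I) * (ENNReal.ofReal (η ^ (1 - b)) * I) := by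
        rw [lintegral_profile (by positivity)]
        gcongr
        rw [← lintegral_profile hη]
        exact lintegral_norm_unitAddCircle_le _ fun x => by simp [profile]
    _ ≤ ENNReal.ofReal ((I.toReal ^ 2 + 1) * η ^ (3 - p)) := by
        rw [← ENNReal.ofReal_toReal hI.ne, mul_mul_mul_comm, ← ENNReal.ofReal_mul (by positivity),
          ← ENNReal.ofReal_mul (by positivity), ← ENNReal.ofReal_mul (by positivity)]
        refine ENNReal.ofReal_le_ofReal ?_
        rw [← Real.mul_rpow (by positivity) hη.le, ← pow_succ, ← Real.rpow_natCast,
          ← Real.rpow_mul hη.le, show ((2 + 1 : ℕ) : ℝ) * (1 - b) = 3 - p by rw [hb]; push_cast; ring]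
        have : 0 < η ^ (3 - p) := by positivity
        simp only [ENNReal.toReal_ofReal ENNReal.toReal_nonneg]
        nlinarith

/-! ### The derivative of the heat kernel -/

lemma spaceDeriv_heatKernel_of_nonpos {z : ℝ × ℝ} (hz : z.1 ≤ 0) :
    spaceDeriv heatKernel z = 0 := by
  simp [spaceDeriv, heatKernel, hz.not_gt]

lemma spaceDeriv_heatKernel_of_pos {z : ℝ × ℝ} (hz : 0 < z.1) :
    spaceDeriv heatKernel z =
      -(z.2 / (2 * z.1)) * ((√(4 * Real.pi * z.1))⁻¹ * Real.exp (-z.2 ^ 2 / (4 * z.1))) := by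
  simp only [spaceDeriv, heatKernel, hz, if_true]
  have h1 : HasDerivAt (fun x : ℝ => -x ^ 2 / (4 * z.1)) (-(z.2 / (2 * z.1))) z.2 := by
    have := ((hasDerivAt_pow 2 z.2).neg).div_const (4 * z.1)
    refine this.congr_deriv ?_
    field_simp
    norm_num
    ring
  rw [(h1.exp.const_mul _).deriv]
  ring

lemma measurable_spaceDeriv_heatKernel : Measurable (spaceDeriv heatKernel) := by
  have : spaceDeriv heatKernel = fun z : ℝ × ℝ => if 0 < z.1 then
      -(z.2 / (2 * z.1)) * ((√(4 * Real.pi * z.1))⁻¹ * Real.exp (-z.2 ^ 2 / (4 * z.1))) else 0 := by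
    ext z
    split_ifs with h
    · exact spaceDeriv_heatKernel_of_pos h
    · exact spaceDeriv_heatKernel_of_nonpos (not_lt.1 h)
  rw [this]
  exact Measurable.ite (measurableSet_lt measurable_const measurable_fst) (by fun_prop)
    measurable_const

/-- The two scaling bounds of `P'`, by `t⁻¹` and by `x⁻²`. -/
lemma abs_spaceDeriv_heatKernel_mul_le (z : ℝ × ℝ) :
    |spaceDeriv heatKernel z| * |z.1| ≤ 1 ∧ |spaceDeriv heatKernel z| * z.2 ^ 2 ≤ 2 := by
  rcases le_or_gt z.1 0 with hz | hz
  · simp [spaceDeriv_heatKernel_of_nonpos hz]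
  set s := √z.1 with hs
  have hs0 : 0 < s := Real.sqrt_pos.2 hz
  have hts : z.1 = s ^ 2 := (Real.sq_sqrt hz.le).symm
  -- the self-similar variable
  set u := |z.2| / (2 * s) with hu
  have hu0 : 0 ≤ u := by positivity
  have hy : |z.2| = 2 * s * u := by rw [hu]; field_simp
  have hy2 : z.2 ^ 2 = (2 * s * u) ^ 2 := by rw [← hy, sq_abs]
  have hexp : 1 + u ^ 2 + (u ^ 2) ^ 2 / 2 ≤ Real.exp (u ^ 2) :=
    Real.quadratic_le_exp_of_nonneg (by positivity)
  have hroot : (√(4 * Real.pi * z.1))⁻¹ ≤ (2 * s)⁻¹ := by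
    gcongr
    rw [hts]
    refine Real.le_sqrt_of_sq_le ?_
    nlinarith [Real.pi_gt_three, sq_nonneg s]
  have hbound : |spaceDeriv heatKernel z| ≤ u / (2 * s ^ 2) * (Real.exp (u ^ 2))⁻¹ := by
    have e1 : -z.2 ^ 2 / (4 * z.1) = -u ^ 2 := by rw [hy2, hts]; field_simp; ring
    rw [spaceDeriv_heatKernel_of_pos hz, abs_mul, abs_neg, abs_div, abs_mul (√_)⁻¹, e1, Real.exp_neg,
      abs_of_pos (by positivity : 0 < 2 * z.1), abs_of_pos (by positivity : 0 < (√(4 * Real.pi * z.1))⁻¹),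
      abs_of_pos (by positivity : 0 < (Real.exp (u ^ 2))⁻¹), hy, ← mul_assoc]
    gcongr
    calc 2 * s * u / (2 * z.1) * (√(4 * Real.pi * z.1))⁻¹
        ≤ 2 * s * u / (2 * z.1) * (2 * s)⁻¹ := by gcongr
      _ = u / (2 * s ^ 2) := by rw [hts]; field_simp
  have he : 0 < Real.exp (u ^ 2) := Real.exp_pos _
  constructor
  · refine (mul_le_mul_of_nonneg_right hbound (abs_nonneg _)).trans ?_
    rw [abs_of_pos hz, hts]
    have : u / (2 * s ^ 2) * (Real.exp (u ^ 2))⁻¹ * s ^ 2 = u / (2 * Real.exp (u ^ 2)) := by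
      field_simp
    rw [this, div_le_one (by positivity)]
    nlinarith [sq_nonneg (u - 1), sq_nonneg (u ^ 2)]
  · refine (mul_le_mul_of_nonneg_right hbound (sq_nonneg _)).trans ?_
    have : u / (2 * s ^ 2) * (Real.exp (u ^ 2))⁻¹ * z.2 ^ 2 = 2 * u ^ 3 / Real.exp (u ^ 2) := by
      rw [hy2]; field_simp
    rw [this, div_le_iff₀ he]
    nlinarith [mul_nonneg (sq_nonneg u) (sq_nonneg (u - 1)), sq_nonneg u]

/-! ### Periodisation -/

/-- The representative of a point of the circle in `[0, 1)`. -/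
noncomputable def rep (x : UnitAddCircle) : ℝ := (AddCircle.equivIco (1 : ℝ) 0 x : ℝ)

lemma coe_rep (x : UnitAddCircle) : (rep x : UnitAddCircle) = x := AddCircle.coe_equivIco

lemma rep_mem (x : UnitAddCircle) : 0 ≤ rep x ∧ rep x < 1 := by
  have := (AddCircle.equivIco (1 : ℝ) 0 x).2
  simpa [rep] using this

lemma measurable_rep : Measurable rep :=
  measurable_subtype_coe.comp (AddCircle.measurableEquivIco 1 0).measurable

lemma norm_le_abs_rep_add (x : UnitAddCircle) (n : ℤ) : ‖x‖ ≤ |rep x + n| := by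
  have h : ((rep x + n : ℝ) : UnitAddCircle) = x := by
    rw [AddCircle.coe_add, coe_rep]
    simp
  conv_lhs => rw [← h]
  exact QuotientAddGroup.norm_mk_le_norm

lemma norm_unitAddCircle_le_half (x : UnitAddCircle) : ‖x‖ ≤ 1 / 2 := by
  simpa using AddCircle.norm_le_half_period (1 : ℝ) (x := x) one_ne_zero

lemma one_add_sq_le_rep_add_sq (x : UnitAddCircle) {n : ℤ} (h0 : n ≠ 0) (h1 : n ≠ -1) :
    1 + (n : ℝ) ^ 2 ≤ 8 * (rep x + n) ^ 2 := by
  obtain ⟨hx0, hx1⟩ := rep_mem x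
  rcases lt_or_gt_of_ne h0 with h | h
  · have : (n : ℝ) ≤ -2 := by exact_mod_cast (by omega : n ≤ -2)
    nlinarith
  · have : (1 : ℝ) ≤ n := by exact_mod_cast h
    nlinarith

lemma norm_sq_mul_le_rep_add_sq (x : UnitAddCircle) (n : ℤ) :
    ‖x‖ ^ 2 * (1 + (n : ℝ) ^ 2) ≤ 2 * (rep x + n) ^ 2 := by
  have h1 := norm_unitAddCircle_le_half x
  have h2 := norm_nonneg x
  have h3 : ‖x‖ ^ 2 ≤ (rep x + n) ^ 2 := by
    rw [← sq_abs (rep x + n)]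
    gcongr
    exact norm_le_abs_rep_add x n
  by_cases h0 : n = 0
  · subst h0; norm_num at h3 ⊢; nlinarith
  by_cases h1 : n = -1
  · subst h1; norm_num at h3 ⊢; nlinarith
  have h4 := one_add_sq_le_rep_add_sq x h0 h1
  have h5 : ‖x‖ ^ 2 ≤ 1 / 4 := by nlinarith
  nlinarith [mul_le_mul_of_nonneg_right h5 (by positivity : 0 ≤ 1 + (n : ℝ) ^ 2)]

lemma measurable_periodize {f : ℝ × ℝ → ℝ} (hf : Measurable f)
    (hs : ∀ z : ℝ × UnitAddCircle, Summable fun n : ℤ => f (z.1, rep z.2 + n)) :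
    Measurable (periodize f) := by
  have hr := measurable_rep
  refine measurable_of_tendsto_metrizable' (f := fun (s : Finset ℤ) (z : ℝ × UnitAddCircle) =>
    ∑ n ∈ s, f (z.1, rep z.2 + n)) atTop (fun s => ?_) (tendsto_pi_nhds.2 fun z => (hs z).hasSum)
  refine Finset.measurable_sum _ fun n _ => hf.comp ?_
  fun_prop

lemma summable_one_add_sq_inv : Summable fun n : ℤ => (1 + (n : ℝ) ^ 2)⁻¹ := by
  refine Summable.of_norm_bounded_eventually (g := fun n : ℤ => 1 / |(n : ℝ)| ^ 2) ?_ ?_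
  · simpa using (Real.summable_one_div_int_pow (p := 2)).2 one_lt_two
  · refine ((Set.finite_singleton (0 : ℤ)).subset fun n hn => ?_)
    by_contra h
    refine hn ?_
    have h0 : (n : ℝ) ≠ 0 := by exact_mod_cast h
    have : 0 < (n : ℝ) ^ 2 := by positivity
    simp only [sq_abs, one_div, Set.mem_ofPred_eq]
    rw [Real.norm_of_nonneg (by positivity)]
    gcongr
    linarith

/-! ### The heat kernel of the circle -/

/-- The spatial derivative `P_𝕋'` of the heat kernel of the circle. -/
noncomputable def heatTorus : ℝ × UnitAddCircle → ℝ := periodize (spaceDeriv heatKernel)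

lemma heatTorus_def (z : ℝ × UnitAddCircle) :
    heatTorus z = ∑' n : ℤ, spaceDeriv heatKernel (z.1, rep z.2 + n) := rfl

lemma heatTorus_of_nonpos {z : ℝ × UnitAddCircle} (hz : z.1 ≤ 0) : heatTorus z = 0 := by
  rw [heatTorus_def]
  simp [spaceDeriv_heatKernel_of_nonpos, hz]

/-- Poisson summation: the sum over the translates is a sine series. -/
lemma hasSum_spaceDeriv_heatKernel {z : ℝ × UnitAddCircle} (hz : 0 < z.1) :
    HasSum (fun n : ℤ => spaceDeriv heatKernel (z.1, rep z.2 + n))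
      (-(2 * Real.pi) * HurwitzZeta.sinKernel z.2 (4 * Real.pi * z.1)) := by
  have hs : 0 < 4 * Real.pi * z.1 := by positivity
  have h := (HurwitzZeta.hasSum_int_oddKernel (rep z.2) (one_div_pos.2 hs)).mul_left
    (-((2 * z.1)⁻¹ * (√(4 * Real.pi * z.1))⁻¹))
  rw [coe_rep, HurwitzZeta.oddKernel_functional_equation] at h
  have e : -(2 * Real.pi) * HurwitzZeta.sinKernel z.2 (4 * Real.pi * z.1) =
      -((2 * z.1)⁻¹ * (√(4 * Real.pi * z.1))⁻¹) * (1 / (1 / (4 * Real.pi * z.1)) ^ (3 / 2 : ℝ) *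
        HurwitzZeta.sinKernel z.2 (1 / (1 / (4 * Real.pi * z.1)))) := by
    rw [one_div_one_div, Real.div_rpow zero_le_one hs.le, Real.one_rpow, one_div_one_div,
      ← mul_assoc]
    congr 1
    rw [show (3 / 2 : ℝ) = 1 + 1 / 2 by norm_num, Real.rpow_add hs, Real.rpow_one,
      ← Real.sqrt_eq_rpow]
    field_simp
    norm_num
  rw [e]
  refine h.congr_fun fun n => ?_
  rw [spaceDeriv_heatKernel_of_pos (z := (z.1, rep z.2 + n)) hz]
  simp only
  rw [show -(rep z.2 + n) ^ 2 / (4 * z.1) =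
    -Real.pi * (n + rep z.2) ^ 2 * (1 / (4 * Real.pi * z.1)) by field_simp; ring]
  ring

lemma measurable_heatTorus : Measurable heatTorus := by
  refine measurable_periodize measurable_spaceDeriv_heatKernel fun z => ?_
  rcases le_or_gt z.1 0 with hz | hz
  · simp [spaceDeriv_heatKernel_of_nonpos, hz, summable_zero]
  · exact (hasSum_spaceDeriv_heatKernel hz).summable

/-- The sine series decays at large times, uniformly in space. The rate `t⁻¹`, which is far from
optimal, is the one that the parabolic scaling asks for. -/
lemma exists_abs_sinKernel_le :
    ∃ C, ∀ (a : UnitAddCircle) {t : ℝ}, 1 ≤ t → |HurwitzZeta.sinKernel a t| * t ≤ C := by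
  refine ⟨∑' n : ℕ, 4 * (1 / (n : ℝ) ^ 3), fun a t ht => ?_⟩
  have ht0 : 0 < t := by linarith
  have h := (HurwitzZeta.hasSum_nat_sinKernel (rep a) ht0).mul_right t
  rw [coe_rep] at h
  have hsum : Summable fun n : ℕ => 4 * (1 / (n : ℝ) ^ 3) :=
    (Real.summable_one_div_nat_pow.2 (by norm_num)).mul_left 4
  rw [← abs_of_pos ht0, ← abs_mul, abs_of_pos ht0, ← h.tsum_eq]
  refine tsum_of_norm_bounded (E := ℝ) hsum.hasSum fun n => ?_
  rcases Nat.eq_zero_or_pos n with rfl | hn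
  · simp
  have hn' : (0 : ℝ) < n := by exact_mod_cast hn
  set v := Real.pi * n ^ 2 * t with hv
  have hv0 : 0 < v := by positivity
  have hexp : v ^ 2 / 2 ≤ Real.exp v := by
    have := Real.quadratic_le_exp_of_nonneg hv0.le
    linarith
  have hvt : n ^ 2 * t ≤ v := by
    rw [hv]; nlinarith [Real.pi_gt_three, mul_pos (pow_pos hn' 2) ht0]
  have e : -Real.pi * n ^ 2 * t = -v := by rw [hv]; ring
  rw [Real.norm_eq_abs, abs_mul, abs_mul, abs_mul, e, Real.exp_neg, abs_of_pos ht0,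
    abs_of_pos (by positivity : (0 : ℝ) < 2 * n), abs_of_pos (by positivity : 0 < (Real.exp v)⁻¹)]
  calc 2 * n * |Real.sin (2 * Real.pi * rep a * n)| * (Real.exp v)⁻¹ * t
      ≤ 2 * n * 1 * (((n : ℝ) ^ 2 * t) ^ 2 / 2)⁻¹ * t := by
        gcongr
        · exact Real.abs_sin_le_one _
        · exact le_trans (by gcongr) hexp
    _ = 4 * (1 / (n : ℝ) ^ 3) * (1 / t) := by field_simp; norm_num
    _ ≤ 4 * (1 / (n : ℝ) ^ 3) * 1 := by gcongr; rw [div_le_one ht0]; exact ht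
    _ = _ := mul_one _

lemma parNorm_sq_le (z : ℝ × UnitAddCircle) : parNorm z ^ 2 ≤ 2 * (|z.1| + ‖z.2‖ ^ 2) := by
  unfold parNorm
  nlinarith [sq_nonneg (√|z.1| - ‖z.2‖), Real.sq_sqrt (abs_nonneg z.1)]

/-- The derivative of the heat kernel of the circle is homogeneous of order `-2`, at all scales.
At small times the terms of the periodisation are summed; at large times the terms are too big
for that, and Poisson summation, in the form of the functional equation of the odd theta kernel,
shows that the sum decays. -/
lemma exists_abs_heatTorus_le : ∃ C > 0, ∀ z, |heatTorus z| * parNorm z ^ 2 ≤ C := by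
  obtain ⟨A, hA⟩ := exists_abs_sinKernel_le
  set B := ∑' n : ℤ, 20 * (1 + (n : ℝ) ^ 2)⁻¹ with hB
  have hB0 : 0 ≤ B := tsum_nonneg fun n => by positivity
  have hA0 : 0 ≤ A := (mul_nonneg (abs_nonneg _) zero_le_one).trans (hA 0 le_rfl)
  refine ⟨2 * B + 4 * A + 1, by positivity, fun z => ?_⟩
  rcases le_or_gt z.1 0 with hz | hz
  · rw [heatTorus_of_nonpos hz]; simp; positivity
  have hp := parNorm_sq_le z
  have hQ : heatTorus z = _ := (hasSum_spaceDeriv_heatKernel hz).tsum_eq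
  have hx := norm_unitAddCircle_le_half z.2
  have hx0 := norm_nonneg z.2
  rcases le_or_gt z.1 1 with hz1 | hz1
  · have h := (hasSum_spaceDeriv_heatKernel hz).summable.hasSum.mul_right (|z.1| + ‖z.2‖ ^ 2)
    have hb : ‖heatTorus z * (|z.1| + ‖z.2‖ ^ 2)‖ ≤ B := by
      rw [heatTorus_def, ← h.tsum_eq]
      refine tsum_of_norm_bounded (summable_one_add_sq_inv.mul_left 20).hasSum fun n => ?_
      obtain ⟨h1, h2⟩ := abs_spaceDeriv_heatKernel_mul_le (z.1, rep z.2 + n)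
      set g := |spaceDeriv heatKernel (z.1, rep z.2 + n)| with hg
      have hg0 : 0 ≤ g := abs_nonneg _
      simp only at h1 h2
      rw [Real.norm_eq_abs, abs_mul, abs_of_nonneg (by positivity : 0 ≤ |z.1| + ‖z.2‖ ^ 2), ← hg,
        ← div_eq_mul_inv, le_div_iff₀ (by positivity), mul_add g, add_mul]
      have e1 : g * ‖z.2‖ ^ 2 * (1 + (n : ℝ) ^ 2) ≤ 4 := by
        have := mul_le_mul_of_nonneg_left (norm_sq_mul_le_rep_add_sq z.2 n) hg0
        nlinarith
      -- the two representatives `n = 0, -1` may lie near the origin; the others stay away from it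
      have e2 : g * |z.1| * (1 + (n : ℝ) ^ 2) ≤ 16 := by
        by_cases h0 : n = 0
        · subst h0; norm_num; linarith
        by_cases h3 : n = -1
        · subst h3; norm_num; linarith
        have h4 := mul_le_mul_of_nonneg_left (one_add_sq_le_rep_add_sq z.2 h0 h3) hg0
        have h5 : g * |z.1| ≤ g * 1 := by
          gcongr; rw [abs_of_pos hz]; exact hz1
        have h6 : 0 ≤ 1 + (n : ℝ) ^ 2 := by positivity
        nlinarith
      linarith
    rw [Real.norm_eq_abs, abs_mul, abs_of_nonneg (by positivity : 0 ≤ |z.1| + ‖z.2‖ ^ 2)] at hb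
    nlinarith [mul_le_mul_of_nonneg_left hp (abs_nonneg (heatTorus z))]
  · have hpt : parNorm z ^ 2 ≤ 4 * z.1 := by
      rw [abs_of_pos hz] at hp; nlinarith
    have h4 : 1 ≤ 4 * Real.pi * z.1 := by nlinarith [Real.pi_gt_three]
    have hk := hA z.2 h4
    rw [hQ, abs_mul, abs_neg, abs_of_pos (by positivity : 0 < 2 * Real.pi)]
    set q := |HurwitzZeta.sinKernel z.2 (4 * Real.pi * z.1)|
    have : 2 * Real.pi * q * parNorm z ^ 2 ≤ 2 * Real.pi * q * (4 * z.1) := by gcongr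
    linarith

/-! ### The truncated heat kernel -/

lemma continuous_proj : Continuous proj := by
  unfold proj
  exact continuous_fst.prodMk ((AddCircle.continuous_mk' 1).comp continuous_snd)

lemma proj_sub (z w : ℝ × ℝ) : proj (z - w) = proj z - proj w := by
  simp [proj]

lemma parNorm_proj_sq_le (z : ℝ × ℝ) : parNorm (proj z) ^ 2 ≤ 2 * (|z.1| + z.2 ^ 2) := by
  refine (parNorm_sq_le _).trans ?_
  have h : ‖(z.2 : UnitAddCircle)‖ ≤ |z.2| := QuotientAddGroup.norm_mk_le_norm
  have h2 : ‖(z.2 : UnitAddCircle)‖ ^ 2 ≤ z.2 ^ 2 := by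
    rw [← sq_abs z.2]; gcongr
  simp only [proj]
  linarith

lemma differentiableAt_heatKernel_space (t x : ℝ) :
    DifferentiableAt ℝ (fun y => heatKernel (t, y)) x := by
  unfold heatKernel
  by_cases h : 0 < t
  · simp only [h, if_true]; fun_prop
  · simp [h]

lemma spaceDeriv_eq_fderiv {f : ℝ × ℝ → ℝ} {z : ℝ × ℝ} (hf : DifferentiableAt ℝ f z) :
    spaceDeriv f z = fderiv ℝ f z (0, 1) := by
  have h1 : HasDerivAt (fun x : ℝ => (z.1, x)) ((0 : ℝ), (1 : ℝ)) z.2 :=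
    (hasDerivAt_const _ _).prodMk (hasDerivAt_id _)
  exact (HasFDerivAt.comp_hasDerivAt z.2 (hf.hasFDerivAt) h1).deriv

lemma spaceDeriv_eq_zero_of_notMem_tsupport {f : ℝ × ℝ → ℝ} {z : ℝ × ℝ} (hz : z ∉ tsupport f) :
    spaceDeriv f z = 0 := by
  have h : f =ᶠ[𝓝 z] 0 := notMem_tsupport_iff_eventuallyEq.1 hz
  have hc : Tendsto (fun x : ℝ => (z.1, x)) (𝓝 z.2) (𝓝 z) :=
    (Continuous.prodMk_right z.1).tendsto z.2
  have h2 : (fun x => f (z.1, x)) =ᶠ[𝓝 z.2] fun _ => 0 := hc.eventually h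
  rw [spaceDeriv, h2.deriv_eq, deriv_const]

namespace IsTruncatedHeatKernel

variable {K : ℝ × ℝ → ℝ}

lemma continuousOn_spaceDeriv (hK : IsTruncatedHeatKernel K) :
    ContinuousOn (spaceDeriv K) {0}ᶜ := by
  have hd := hK.contDiffOn.continuousOn_fderiv_of_isOpen isOpen_compl_singleton (by simp)
  refine (hd.clm_apply (continuousOn_const (c := ((0 : ℝ), (1 : ℝ))))).congr fun z hz => ?_
  exact spaceDeriv_eq_fderiv
    ((hK.contDiffOn.contDiffAt (isOpen_compl_singleton.mem_nhds hz)).differentiableAt (by simp))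

lemma measurable_spaceDeriv (hK : IsTruncatedHeatKernel K) : Measurable (spaceDeriv K) :=
  measurable_of_continuousOn_compl_singleton 0 hK.continuousOn_spaceDeriv

/-- The derivative of a truncated heat kernel has the same homogeneity as that of the heat
kernel. The bound is trivial at the origin, where the derivative is a junk value. -/
lemma exists_abs_spaceDeriv_le (hK : IsTruncatedHeatKernel K) :
    ∃ C, ∀ z, |spaceDeriv K z| * parNorm (proj z) ^ 2 ≤ C := by
  obtain ⟨R, hR, hKR⟩ := hK.near_zero
  rw [eventually_nhdsWithin_iff, Metric.eventually_nhds_iff] at hKR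
  obtain ⟨r, hr, hKR⟩ := hKR
  have hp := continuous_parNorm.comp continuous_proj
  have hRc : Continuous (spaceDeriv R) := by
    have h1 : spaceDeriv R = fun z => fderiv ℝ R z (0, 1) :=
      funext fun z => spaceDeriv_eq_fderiv (hR.differentiable (by simp) z)
    rw [h1]
    exact (hR.continuous_fderiv (by simp)).clm_apply continuous_const
  obtain ⟨C₁, hC₁⟩ := (isCompact_closedBall (0 : ℝ × ℝ) r).exists_bound_of_continuousOn
    (f := fun z => spaceDeriv R z * parNorm (proj z) ^ 2) (hRc.mul (hp.pow 2)).continuousOn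
  obtain ⟨C₂, hC₂⟩ := (hK.hasCompactSupport.isCompact.diff
    (Metric.isOpen_ball (x := (0 : ℝ × ℝ)) (ε := r))).exists_bound_of_continuousOn
    (f := fun z => spaceDeriv K z * parNorm (proj z) ^ 2)
    ((hK.continuousOn_spaceDeriv.mono fun z hz h0 =>
      hz.2 (by rw [Set.mem_singleton_iff.1 h0]; exact Metric.mem_ball_self hr)).mul
        (hp.pow 2).continuousOn)
  refine ⟨max (6 + C₁) (max C₂ 0), fun z => ?_⟩
  have hsq : 0 ≤ parNorm (proj z) ^ 2 := sq_nonneg _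
  have habs : ∀ y : ℝ, |y| * parNorm (proj z) ^ 2 = ‖y * parNorm (proj z) ^ 2‖ := fun y => by
    rw [Real.norm_eq_abs, abs_mul, abs_of_nonneg hsq]
  by_cases hz : z ∈ Metric.ball 0 r
  · by_cases h0 : z = 0
    · subst h0
      have : parNorm (proj 0) = 0 := by simp [parNorm, proj]
      simp [this]
    have hev : (fun x => K (z.1, x)) =ᶠ[𝓝 z.2] fun x => heatKernel (z.1, x) + R (z.1, x) := by
      have ho : Metric.ball 0 r ∩ {0}ᶜ ∈ 𝓝 z :=
        (Metric.isOpen_ball.inter isOpen_compl_singleton).mem_nhds ⟨hz, h0⟩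
      have hc : Tendsto (fun x : ℝ => (z.1, x)) (𝓝 z.2) (𝓝 z) :=
        (Continuous.prodMk_right z.1).tendsto z.2
      filter_upwards [hc.eventually ho] with x hx
      exact hKR hx.1 hx.2
    have hRd : DifferentiableAt ℝ (fun x => R (z.1, x)) z.2 :=
      (hR.differentiable (by simp) (z.1, z.2)).comp z.2
        ((differentiableAt_const _).prodMk differentiableAt_id)
    have hsum : spaceDeriv K z = spaceDeriv heatKernel z + spaceDeriv R z := by
      rw [spaceDeriv, hev.deriv_eq, deriv_fun_add (differentiableAt_heatKernel_space _ _) hRd]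
      rfl
    obtain ⟨h1, h2⟩ := abs_spaceDeriv_heatKernel_mul_le z
    have h3 := hC₁ z (Metric.ball_subset_closedBall hz)
    rw [← habs] at h3
    refine le_trans ?_ (le_max_left _ _)
    rw [hsum]
    calc _ ≤ (|spaceDeriv heatKernel z| + |spaceDeriv R z|) * parNorm (proj z) ^ 2 := by
          gcongr; exact abs_add_le _ _
      _ ≤ |spaceDeriv heatKernel z| * (2 * (|z.1| + z.2 ^ 2)) + C₁ := by
          rw [add_mul]
          gcongr
          exact parNorm_proj_sq_le z
      _ ≤ 6 + C₁ := by linarith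
  · refine le_trans ?_ (le_max_right _ _)
    by_cases hs : z ∈ tsupport K
    · rw [habs]
      exact (hC₂ z ⟨hs, hz⟩).trans (le_max_left _ _)
    · simp [spaceDeriv_eq_zero_of_notMem_tsupport hs]

/-- The derivative of a truncated heat kernel vanishes off a box. -/
lemma exists_spaceDeriv_ne_zero_imp (hK : IsTruncatedHeatKernel K) :
    ∃ N : ℕ, ∀ z, spaceDeriv K z ≠ 0 → |z.1| ≤ N ∧ |z.2| ≤ N := by
  obtain ⟨r, hr⟩ := hK.hasCompactSupport.isCompact.isBounded.subset_closedBall 0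
  refine ⟨⌈r⌉₊, fun z hz => ?_⟩
  have h := hr (not_imp_comm.1 spaceDeriv_eq_zero_of_notMem_tsupport hz)
  rw [mem_closedBall_zero_iff] at h
  have h2 := h.trans (Nat.le_ceil r)
  exact ⟨(norm_fst_le z).trans h2, (norm_snd_le z).trans h2⟩

end IsTruncatedHeatKernel

/-! ### Integrals against singular kernels -/

instance isAddHaarMeasure_volume_real_prod_unitAddCircle :
    (volume : Measure (ℝ × UnitAddCircle)).IsAddHaarMeasure :=
  inferInstanceAs
    ((volume : Measure ℝ).prod (volume : Measure UnitAddCircle)).IsAddHaarMeasure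

lemma exists_lintegral_decay_pow_four_le : ∃ C > 0, ∀ η > 0,
    ∫⁻ z, ENNReal.ofReal (decay η z ^ 4) ≤ ENNReal.ofReal (C * η ^ 3) := by
  obtain ⟨C, hC, h⟩ := exists_lintegral_weight_le (p := 0) (q := 4) le_rfl (by norm_num)
    (by norm_num) (by norm_num)
  refine ⟨C, hC, fun η hη => ?_⟩
  have := h η hη
  simp only [neg_zero, Real.rpow_zero, one_mul, sub_zero] at this
  exact_mod_cast this

lemma exists_lintegral_inv_sq_mul_decay_sq_le : ∃ C > 0, ∀ η > 0,
    ∫⁻ z, ENNReal.ofReal ((parNorm z ^ 2)⁻¹ * decay η z ^ 2) ≤ ENNReal.ofReal (C * η) := by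
  obtain ⟨C, hC, h⟩ := exists_lintegral_weight_le (p := 2) (q := 2) (by norm_num) (by norm_num)
    (by norm_num) (by norm_num)
  refine ⟨C, hC, fun η hη => ?_⟩
  have := h η hη
  rw [show (3 : ℝ) - 2 = 1 by norm_num, Real.rpow_one] at this
  simpa only [Real.rpow_neg (parNorm_nonneg _), Real.rpow_two] using this

/-- The singularity and the decay may be centred at two different points. -/
lemma exists_lintegral_inv_sq_mul_decay_sub_sq_le : ∃ C > 0, ∀ η > 0, ∀ z,
    ∫⁻ w, ENNReal.ofReal ((parNorm w ^ 2)⁻¹ * decay η (z - w) ^ 2) ≤ ENNReal.ofReal (C * η) := by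
  obtain ⟨C, hC, h⟩ := exists_lintegral_inv_sq_mul_decay_sq_le
  refine ⟨2 * C, by positivity, fun η hη z => ?_⟩
  have hm : Measurable fun w => ENNReal.ofReal ((parNorm w ^ 2)⁻¹ * decay η w ^ 2) := by
    have h1 := continuous_parNorm.measurable
    have h2 := measurable_decay η
    fun_prop
  calc ∫⁻ w, ENNReal.ofReal ((parNorm w ^ 2)⁻¹ * decay η (z - w) ^ 2)
      ≤ ∫⁻ w, (ENNReal.ofReal ((parNorm w ^ 2)⁻¹ * decay η w ^ 2) +
          ENNReal.ofReal ((parNorm (z - w) ^ 2)⁻¹ * decay η (z - w) ^ 2)) := by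
        refine lintegral_mono_ae ?_
        filter_upwards [compl_mem_ae_iff.2 (measure_singleton z)] with w hw
        have hw' : 0 < parNorm (z - w) := parNorm_pos (sub_ne_zero.2 (Ne.symm hw))
        have h0 := (decay_pos hη (z - w)).le
        rcases le_total (parNorm w) (parNorm (z - w)) with hle | hle
        · refine le_trans (ENNReal.ofReal_le_ofReal ?_) le_self_add
          gcongr
          exact decay_anti hη hle
        · refine le_trans (ENNReal.ofReal_le_ofReal ?_) le_add_self
          gcongr
    _ = _ := lintegral_add_left hm _
    _ ≤ ENNReal.ofReal (C * η) + ENNReal.ofReal (C * η) := by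
        refine add_le_add (h η hη) ?_
        rw [lintegral_sub_left_eq_self
          (fun w => ENNReal.ofReal ((parNorm w ^ 2)⁻¹ * decay η w ^ 2))]
        exact h η hη
    _ = ENNReal.ofReal (2 * C * η) := by
        rw [← ENNReal.ofReal_add (by positivity) (by positivity)]
        congr 1; ring

/-! ### The periodised mollifier -/

lemma periodize_proj (f : ℝ × ℝ → ℝ) (z : ℝ × ℝ) :
    periodize f (proj z) = ∑' n : ℤ, f (z.1, z.2 + n) := by
  have h : ((AddCircle.equivIco (1 : ℝ) 0 (z.2 : UnitAddCircle) : ℝ)) = Int.fract z.2 := by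
    simp
  unfold periodize proj
  simp only
  rw [h, ← (Equiv.addRight ⌊z.2⌋).tsum_eq fun n : ℤ => f (z.1, Int.fract z.2 + n)]
  refine tsum_congr fun n => ?_
  congr 2
  rw [Equiv.coe_addRight, Int.cast_add, ← Int.self_sub_floor]
  ring

lemma periodize_eq_sum {f : ℝ × ℝ → ℝ} {N : ℕ} (hf : ∀ z, f z ≠ 0 → |z.2| ≤ N) {z : ℝ × ℝ} {m : ℕ}
    (hm : |z.2| ≤ m) :
    periodize f (proj z) = ∑ n ∈ Finset.Icc (-(N + m : ℤ)) (N + m), f (z.1, z.2 + n) := by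
  rw [periodize_proj]
  refine tsum_eq_sum fun n hn => ?_
  by_contra h
  have h1 := abs_le.1 (hf _ h)
  have h2 := abs_le.1 hm
  simp only at h1
  refine hn (Finset.mem_Icc.2 ⟨?_, ?_⟩)
  · have : (-(N + m) : ℝ) ≤ n := by linarith
    exact_mod_cast this
  · have : (n : ℝ) ≤ N + m := by linarith
    exact_mod_cast this

lemma isOpenQuotientMap_proj : IsOpenQuotientMap proj :=
  IsOpenQuotientMap.id.prodMap QuotientAddGroup.isOpenQuotientMap_mk

lemma continuous_periodize {f : ℝ × ℝ → ℝ} (hf : Continuous f) {N : ℕ}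
    (hN : ∀ z, f z ≠ 0 → |z.2| ≤ N) : Continuous (periodize f) := by
  rw [isOpenQuotientMap_proj.isQuotientMap.continuous_iff, continuous_iff_continuousAt]
  intro z
  have hev : ∀ᶠ y : ℝ × ℝ in 𝓝 z, |y.2| < ⌈|z.2|⌉₊ + 1 :=
    (continuous_snd.abs.tendsto z).eventually_lt_const
      ((Nat.le_ceil |z.2|).trans_lt (lt_add_one _))
  have heq : (fun y : ℝ × ℝ => ∑ n ∈ Finset.Icc (-(N + (⌈|z.2|⌉₊ + 1 : ℕ) : ℤ))
      (N + (⌈|z.2|⌉₊ + 1 : ℕ)), f (y.1, y.2 + n)) =ᶠ[𝓝 z] periodize f ∘ proj := by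
    filter_upwards [hev] with y hy
    exact (periodize_eq_sum hN (by push_cast; exact hy.le)).symm
  refine ContinuousAt.congr ?_ heq
  fun_prop

lemma proj_rep (z : ℝ × UnitAddCircle) : proj (z.1, rep z.2) = z := by
  simp [proj, coe_rep]

/-- The `ε`-mollifier on `ℝ × 𝕋`. -/
noncomputable def mollifierTorus (ρ : ℝ × ℝ → ℝ) (ε : ℝ) : ℝ × UnitAddCircle → ℝ :=
  periodize (rescale ρ ε)

lemma IsMollifier.exists_bounds {ρ : ℝ × ℝ → ℝ} (hρ : IsMollifier ρ) :
    ∃ M > 0, ∃ N : ℕ, 1 ≤ N ∧ (∀ z, |ρ z| ≤ M) ∧ ∀ z, ρ z ≠ 0 → |z.1| ≤ N ∧ |z.2| ≤ N := by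
  obtain ⟨M, hM⟩ := hρ.hasCompactSupport.exists_bound_of_continuous hρ.contDiff.continuous
  obtain ⟨r, hr⟩ := hρ.hasCompactSupport.isCompact.isBounded.subset_closedBall 0
  refine ⟨max M 1, by positivity, max ⌈r⌉₊ 1, le_max_right _ _,
    fun z => (hM z).trans (le_max_left _ _), fun z hz => ?_⟩
  have h := hr (subset_tsupport _ hz)
  rw [mem_closedBall_zero_iff] at h
  have h2 : ‖z‖ ≤ (max ⌈r⌉₊ 1 : ℕ) :=
    (h.trans (Nat.le_ceil r)).trans (by exact_mod_cast le_max_left _ _)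
  exact ⟨(norm_fst_le z).trans h2, (norm_snd_le z).trans h2⟩

section

variable {ρ : ℝ × ℝ → ℝ} {ε M : ℝ} {N : ℕ}

lemma rescale_ne_zero_imp (hε : 0 < ε) (hN : ∀ z, ρ z ≠ 0 → |z.1| ≤ N ∧ |z.2| ≤ N) {z : ℝ × ℝ}
    (hz : rescale ρ ε z ≠ 0) : |z.1| ≤ N * ε ^ 2 ∧ |z.2| ≤ N * ε := by
  have h := hN _ (right_ne_zero_of_mul hz)
  simp only [abs_div, abs_of_pos hε, abs_pow] at h
  rwa [div_le_iff₀ (by positivity), div_le_iff₀ hε] at h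

lemma mollifierTorus_ne_zero_imp (hε : 0 < ε) (hN : ∀ z, ρ z ≠ 0 → |z.1| ≤ N ∧ |z.2| ≤ N)
    {z : ℝ × UnitAddCircle} (hz : mollifierTorus ρ ε z ≠ 0) :
    |z.1| ≤ N * ε ^ 2 ∧ ‖z.2‖ ≤ N * ε := by
  have : ∃ n : ℤ, rescale ρ ε (z.1, rep z.2 + n) ≠ 0 := by
    by_contra! h
    refine hz ?_
    change ∑' n : ℤ, rescale ρ ε (z.1, rep z.2 + n) = 0
    simp [h]
  obtain ⟨n, hn⟩ := this
  obtain ⟨h1, h2⟩ := rescale_ne_zero_imp hε hN hn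
  exact ⟨h1, (norm_le_abs_rep_add z.2 n).trans h2⟩

lemma rescale_snd_le (hε : ε ∈ Set.Ioo (0 : ℝ) 1) (hN : ∀ z, ρ z ≠ 0 → |z.1| ≤ N ∧ |z.2| ≤ N)
    (z : ℝ × ℝ) (hz : rescale ρ ε z ≠ 0) : |z.2| ≤ N :=
  (rescale_ne_zero_imp hε.1 hN hz).2.trans (mul_le_of_le_one_right (by positivity) hε.2.le)

lemma continuous_mollifierTorus (hρ : Continuous ρ) (hε : ε ∈ Set.Ioo (0 : ℝ) 1)
    (hN : ∀ z, ρ z ≠ 0 → |z.1| ≤ N ∧ |z.2| ≤ N) : Continuous (mollifierTorus ρ ε) :=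
  continuous_periodize (by unfold rescale; fun_prop) (rescale_snd_le hε hN)

lemma hasCompactSupport_mollifierTorus (hε : 0 < ε)
    (hN : ∀ z, ρ z ≠ 0 → |z.1| ≤ N ∧ |z.2| ≤ N) : HasCompactSupport (mollifierTorus ρ ε) := by
  refine HasCompactSupport.intro
    ((isCompact_Icc (a := -(N * ε ^ 2)) (b := N * ε ^ 2)).prod isCompact_univ) fun z hz => ?_
  by_contra h
  exact hz ⟨abs_le.1 (mollifierTorus_ne_zero_imp hε hN h).1, Set.mem_univ _⟩

lemma abs_mollifierTorus_le (hε : ε ∈ Set.Ioo (0 : ℝ) 1) (hM : ∀ z, |ρ z| ≤ M)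
    (hN1 : 1 ≤ N) (hN : ∀ z, ρ z ≠ 0 → |z.1| ≤ N ∧ |z.2| ≤ N) (z : ℝ × UnitAddCircle) :
    |mollifierTorus ρ ε z| ≤
      (2 * N + 3) * (2 * N + 1) ^ 4 * M * (ε ^ 3)⁻¹ * decay ε z ^ 4 := by
  have hε0 := hε.1
  have hM0 : 0 ≤ M := (abs_nonneg _).trans (hM 0)
  have hd := decay_pos hε0 z
  by_cases hz : mollifierTorus ρ ε z = 0
  · rw [hz, abs_zero]; positivity
  obtain ⟨h1, h2⟩ := mollifierTorus_ne_zero_imp hε0 hN hz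
  have hN1' : (1 : ℝ) ≤ N := by exact_mod_cast hN1
  have hpar : parNorm z ≤ 2 * N * ε := by
    have : √|z.1| ≤ N * ε := by
      refine Real.sqrt_le_iff.2 ⟨by positivity, h1.trans ?_⟩
      rw [mul_pow]
      gcongr
      nlinarith
    unfold parNorm; linarith
  have hdec : 1 ≤ (2 * N + 1) * decay ε z := by
    have := parNorm_nonneg z
    rw [decay, ← mul_div_assoc, one_le_div (by positivity)]
    nlinarith
  have hsum : |mollifierTorus ρ ε z| ≤ (2 * N + 3) * (M * (ε ^ 3)⁻¹) := by
    have hr : |rep z.2| ≤ (1 : ℕ) := by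
      have := rep_mem z.2
      rw [abs_of_nonneg this.1]; exact_mod_cast this.2.le
    have := periodize_eq_sum (rescale_snd_le hε hN) (z := (z.1, rep z.2)) (m := 1) hr
    rw [proj_rep] at this
    rw [mollifierTorus, this]
    refine (Finset.abs_sum_le_sum_abs _ _).trans ?_
    refine (Finset.sum_le_card_nsmul _ _ (M * (ε ^ 3)⁻¹) fun n _ => ?_).trans (le_of_eq ?_)
    · rw [rescale, abs_mul, abs_of_pos (by positivity), mul_comm]
      gcongr
      exact hM _
    · rw [Int.card_Icc, nsmul_eq_mul]
      congr 1
      have : ((N + (1 : ℕ) : ℤ) + 1 - -(N + (1 : ℕ) : ℤ)).toNat = 2 * N + 3 := by omega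
      rw [this]; push_cast; ring
  calc |mollifierTorus ρ ε z| ≤ (2 * N + 3) * (M * (ε ^ 3)⁻¹) * 1 ^ 4 := by simpa using hsum
    _ ≤ (2 * N + 3) * (M * (ε ^ 3)⁻¹) * ((2 * N + 1) * decay ε z) ^ 4 := by gcongr
    _ = _ := by ring

end

lemma IsMollifier.exists_abs_mollifierTorus_le {ρ : ℝ × ℝ → ℝ} (hρ : IsMollifier ρ) :
    ∃ C > 0, ∀ ε ∈ Set.Ioo (0 : ℝ) 1, Continuous (mollifierTorus ρ ε) ∧
      HasCompactSupport (mollifierTorus ρ ε) ∧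
      ∀ z, |mollifierTorus ρ ε z| ≤ C * (ε ^ 3)⁻¹ * decay ε z ^ 4 := by
  obtain ⟨M, hM0, N, hN1, hM, hN⟩ := hρ.exists_bounds
  exact ⟨(2 * N + 3) * (2 * N + 1) ^ 4 * M, by positivity, fun ε hε =>
    ⟨continuous_mollifierTorus hρ.contDiff.continuous hε hN,
      hasCompactSupport_mollifierTorus hε.1 hN, abs_mollifierTorus_le hε hM hN1 hN⟩⟩

/-! ### The kernel of the field -/

lemma exists_abs_heatTorus_le_inv_sq :
    ∃ C > 0, ∀ z, |heatTorus z| ≤ C * (parNorm z ^ 2)⁻¹ := by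
  obtain ⟨C, hC, h⟩ := exists_abs_heatTorus_le
  refine ⟨C, hC, fun z => ?_⟩
  by_cases hz : z = 0
  -- both sides vanish at the origin, the right-hand one because `0⁻¹ = 0`
  · subst hz
    rw [heatTorus_of_nonpos (z := (0 : ℝ × UnitAddCircle)) le_rfl]
    simp [parNorm_zero]
  · rw [← div_eq_mul_inv, le_div_iff₀ (pow_pos (parNorm_pos hz) 2)]
    exact h z

lemma locallyIntegrable_heatTorus : LocallyIntegrable heatTorus := by
  obtain ⟨C, hC, h⟩ := exists_abs_heatTorus_le_inv_sq
  obtain ⟨D, -, hD⟩ := exists_lintegral_inv_sq_mul_decay_sq_le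
  intro z
  refine ⟨{w | parNorm w < parNorm z + 1},
    (isOpen_lt continuous_parNorm continuous_const).mem_nhds
      (lt_add_one (parNorm z)),
    measurable_heatTorus.aestronglyMeasurable, ?_⟩
  have hz := parNorm_nonneg z
  refine lt_of_le_of_lt (b := ENNReal.ofReal (C * (parNorm z + 2) ^ 2) * ∫⁻ w,
    ENNReal.ofReal ((parNorm w ^ 2)⁻¹ * decay 1 w ^ 2)) ?_
    (ENNReal.mul_lt_top ENNReal.ofReal_lt_top ((hD 1 one_pos).trans_lt ENNReal.ofReal_lt_top))
  rw [← lintegral_const_mul' _ _ ENNReal.ofReal_ne_top]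
  refine le_trans (setLIntegral_mono' ?_ fun w hw => ?_) (setLIntegral_le_lintegral _ _)
  · exact measurableSet_lt continuous_parNorm.measurable measurable_const
  rw [← ENNReal.ofReal_mul (by positivity), Real.enorm_eq_ofReal_abs]
  refine ENNReal.ofReal_le_ofReal ((h w).trans ?_)
  have hw0 := parNorm_nonneg w
  have hd : 1 ≤ (parNorm z + 2) * decay 1 w := by
    rw [decay, ← mul_div_assoc, one_le_div (by positivity)]
    have : parNorm w < parNorm z + 1 := hw
    linarith
  have : 0 ≤ (parNorm w ^ 2)⁻¹ := by positivity
  calc C * (parNorm w ^ 2)⁻¹ = C * (parNorm w ^ 2)⁻¹ * 1 ^ 2 := by ring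
    _ ≤ C * (parNorm w ^ 2)⁻¹ * ((parNorm z + 2) * decay 1 w) ^ 2 := by gcongr
    _ = _ := by ring

/-- The kernel `P_𝕋' * ρ_ε` of the field `Ψ_ε`. -/
noncomputable def fieldKernel (ρ : ℝ × ℝ → ℝ) (ε : ℝ) : ℝ × UnitAddCircle → ℝ :=
  heatTorus ⋆[ContinuousLinearMap.lsmul ℝ ℝ, volume] mollifierTorus ρ ε

/-- The kernel of the field is homogeneous of order `-2` down to scale `ε`. -/
lemma IsMollifier.exists_abs_fieldKernel_le {ρ : ℝ × ℝ → ℝ} (hρ : IsMollifier ρ) :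
    ∃ C > 0, ∀ ε ∈ Set.Ioo (0 : ℝ) 1, Continuous (fieldKernel ρ ε) ∧
      ∀ z, |fieldKernel ρ ε z| ≤ C * ((parNorm z + ε) ^ 2)⁻¹ := by
  obtain ⟨A, hA, hr⟩ := hρ.exists_abs_mollifierTorus_le
  obtain ⟨B, hB, hQ⟩ := exists_abs_heatTorus_le_inv_sq
  obtain ⟨D₁, hD₁, h₁⟩ := exists_lintegral_decay_pow_four_le
  obtain ⟨D₂, hD₂, h₂⟩ := exists_lintegral_inv_sq_mul_decay_sub_sq_le
  refine ⟨2 * A * B * (D₁ + D₂), by positivity, fun ε hε => ?_⟩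
  obtain ⟨hrc, hrs, hrb⟩ := hr ε hε
  have hε0 := hε.1
  refine ⟨hrs.continuous_convolution_right _ locallyIntegrable_heatTorus hrc, fun z => ?_⟩
  have hz := parNorm_nonneg z
  rw [← div_eq_mul_inv, le_div_iff₀ (by positivity),
    ← ENNReal.ofReal_le_ofReal_iff (by positivity)]
  -- split `(|z| + ε)² ≤ 2 |w|² + 2 (|z - w| + ε)²` under the integral
  have hpt : ∀ w, ENNReal.ofReal ((parNorm z + ε) ^ 2) *
      ‖(ContinuousLinearMap.lsmul ℝ ℝ (heatTorus w)) (mollifierTorus ρ ε (z - w))‖ₑ ≤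
      ENNReal.ofReal (2 * A * B * (ε ^ 3)⁻¹) * ENNReal.ofReal (decay ε (z - w) ^ 4) +
      ENNReal.ofReal (2 * A * B * ε⁻¹) *
        ENNReal.ofReal ((parNorm w ^ 2)⁻¹ * decay ε (z - w) ^ 2) := by
    intro w
    have hw := parNorm_nonneg w
    have hzw := parNorm_nonneg (z - w)
    have hd := decay_pos hε0 (z - w)
    rw [ContinuousLinearMap.lsmul_apply, smul_eq_mul, Real.enorm_eq_ofReal_abs,
      ← ENNReal.ofReal_mul (by positivity), ← ENNReal.ofReal_mul (by positivity),
      ← ENNReal.ofReal_mul (by positivity), ← ENNReal.ofReal_add (by positivity) (by positivity)]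
    refine ENNReal.ofReal_le_ofReal ?_
    rw [abs_mul]
    have htri : parNorm z ≤ parNorm w + parNorm (z - w) := by
      simpa using parNorm_add_le w (z - w)
    have hsq : (parNorm z + ε) ^ 2 ≤ 2 * parNorm w ^ 2 + 2 * (parNorm (z - w) + ε) ^ 2 := by
      nlinarith [sq_nonneg (parNorm w - (parNorm (z - w) + ε))]
    have hdec : (parNorm (z - w) + ε) ^ 2 * decay ε (z - w) ^ 2 = ε ^ 2 := by
      rw [decay, div_pow]; field_simp
    have hQw : parNorm w ^ 2 * (parNorm w ^ 2)⁻¹ ≤ 1 := mul_inv_le_one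
    calc (parNorm z + ε) ^ 2 * (|heatTorus w| * |mollifierTorus ρ ε (z - w)|)
        ≤ (2 * parNorm w ^ 2 + 2 * (parNorm (z - w) + ε) ^ 2) *
          ((B * (parNorm w ^ 2)⁻¹) * (A * (ε ^ 3)⁻¹ * decay ε (z - w) ^ 4)) := by
          gcongr
          · exact hQ w
          · exact hrb _
      _ = 2 * A * B * (ε ^ 3)⁻¹ * decay ε (z - w) ^ 4 * (parNorm w ^ 2 * (parNorm w ^ 2)⁻¹) +
          2 * A * B * (ε ^ 3)⁻¹ * ((parNorm (z - w) + ε) ^ 2 * decay ε (z - w) ^ 2) *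
            ((parNorm w ^ 2)⁻¹ * decay ε (z - w) ^ 2) := by ring
      _ ≤ 2 * A * B * (ε ^ 3)⁻¹ * decay ε (z - w) ^ 4 * 1 +
          2 * A * B * (ε ^ 3)⁻¹ * ε ^ 2 * ((parNorm w ^ 2)⁻¹ * decay ε (z - w) ^ 2) := by
          rw [hdec]; gcongr
      _ = _ := by field_simp
  have hm : Measurable fun w => ENNReal.ofReal (decay ε (z - w) ^ 4) := by
    have := measurable_decay ε
    fun_prop
  calc ENNReal.ofReal (|fieldKernel ρ ε z| * (parNorm z + ε) ^ 2)
      = ENNReal.ofReal ((parNorm z + ε) ^ 2) * ‖fieldKernel ρ ε z‖ₑ := by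
        rw [mul_comm, ENNReal.ofReal_mul (by positivity), Real.enorm_eq_ofReal_abs]
    _ ≤ ENNReal.ofReal ((parNorm z + ε) ^ 2) * ∫⁻ w,
        ‖(ContinuousLinearMap.lsmul ℝ ℝ (heatTorus w)) (mollifierTorus ρ ε (z - w))‖ₑ := by
        gcongr
        exact enorm_integral_le_lintegral_enorm _
    _ ≤ ∫⁻ w, (ENNReal.ofReal (2 * A * B * (ε ^ 3)⁻¹) * ENNReal.ofReal (decay ε (z - w) ^ 4) +
        ENNReal.ofReal (2 * A * B * ε⁻¹) *
          ENNReal.ofReal ((parNorm w ^ 2)⁻¹ * decay ε (z - w) ^ 2)) := by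
        rw [← lintegral_const_mul' _ _ ENNReal.ofReal_ne_top]
        exact lintegral_mono hpt
    _ = ENNReal.ofReal (2 * A * B * (ε ^ 3)⁻¹) * (∫⁻ w, ENNReal.ofReal (decay ε w ^ 4)) +
        ENNReal.ofReal (2 * A * B * ε⁻¹) *
          ∫⁻ w, ENNReal.ofReal ((parNorm w ^ 2)⁻¹ * decay ε (z - w) ^ 2) := by
        rw [lintegral_add_left (hm.const_mul _), lintegral_const_mul' _ _ ENNReal.ofReal_ne_top,
          lintegral_const_mul' _ _ ENNReal.ofReal_ne_top,
          lintegral_sub_left_eq_self (fun w => ENNReal.ofReal (decay ε w ^ 4))]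
    _ ≤ ENNReal.ofReal (2 * A * B * (ε ^ 3)⁻¹) * ENNReal.ofReal (D₁ * ε ^ 3) +
        ENNReal.ofReal (2 * A * B * ε⁻¹) * ENNReal.ofReal (D₂ * ε) := by
        gcongr
        · exact h₁ ε hε0
        · exact h₂ ε hε0 z
    _ = ENNReal.ofReal (2 * A * B * (D₁ + D₂)) := by
        rw [← ENNReal.ofReal_mul (by positivity), ← ENNReal.ofReal_mul (by positivity),
          ← ENNReal.ofReal_add (by positivity) (by positivity)]
        congr 1
        field_simp

/-! ### The covariance of the field -/

/-- The integral of the product of two copies of the kernel bound, centred at points at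
distance `|u|`. In the region where `w` is the closer one of the two centres, the distance to the
other centre is comparable to `|w| + |u| + ε`. -/
lemma exists_lintegral_inv_sq_mul_inv_sq_le : ∃ C > 0, ∀ ε > 0, ∀ u,
    ∫⁻ w, ENNReal.ofReal (((parNorm (u + w) + ε) ^ 2)⁻¹ * ((parNorm w + ε) ^ 2)⁻¹) ≤
      ENNReal.ofReal (C * (parNorm u + ε)⁻¹) := by
  obtain ⟨C, hC, h⟩ := exists_lintegral_inv_sq_mul_decay_sq_le
  refine ⟨32 * C, by positivity, fun ε hε u => ?_⟩
  have hu := parNorm_nonneg u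
  set η := parNorm u + ε with hη
  have hη0 : 0 < η := by positivity
  set g : ℝ × UnitAddCircle → ℝ≥0∞ := fun w =>
    ENNReal.ofReal ((parNorm w ^ 2)⁻¹ * decay η w ^ 2) with hg
  have hm : Measurable g := by
    have h1 := continuous_parNorm.measurable
    have h2 := measurable_decay η
    fun_prop
  -- the case in which `a` is the distance to the closer centre
  have key : ∀ a b : ℝ, 0 < a → a ≤ b → parNorm u ≤ a + b →
      ((b + ε) ^ 2)⁻¹ * ((a + ε) ^ 2)⁻¹ ≤ 16 * (η ^ 2)⁻¹ * ((a ^ 2)⁻¹ * (η / (a + η)) ^ 2) := by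
    intro a b ha hab htri
    have h1 : ((b + ε) ^ 2)⁻¹ ≤ (((a + η) / 4) ^ 2)⁻¹ := by
      gcongr
      linarith
    have h2 : ((a + ε) ^ 2)⁻¹ ≤ (a ^ 2)⁻¹ := by
      gcongr
      linarith
    calc _ ≤ (((a + η) / 4) ^ 2)⁻¹ * (a ^ 2)⁻¹ := by gcongr
      _ = _ := by field_simp; norm_num
  have hpt : ∀ᵐ w, ENNReal.ofReal (((parNorm (u + w) + ε) ^ 2)⁻¹ * ((parNorm w + ε) ^ 2)⁻¹) ≤
      ENNReal.ofReal (16 * (η ^ 2)⁻¹) * (g w + g (u + w)) := by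
    filter_upwards [compl_mem_ae_iff.2 (measure_singleton (0 : ℝ × UnitAddCircle)),
      compl_mem_ae_iff.2 (measure_singleton (-u))] with w hw0 hwu
    have h1 : 0 < parNorm w := parNorm_pos hw0
    have h2 : 0 < parNorm (u + w) := parNorm_pos fun h0 => hwu (by
      rw [Set.mem_singleton_iff]; exact (neg_eq_of_add_eq_zero_right h0).symm)
    have htri : parNorm u ≤ parNorm (u + w) + parNorm w := by
      have := parNorm_add_le (u + w) (-w)
      rwa [add_neg_cancel_right, parNorm_neg] at this
    rcases le_total (parNorm w) (parNorm (u + w)) with hle | hle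
    · refine le_trans ?_ (mul_le_mul_right (le_self_add (a := g w) (b := g (u + w))) _)
      rw [hg, ← ENNReal.ofReal_mul (by positivity)]
      exact ENNReal.ofReal_le_ofReal (key _ _ h1 hle (by linarith))
    · refine le_trans ?_ (mul_le_mul_right (le_add_self (a := g (u + w)) (b := g w)) _)
      rw [hg, ← ENNReal.ofReal_mul (by positivity), mul_comm (((parNorm (u + w) + ε) ^ 2)⁻¹)]
      exact ENNReal.ofReal_le_ofReal (key _ _ h2 hle (by linarith))
  calc _ ≤ ∫⁻ w, ENNReal.ofReal (16 * (η ^ 2)⁻¹) * (g w + g (u + w)) := lintegral_mono_ae hpt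
    _ = ENNReal.ofReal (16 * (η ^ 2)⁻¹) * ((∫⁻ w, g w) + ∫⁻ w, g w) := by
        rw [lintegral_const_mul' _ _ ENNReal.ofReal_ne_top, lintegral_add_left hm,
          lintegral_add_left_eq_self g u]
    _ ≤ ENNReal.ofReal (16 * (η ^ 2)⁻¹) * (ENNReal.ofReal (C * η) + ENNReal.ofReal (C * η)) := by
        gcongr <;> exact h η hη0
    _ = _ := by
        rw [← ENNReal.ofReal_add (by positivity) (by positivity),
          ← ENNReal.ofReal_mul (by positivity)]
        congr 1
        field_simp
        norm_num

/-- The covariance `R_ε(u)` of the rescaled field `ε^{1/2} Ψ_ε` at two points that differ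
by `u`. -/
noncomputable def fieldCov (ρ : ℝ × ℝ → ℝ) (ε : ℝ) (u : ℝ × UnitAddCircle) : ℝ :=
  ε * ∫ w, fieldKernel ρ ε (u + w) * fieldKernel ρ ε w

lemma integral_fieldKernel_mul (ρ : ℝ × ℝ → ℝ) (ε : ℝ) (y z : ℝ × UnitAddCircle) :
    ε * ∫ w, fieldKernel ρ ε (y - w) * fieldKernel ρ ε (z - w) = fieldCov ρ ε (y - z) := by
  rw [fieldCov, ← integral_sub_left_eq_self
    (fun w => fieldKernel ρ ε (y - z + w) * fieldKernel ρ ε w) volume z]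
  simp

/-- The field kernel is square integrable, and the covariance of the rescaled field is continuous
and bounded by the decay function at scale `ε`, uniformly in `ε`. -/
lemma IsMollifier.exists_abs_fieldCov_le {ρ : ℝ × ℝ → ℝ} (hρ : IsMollifier ρ) :
    ∃ C > 0, ∀ ε ∈ Set.Ioo (0 : ℝ) 1, MemLp (fieldKernel ρ ε) 2 ∧ Continuous (fieldCov ρ ε) ∧
      ∀ u, |fieldCov ρ ε u| ≤ C * decay ε u := by
  obtain ⟨A, hA, hκ⟩ := hρ.exists_abs_fieldKernel_le
  obtain ⟨D, hD, h⟩ := exists_lintegral_inv_sq_mul_inv_sq_le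
  refine ⟨A ^ 2 * D, by positivity, fun ε hε => ?_⟩
  obtain ⟨hκc, hκb⟩ := hκ ε hε
  have hε0 := hε.1
  have hprod : ∀ u w, |fieldKernel ρ ε (u + w) * fieldKernel ρ ε w| ≤
      A ^ 2 * (((parNorm (u + w) + ε) ^ 2)⁻¹ * ((parNorm w + ε) ^ 2)⁻¹) := by
    intro u w
    have h1 := parNorm_nonneg (u + w)
    have h2 := parNorm_nonneg w
    rw [abs_mul]
    calc _ ≤ (A * ((parNorm (u + w) + ε) ^ 2)⁻¹) * (A * ((parNorm w + ε) ^ 2)⁻¹) := by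
          gcongr <;> exact hκb _
      _ = _ := by ring
  have hdom : Integrable fun w : ℝ × UnitAddCircle =>
      ((parNorm w + ε) ^ 2)⁻¹ * ((parNorm w + ε) ^ 2)⁻¹ := by
    refine ⟨?_, ?_⟩
    · have := continuous_parNorm.measurable
      exact Measurable.aestronglyMeasurable (by fun_prop)
    · refine lt_of_le_of_lt (lintegral_mono fun w => ?_)
        ((h ε hε0 0).trans_lt ENNReal.ofReal_lt_top)
      have := parNorm_nonneg w
      rw [zero_add, Real.enorm_eq_ofReal (by positivity)]
  refine ⟨?_, ?_, fun u => ?_⟩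
  · rw [memLp_two_iff_integrable_sq hκc.aestronglyMeasurable]
    refine (hdom.const_mul (A ^ 2)).mono' (hκc.pow 2).aestronglyMeasurable
      (Eventually.of_forall fun w => ?_)
    have := hprod 0 w
    rwa [zero_add, ← sq] at this
  · rw [continuous_iff_continuousAt]
    intro u
    refine ContinuousAt.mul continuousAt_const ?_
    have hu := parNorm_nonneg u
    set B := parNorm u + 1 with hB
    refine continuousAt_of_dominated (bound := fun w => A ^ 2 * (1 + B / ε) ^ 2 *
      (((parNorm w + ε) ^ 2)⁻¹ * ((parNorm w + ε) ^ 2)⁻¹))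
      (Eventually.of_forall fun v => Continuous.aestronglyMeasurable (by fun_prop)) ?_
      (hdom.const_mul _) (Eventually.of_forall fun w => Continuous.continuousAt (by fun_prop))
    have hev : ∀ᶠ v in 𝓝 u, parNorm v < B :=
      (continuous_parNorm.tendsto u).eventually_lt_const (lt_add_one _)
    filter_upwards [hev] with v hv
    refine Eventually.of_forall fun w => ?_
    have h1 := parNorm_nonneg (v + w)
    have h2 := parNorm_nonneg w
    have hle : parNorm w + ε ≤ (1 + B / ε) * (parNorm (v + w) + ε) := by
      have := parNorm_add_le (v + w) (-v)
      rw [add_neg_cancel_comm, parNorm_neg] at this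
      have h3 : B ≤ B / ε * (parNorm (v + w) + ε) := by
        rw [div_mul_eq_mul_div, le_div_iff₀ hε0]
        have : 0 ≤ B := by positivity
        nlinarith
      linarith
    have hinv : ((parNorm (v + w) + ε) ^ 2)⁻¹ ≤ (1 + B / ε) ^ 2 * ((parNorm w + ε) ^ 2)⁻¹ := by
      rw [← div_eq_mul_inv, le_div_iff₀ (by positivity), inv_mul_le_iff₀ (by positivity),
        mul_comm, ← mul_pow]
      gcongr
    calc ‖fieldKernel ρ ε (v + w) * fieldKernel ρ ε w‖ ≤ _ := hprod v w
      _ ≤ A ^ 2 * ((1 + B / ε) ^ 2 * ((parNorm w + ε) ^ 2)⁻¹ * ((parNorm w + ε) ^ 2)⁻¹) := by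
          gcongr
      _ = _ := by ring
  · have hu := parNorm_nonneg u
    have hint : |∫ w, fieldKernel ρ ε (u + w) * fieldKernel ρ ε w| ≤
        A ^ 2 * (D * (parNorm u + ε)⁻¹) := by
      rw [← ENNReal.ofReal_le_ofReal_iff (by positivity), ← Real.enorm_eq_ofReal_abs]
      refine (enorm_integral_le_lintegral_enorm _).trans ?_
      rw [ENNReal.ofReal_mul (by positivity)]
      refine le_trans ?_ (mul_le_mul_right (h ε hε0 u) _)
      rw [← lintegral_const_mul' _ _ ENNReal.ofReal_ne_top]
      refine lintegral_mono fun w => ?_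
      rw [← ENNReal.ofReal_mul (by positivity), Real.enorm_eq_ofReal_abs]
      exact ENNReal.ofReal_le_ofReal (hprod u w)
    rw [fieldCov, abs_mul, abs_of_pos hε0, decay]
    calc ε * _ ≤ ε * (A ^ 2 * (D * (parNorm u + ε)⁻¹)) := by gcongr
      _ = _ := by rw [div_eq_mul_inv]; ring

/-! ### The nonlinearity -/

namespace IsAdmissibleNonlinearity

variable {F : ℝ → ℝ}

lemma exists_expBdd (hF : IsAdmissibleNonlinearity F) :
    ∃ C ≥ 1, ExpBdd 4 C F ∧ ExpBdd 4 C (iteratedDeriv 2 F) := by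
  obtain ⟨-, -, C, hC, M, -, hb, -⟩ := hF.growth
  set n := ⌈M⌉₊ with hn
  set D := C * (n.factorial * Real.exp 1) with hD
  have hD0 : 0 ≤ D := by positivity
  have h7 : ExpBdd 7 D F := ⟨hF.contDiff, fun l hl u => by
    refine (hb l hl u).trans ?_
    have h1 : (1 : ℝ) ≤ 1 + |u| := by linarith [abs_nonneg u]
    have h2 : (1 + |u|) ^ M ≤ (1 + |u|) ^ n := by
      rw [← Real.rpow_natCast]
      exact Real.rpow_le_rpow_of_exponent_le h1 (Nat.le_ceil M)
    have h3 := Real.pow_div_factorial_le_exp _ (by linarith : 0 ≤ 1 + |u|) n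
    rw [div_le_iff₀ (by positivity), Real.exp_add] at h3
    rw [hD, mul_assoc C]
    gcongr
    linarith⟩
  have h5 : ExpBdd 5 D (iteratedDeriv 2 F) := by
    have : iteratedDeriv 2 F = deriv (deriv F) := by
      rw [iteratedDeriv_succ, iteratedDeriv_one]
    rw [this]
    exact h7.deriv.deriv
  exact ⟨max D 1, le_max_right _ _, (h7.of_le (by norm_num)).mono (le_max_left _ _),
    (h5.of_le (by norm_num)).mono (le_max_left _ _)⟩

lemma even_iteratedDeriv_two (hF : IsAdmissibleNonlinearity F) (u : ℝ) :
    iteratedDeriv 2 F (-u) = iteratedDeriv 2 F u := by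
  have h := iteratedDeriv_comp_neg 2 F u
  rw [show (fun x => F (-x)) = F from funext hF.even] at h
  simpa using h.symm

end IsAdmissibleNonlinearity

/-! ### The Gaussian field -/

section Field

variable {Ω : Type*} [MeasurableSpace Ω] {P : Measure Ω}
  {ξ : (ℝ × UnitAddCircle → ℝ) → Ω → ℝ} {ρ : ℝ × ℝ → ℝ} {ε : ℝ}

/-- The rescaled field `ε^{1/2} Ψ_ε` on `ℝ × 𝕋`. -/
noncomputable def scaledTorus (ξ : (ℝ × UnitAddCircle → ℝ) → Ω → ℝ) (ρ : ℝ × ℝ → ℝ) (ε : ℝ)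
    (s : ℝ × UnitAddCircle) (ω : Ω) : ℝ :=
  √ε * fieldTorus ξ ρ ε s ω

omit [MeasurableSpace Ω] in
lemma scaledTorus_eq (s : ℝ × UnitAddCircle) (ω : Ω) :
    scaledTorus ξ ρ ε s ω = √ε * ξ (fun w => fieldKernel ρ ε (s - w)) ω := rfl

lemma memLp_fieldKernel_sub (hκ : MemLp (fieldKernel ρ ε) 2) (s : ℝ × UnitAddCircle) :
    MemLp (fun w => fieldKernel ρ ε (s - w)) 2 :=
  hκ.comp_measurePreserving (Measure.measurePreserving_sub_left volume s)

lemma hasGaussianLaw_scaledTorus (hξ : IsWhiteNoise ξ volume P)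
    (hκ : MemLp (fieldKernel ρ ε) 2) (x y z : ℝ × UnitAddCircle) :
    HasGaussianLaw (fun ω =>
      (scaledTorus ξ ρ ε x ω, scaledTorus ξ ρ ε y ω, scaledTorus ξ ρ ε z ω)) P := by
  classical
  let t : ℝ × UnitAddCircle → {f : ℝ × UnitAddCircle → ℝ // MemLp f 2} :=
    fun s => ⟨_, memLp_fieldKernel_sub hκ s⟩
  let π : ∀ s ∈ ({t x, t y, t z} : Finset _), (({t x, t y, t z} : Finset _) → ℝ) →L[ℝ] ℝ :=
    fun s hs => √ε • ContinuousLinearMap.proj ⟨s, hs⟩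
  exact (hξ.gaussian.hasGaussianLaw {t x, t y, t z}).map
    ((π (t x) (by simp)).prod ((π (t y) (by simp)).prod (π (t z) (by simp))))

lemma integral_scaledTorus (hξ : IsWhiteNoise ξ volume P)
    (hκ : MemLp (fieldKernel ρ ε) 2) (s : ℝ × UnitAddCircle) :
    ∫ ω, scaledTorus ξ ρ ε s ω ∂P = 0 := by
  simp only [scaledTorus_eq]
  rw [integral_const_mul, hξ.mean _ (memLp_fieldKernel_sub hκ s), mul_zero]

lemma integral_scaledTorus_mul (hξ : IsWhiteNoise ξ volume P) (hε : 0 ≤ ε)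
    (hκ : MemLp (fieldKernel ρ ε) 2) (y z : ℝ × UnitAddCircle) :
    ∫ ω, scaledTorus ξ ρ ε y ω * scaledTorus ξ ρ ε z ω ∂P = fieldCov ρ ε (y - z) := by
  simp only [scaledTorus_eq]
  rw [← integral_fieldKernel_mul, ← hξ.covariance _ _ (memLp_fieldKernel_sub hκ y)
    (memLp_fieldKernel_sub hκ z), ← integral_const_mul]
  refine integral_congr_ae (ae_of_all _ fun ω => ?_)
  simp only
  rw [mul_mul_mul_comm, Real.mul_self_sqrt hε]

lemma hasGaussianLaw_scaledTorus_single (hξ : IsWhiteNoise ξ volume P)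
    (hκ : MemLp (fieldKernel ρ ε) 2) (s : ℝ × UnitAddCircle) :
    HasGaussianLaw (scaledTorus ξ ρ ε s) P :=
  (hasGaussianLaw_scaledTorus hξ hκ s s s).fst

lemma map_scaledTorus (hξ : IsWhiteNoise ξ volume P) (hε : 0 ≤ ε)
    (hκ : MemLp (fieldKernel ρ ε) 2) (s : ℝ × UnitAddCircle) :
    P.map (scaledTorus ξ ρ ε s) = gaussianReal 0 (fieldCov ρ ε 0).toNNReal := by
  have h := hasGaussianLaw_scaledTorus_single hξ hκ s
  rw [h.map_eq_gaussianReal, variance_of_integral_eq_zero h.aemeasurable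
    (integral_scaledTorus hξ hκ s), integral_scaledTorus hξ hκ s]
  simp only [sq, integral_scaledTorus_mul hξ hε hκ, sub_self]

lemma tendsto_integral_scaledTorus_sub_sq (hξ : IsWhiteNoise ξ volume P) (hε : 0 ≤ ε)
    (hκ : MemLp (fieldKernel ρ ε) 2) (hc : Continuous (fieldCov ρ ε)) (t : ℝ × UnitAddCircle) :
    Tendsto (fun s => ∫ ω, (scaledTorus ξ ρ ε s ω - scaledTorus ξ ρ ε t ω) ^ 2 ∂P)
      (𝓝 t) (𝓝 0) := by
  have hL := fun s => (hasGaussianLaw_scaledTorus_single (ρ := ρ) (ε := ε) hξ hκ s).memLp_two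
  have hi : ∀ s s', Integrable (fun ω => scaledTorus ξ ρ ε s ω * scaledTorus ξ ρ ε s' ω) P :=
    fun s s' => (hL s).integrable_mul (hL s')
  have h : ∀ s, ∫ ω, (scaledTorus ξ ρ ε s ω - scaledTorus ξ ρ ε t ω) ^ 2 ∂P =
      fieldCov ρ ε 0 - 2 * fieldCov ρ ε (s - t) + fieldCov ρ ε 0 := by
    intro s
    have e : ∀ ω, (scaledTorus ξ ρ ε s ω - scaledTorus ξ ρ ε t ω) ^ 2 =
        scaledTorus ξ ρ ε s ω * scaledTorus ξ ρ ε s ω -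
          2 * (scaledTorus ξ ρ ε s ω * scaledTorus ξ ρ ε t ω) +
          scaledTorus ξ ρ ε t ω * scaledTorus ξ ρ ε t ω := fun ω => by ring
    simp only [e]
    have hd : Integrable (fun ω => scaledTorus ξ ρ ε s ω * scaledTorus ξ ρ ε s ω -
        2 * (scaledTorus ξ ρ ε s ω * scaledTorus ξ ρ ε t ω)) P :=
      (hi s s).sub ((hi s t).const_mul 2)
    rw [integral_add hd (hi t t),
      integral_sub (hi s s) ((hi s t).const_mul 2), integral_const_mul]
    simp only [integral_scaledTorus_mul hξ hε hκ, sub_self]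
  simp only [h]
  have : Continuous fun s => fieldCov ρ ε 0 - 2 * fieldCov ρ ε (s - t) + fieldCov ρ ε 0 := by
    fun_prop
  have h2 := this.tendsto t
  rwa [sub_self, show fieldCov ρ ε 0 - 2 * fieldCov ρ ε 0 + fieldCov ρ ε 0 = 0 by ring] at h2

end Field

/-! ### The three-point function -/

/-- Here `s₁` is the decay function of the shortest side of a triangle; the other two sides are
comparable. -/
lemma sq_add_mul_add_le {s₁ s₂ s₃ : ℝ} (h₁ : 0 ≤ s₁) (h₂ : 0 ≤ s₂) (h₃ : 0 ≤ s₃)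
    (h₂₃ : s₂ ≤ 2 * s₃) (h₃₂ : s₃ ≤ 2 * s₂) (h₂₁ : s₂ ≤ s₁) (h₃₁ : s₃ ≤ s₁) :
    (s₂ + s₃) ^ 2 * (s₁ + s₂ + s₃) ≤ 27 * (s₁ * s₂ * s₃) := by
  calc (s₂ + s₃) ^ 2 * (s₁ + s₂ + s₃) = (s₂ + s₃) * (s₂ + s₃) * (s₁ + s₂ + s₃) := by ring
    _ ≤ (3 * s₂) * (3 * s₃) * (3 * s₁) := by gcongr <;> linarith
    _ = _ := by ring

lemma decay_le_two_mul {η : ℝ} (hη : 0 < η) {z w : ℝ × UnitAddCircle}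
    (h : parNorm w ≤ 2 * parNorm z) : decay η z ≤ 2 * decay η w := by
  have h1 := parNorm_nonneg z
  have h2 := parNorm_nonneg w
  rw [decay, decay, ← mul_div_assoc, div_le_div_iff₀ (by positivity) (by positivity)]
  nlinarith

/-- If a quantity is controlled by each of the three bounds of the cubic estimate, then it is
controlled by the product of the three decay functions: use the bound that squares the two longer
sides of the triangle, which are comparable. -/
lemma le_mul_decay_mul_decay_mul_decay {η I T : ℝ} (hη : 0 < η) (hT : 0 ≤ T)
    (x y z : ℝ × UnitAddCircle)
    (h₁ : I ≤ T * ((decay η (x - z) + decay η (y - z)) ^ 2 *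
      (decay η (x - y) + decay η (x - z) + decay η (y - z))))
    (h₂ : I ≤ T * ((decay η (x - y) + decay η (y - z)) ^ 2 *
      (decay η (x - y) + decay η (x - z) + decay η (y - z))))
    (h₃ : I ≤ T * ((decay η (x - y) + decay η (x - z)) ^ 2 *
      (decay η (x - y) + decay η (x - z) + decay η (y - z)))) :
    I ≤ 27 * T * (decay η (x - y) * decay η (x - z) * decay η (y - z)) := by
  have t1 : parNorm (x - z) ≤ parNorm (x - y) + parNorm (y - z) := parNorm_sub_le _ _ _
  have t2 : parNorm (x - y) ≤ parNorm (x - z) + parNorm (y - z) := by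
    rw [parNorm_sub_comm y z]; exact parNorm_sub_le _ _ _
  have t3 : parNorm (y - z) ≤ parNorm (x - y) + parNorm (x - z) := by
    rw [parNorm_sub_comm x y]; exact parNorm_sub_le _ _ _
  have p1 := (decay_pos hη (x - y)).le
  have p2 := (decay_pos hη (x - z)).le
  have p3 := (decay_pos hη (y - z)).le
  have two : ∀ {u v : ℝ × UnitAddCircle}, parNorm v ≤ 2 * parNorm u → decay η u ≤ 2 * decay η v :=
    fun h => decay_le_two_mul hη h
  have anti : ∀ {u v : ℝ × UnitAddCircle}, parNorm u ≤ parNorm v → decay η v ≤ decay η u :=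
    fun h => decay_anti hη h
  rcases le_total (parNorm (x - y)) (parNorm (x - z)) with h12 | h12
  · rcases le_total (parNorm (x - y)) (parNorm (y - z)) with h13 | h13
    · have := sq_add_mul_add_le p1 p2 p3 (two (by linarith)) (two (by linarith)) (anti h12)
        (anti h13)
      refine h₁.trans ((mul_le_mul_of_nonneg_left this hT).trans (le_of_eq (by ring)))
    · have := sq_add_mul_add_le p3 p1 p2 (two (by linarith)) (two (by linarith)) (anti h13)
        (anti (h13.trans h12))
      refine h₃.trans ((le_of_eq (by ring)).trans
        ((mul_le_mul_of_nonneg_left this hT).trans (le_of_eq (by ring))))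
  · rcases le_total (parNorm (x - z)) (parNorm (y - z)) with h13 | h13
    · have := sq_add_mul_add_le p2 p1 p3 (two (by linarith)) (two (by linarith)) (anti h12)
        (anti h13)
      refine h₂.trans ((le_of_eq (by ring)).trans
        ((mul_le_mul_of_nonneg_left this hT).trans (le_of_eq (by ring))))
    · have := sq_add_mul_add_le p3 p1 p2 (two (by linarith)) (two (by linarith))
        (anti (h13.trans h12)) (anti h13)
      refine h₃.trans ((le_of_eq (by ring)).trans
        ((mul_le_mul_of_nonneg_left this hT).trans (le_of_eq (by ring))))

lemma tripleConst_nonneg {C R : ℝ} (hC : 1 ≤ C) (hR : 0 ≤ R) : 0 ≤ tripleConst C R := by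
  have hM := one_le_expMoment (E := EuclideanSpace ℝ (Fin 4)) hR
  unfold tripleConst
  positivity

/-- The three-point function of `(F'', F, F)` evaluated on the rescaled field: the product is
integrable, its expectation is bounded by a product of decay functions and depends measurably on
the points. -/
lemma exists_abs_integral_tripleProduct_le {Ω : Type*} [MeasurableSpace Ω] {P : Measure Ω}
    [IsProbabilityMeasure P] {ξ : (ℝ × UnitAddCircle → ℝ) → Ω → ℝ}
    (hξ : IsWhiteNoise ξ volume P) {F : ℝ → ℝ} (hF : IsAdmissibleNonlinearity F)
    {ρ : ℝ × ℝ → ℝ} (hρ : IsMollifier ρ) :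
    ∃ C > 0, ∀ ε ∈ Set.Ioo (0 : ℝ) 1, ∀ x : ℝ × ℝ,
      Measurable (fun yz : (ℝ × ℝ) × (ℝ × ℝ) => ∫ ω, tripleProduct P ξ ρ F ε x yz.1 yz.2 ω ∂P) ∧
      ∀ y z : ℝ × ℝ, Integrable (tripleProduct P ξ ρ F ε x y z) P ∧
        |∫ ω, tripleProduct P ξ ρ F ε x y z ω ∂P| ≤
          C * (decay ε (proj x - proj y) * decay ε (proj x - proj z) *
            decay ε (proj y - proj z)) := by
  obtain ⟨A, hA, hcov⟩ := hρ.exists_abs_fieldCov_le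
  obtain ⟨B, hB, hF0, hF2⟩ := hF.exists_expBdd
  have hT := tripleConst_nonneg hB (Real.sqrt_nonneg A)
  refine ⟨27 * (tripleConst B (√A) * A ^ 3) + 1, by positivity, fun ε hε x => ?_⟩
  obtain ⟨hκ, hc, hb⟩ := hcov ε hε
  have hε0 := hε.1
  have hlaw := map_scaledTorus hξ hε0.le hκ
  have hm := fun s => (hasGaussianLaw_scaledTorus_single hξ hκ s).aemeasurable
  constructor
  -- the means do not depend on the points, so measurability follows from mean square continuity
  · have hconst : ∀ (G : ℝ → ℝ), Continuous G → ∀ s, ∫ ω, G (scaledTorus ξ ρ ε s ω) ∂P =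
        ∫ u, G u ∂gaussianReal 0 (fieldCov ρ ε 0).toNNReal := fun G hG s => by
      rw [← hlaw s, integral_map (hm s) hG.aestronglyMeasurable]
    set m₂ := ∫ u, iteratedDeriv 2 F u ∂gaussianReal 0 (fieldCov ρ ε 0).toNNReal with hm₂
    set m₀ := ∫ u, F u ∂gaussianReal 0 (fieldCov ρ ε 0).toNNReal with hm₀
    have e : ∀ y z ω, tripleProduct P ξ ρ F ε x y z ω =
        (iteratedDeriv 2 F (scaledTorus ξ ρ ε (proj x) ω) - m₂) *
          (F (scaledTorus ξ ρ ε (proj y) ω) - m₀) *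
          (F (scaledTorus ξ ρ ε (proj z) ω) - m₀) := by
      intro y z ω
      change (iteratedDeriv 2 F (scaledTorus ξ ρ ε (proj x) ω) -
          ∫ ω', iteratedDeriv 2 F (scaledTorus ξ ρ ε (proj x) ω') ∂P) *
        (F (scaledTorus ξ ρ ε (proj y) ω) - ∫ ω', F (scaledTorus ξ ρ ε (proj y) ω') ∂P) *
        (F (scaledTorus ξ ρ ε (proj z) ω) - ∫ ω', F (scaledTorus ξ ρ ε (proj z) ω') ∂P) = _
      rw [hconst _ hF2.continuous, hconst _ hF0.continuous, hconst _ hF0.continuous]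
    have hcont := continuous_integral_triple hm hlaw
      (tendsto_integral_scaledTorus_sub_sq hξ hε0.le hκ hc)
      (((hF2.of_le (by norm_num)).sub_const m₂).mono (le_max_left _ (B + |m₀|)))
      (((hF0.of_le (by norm_num)).sub_const m₀).mono (le_max_right (B + |m₂|) _))
      (((hF0.of_le (by norm_num)).sub_const m₀).mono (le_max_right (B + |m₂|) _)) (proj x)
    simp only [e]
    exact (hcont.comp ((continuous_proj.comp continuous_fst).prodMk
      (continuous_proj.comp continuous_snd))).measurable
  · intro y z
    have hv : ∀ s, ∫ ω, scaledTorus ξ ρ ε s ω * scaledTorus ξ ρ ε s ω ∂P ≤ √A ^ 2 := fun s => by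
      rw [integral_scaledTorus_mul hξ hε0.le hκ, Real.sq_sqrt hA.le]
      refine (le_abs_self _).trans ((hb _).trans (mul_le_of_le_one_right hA.le ?_))
      exact decay_le_one hε0 _
    have hr : ∀ s t, |∫ ω, scaledTorus ξ ρ ε s ω * scaledTorus ξ ρ ε t ω ∂P| ≤
        A * decay ε (s - t) := fun s t => by
      rw [integral_scaledTorus_mul hξ hε0.le hκ]; exact hb _
    obtain ⟨hi, h₁, h₂, h₃⟩ := abs_integral_cent_mul_le
      (hasGaussianLaw_scaledTorus hξ hκ (proj x) (proj y) (proj z))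
      (integral_scaledTorus hξ hκ _) (integral_scaledTorus hξ hκ _) (integral_scaledTorus hξ hκ _)
      hB (Real.sqrt_nonneg A) hF2 hF0 hF0 hF.even_iteratedDeriv_two hF.even hF.even
      (hv _) (hv _) (hv _) (hr _ _) (hr _ _) (hr _ _)
    refine ⟨hi, ?_⟩
    have := le_mul_decay_mul_decay_mul_decay (T := tripleConst B (√A) * A ^ 3) hε0 (by positivity)
      (proj x) (proj y) (proj z) (h₁.trans (le_of_eq (by ring))) (h₂.trans (le_of_eq (by ring)))
      (h₃.trans (le_of_eq (by ring)))
    refine le_trans this ?_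
    have p1 := (decay_pos hε0 (proj x - proj y)).le
    have p2 := (decay_pos hε0 (proj x - proj z)).le
    have p3 := (decay_pos hε0 (proj y - proj z)).le
    gcongr
    linarith

/-! ### The triangle integral -/

/-- The weight `|z|^{-1/2}`. -/
noncomputable def invSqrt (z : ℝ × UnitAddCircle) : ℝ := (√(parNorm z))⁻¹

lemma invSqrt_nonneg (z : ℝ × UnitAddCircle) : 0 ≤ invSqrt z := by unfold invSqrt; positivity

lemma invSqrt_pow (z : ℝ × UnitAddCircle) (n : ℕ) :
    invSqrt z ^ n = parNorm z ^ (-((n : ℝ) / 2)) := by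
  have h := parNorm_nonneg z
  rw [invSqrt, Real.sqrt_eq_rpow, inv_pow, ← Real.rpow_natCast, ← Real.rpow_mul h,
    Real.rpow_neg h]
  congr 2
  ring

/-- The weight `|z|^{-5/2} (η / (|z| + η))`. -/
noncomputable def weightFive (η : ℝ) (z : ℝ × UnitAddCircle) : ℝ := invSqrt z ^ 5 * decay η z

/-- The weight `|z|^{-3/2} (η / (|z| + η))²`. -/
noncomputable def weightThree (η : ℝ) (z : ℝ × UnitAddCircle) : ℝ :=
  invSqrt z ^ 3 * decay η z ^ 2

lemma measurable_invSqrt : Measurable invSqrt := by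
  have := continuous_parNorm.measurable
  unfold invSqrt; fun_prop

lemma measurable_weightFive (η : ℝ) : Measurable (weightFive η) :=
  (measurable_invSqrt.pow_const 5).mul (measurable_decay η)

lemma measurable_weightThree (η : ℝ) : Measurable (weightThree η) :=
  (measurable_invSqrt.pow_const 3).mul ((measurable_decay η).pow_const 2)

lemma exists_lintegral_weightFive_mul_weightThree_le : ∃ C > 0, ∀ η > 0,
    (∫⁻ z, ENNReal.ofReal (weightFive η z)) * (∫⁻ z, ENNReal.ofReal (weightThree η z)) ≤
      ENNReal.ofReal (C * η ^ 2) := by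
  obtain ⟨C₁, h₁, H₁⟩ := exists_lintegral_weight_le (p := 5 / 2) (q := 1) (by norm_num)
    (by norm_num) (by norm_num) (by norm_num)
  obtain ⟨C₂, h₂, H₂⟩ := exists_lintegral_weight_le (p := 3 / 2) (q := 2) (by norm_num)
    (by norm_num) (by norm_num) (by norm_num)
  refine ⟨C₁ * C₂, by positivity, fun η hη => ?_⟩
  have e₁ : ∀ z, weightFive η z = parNorm z ^ (-(5 / 2 : ℝ)) * decay η z ^ (1 : ℝ) := fun z => by
    rw [weightFive, invSqrt_pow, Real.rpow_one]; norm_num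
  have e₂ : ∀ z, weightThree η z = parNorm z ^ (-(3 / 2 : ℝ)) * decay η z ^ (2 : ℝ) := fun z => by
    rw [weightThree, invSqrt_pow, Real.rpow_two]; norm_num
  simp only [e₁, e₂]
  refine (mul_le_mul' (H₁ η hη) (H₂ η hη)).trans (le_of_eq ?_)
  rw [← ENNReal.ofReal_mul (by positivity), mul_mul_mul_comm, ← Real.rpow_add hη,
    ← Real.rpow_two]
  norm_num

/-- A bound of the weights of a triangle: `p, q, r` are the inverse square roots of the side lengths
and `s₁, s₂, s₃` the decay functions. The second side is not shorter than the first. Either the first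
side is the shortest, or the third side is not longer than the first; the two terms on the right
involve the two shortest sides in these cases, up to a factor of `2`. -/
lemma triangle_weight_le_of_le {p q r s₁ s₂ s₃ : ℝ} (hp : 0 ≤ p) (hq : 0 ≤ q) (hr : 0 ≤ r)
    (h₁ : 0 ≤ s₁) (h₂ : 0 ≤ s₂) (h₃ : 0 ≤ s₃) (hqp : q ≤ p) (hs : s₂ ≤ s₁)
    (h : (r ≤ p ∧ s₃ ≤ 2 * s₂) ∨ p ≤ r) :
    p ^ 4 * q ^ 4 * (s₁ * s₂ * s₃) ≤
      2 * (p ^ 5 * s₁ * (q ^ 3 * s₂ ^ 2)) + r ^ 5 * s₃ * (p ^ 3 * s₁ ^ 2) := by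
  have e1 : 0 ≤ p ^ 5 * s₁ * (q ^ 3 * s₂ ^ 2) := by positivity
  have e2 : 0 ≤ r ^ 5 * s₃ * (p ^ 3 * s₁ ^ 2) := by positivity
  rcases h with ⟨hrp, h32⟩ | hpr
  · calc p ^ 4 * q ^ 4 * (s₁ * s₂ * s₃) = p ^ 4 * q ^ 3 * q * (s₁ * s₂ * s₃) := by ring
      _ ≤ p ^ 4 * q ^ 3 * p * (s₁ * s₂ * (2 * s₂)) := by gcongr
      _ = 2 * (p ^ 5 * s₁ * (q ^ 3 * s₂ ^ 2)) := by ring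
      _ ≤ _ := by linarith
  · calc p ^ 4 * q ^ 4 * (s₁ * s₂ * s₃) ≤ p ^ 4 * p ^ 4 * (s₁ * s₁ * s₃) := by gcongr
      _ = p ^ 5 * (s₃ * (p ^ 3 * s₁ ^ 2)) := by ring
      _ ≤ r ^ 5 * (s₃ * (p ^ 3 * s₁ ^ 2)) := by gcongr
      _ = r ^ 5 * s₃ * (p ^ 3 * s₁ ^ 2) := by ring
      _ ≤ _ := by linarith

/-- The integrand of the triangle integral is bounded by sums of products of two integrable
weights, one for each of the two shortest sides. -/
lemma triangle_weight_le {η : ℝ} (hη : 0 < η) {y z : ℝ × UnitAddCircle} (hy : y ≠ 0)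
    (hz : z ≠ 0) (hyz : y ≠ z) :
    invSqrt y ^ 4 * invSqrt z ^ 4 * (decay η y * decay η z * decay η (y - z)) ≤
      2 * (weightFive η y * weightThree η z + weightFive η z * weightThree η y +
        weightFive η (y - z) * weightThree η y + weightFive η (y - z) * weightThree η z) := by
  have hw : y - z ≠ 0 := sub_ne_zero.2 hyz
  have anti : ∀ {u v : ℝ × UnitAddCircle}, u ≠ 0 → parNorm u ≤ parNorm v →
      invSqrt v ≤ invSqrt u := fun hu h => by
    have := parNorm_pos hu
    unfold invSqrt; gcongr
  have p1 := (decay_pos hη y).le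
  have p2 := (decay_pos hη z).le
  have p3 := (decay_pos hη (y - z)).le
  have q1 := invSqrt_nonneg y
  have q2 := invSqrt_nonneg z
  have q3 := invSqrt_nonneg (y - z)
  have n1 := parNorm_nonneg y
  have n2 := parNorm_nonneg z
  have t1 : parNorm z ≤ parNorm y + parNorm (y - z) := by
    have := parNorm_add_le y (z - y)
    rwa [add_sub_cancel, parNorm_sub_comm] at this
  have t2 : parNorm y ≤ parNorm z + parNorm (y - z) := by
    simpa using parNorm_add_le z (y - z)
  unfold weightFive weightThree
  have m1 : 0 ≤ invSqrt y ^ 5 * decay η y * (invSqrt z ^ 3 * decay η z ^ 2) := by positivity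
  have m2 : 0 ≤ invSqrt z ^ 5 * decay η z * (invSqrt y ^ 3 * decay η y ^ 2) := by positivity
  have m3 : 0 ≤ invSqrt (y - z) ^ 5 * decay η (y - z) * (invSqrt y ^ 3 * decay η y ^ 2) := by
    positivity
  have m4 : 0 ≤ invSqrt (y - z) ^ 5 * decay η (y - z) * (invSqrt z ^ 3 * decay η z ^ 2) := by
    positivity
  rcases le_total (parNorm y) (parNorm z) with h | h
  · have := triangle_weight_le_of_le q1 q2 q3 p1 p2 p3 (anti hy h) (decay_anti hη h) (by
      rcases le_total (parNorm y) (parNorm (y - z)) with h' | h'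
      · exact Or.inl ⟨anti hy h', decay_le_two_mul hη (by linarith)⟩
      · exact Or.inr (anti hw h'))
    linarith
  · have := triangle_weight_le_of_le q2 q1 q3 p2 p1 p3 (anti hz h) (decay_anti hη h) (by
      rcases le_total (parNorm z) (parNorm (y - z)) with h' | h'
      · exact Or.inl ⟨anti hz h', decay_le_two_mul hη (by linarith)⟩
      · exact Or.inr (anti hw h'))
    linarith

/-! ### Integration over a strip -/

lemma setLIntegral_Ioc_coe_le {g : UnitAddCircle → ℝ≥0∞} (a : ℝ) (n : ℕ) :
    ∫⁻ x in Set.Ioc a (a + n), g (x : UnitAddCircle) ≤ n * ∫⁻ x, g x := by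
  induction n with
  | zero => simp
  | succ n ih =>
    have hsub : Set.Ioc a (a + (n + 1 : ℕ)) ⊆
        Set.Ioc a (a + n) ∪ Set.Ioc (a + n) (a + n + 1) := by
      intro x hx
      push_cast at hx
      rcases le_or_gt x (a + n) with h | h
      · exact Or.inl ⟨hx.1, h⟩
      · exact Or.inr ⟨h, by linarith [hx.2]⟩
    calc _ ≤ ∫⁻ x in Set.Ioc a (a + n) ∪ Set.Ioc (a + n) (a + n + 1), g (x : UnitAddCircle) :=
          lintegral_mono_set hsub
      _ ≤ _ := lintegral_union_le _ _ _
      _ ≤ n * (∫⁻ x, g x) + ∫⁻ x, g x := by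
          gcongr
          exact (UnitAddCircle.lintegral_preimage _ _).le
      _ = _ := by push_cast; ring

/-- A strip of integral width that contains `{|x| ≤ N}`. -/
def strip (N : ℕ) : Set (ℝ × ℝ) := Set.univ ×ˢ Set.Ioc (-((N : ℝ) + 1)) (-((N : ℝ) + 1) + (2 * N + 2 : ℕ))

lemma setLIntegral_strip_le {G : ℝ × UnitAddCircle → ℝ≥0∞} (hG : Measurable G) (N : ℕ) :
    ∫⁻ z in strip N, G (proj z) ≤ (2 * N + 2 : ℕ) * ∫⁻ z, G z := by
  have hGp : Measurable fun z : ℝ × ℝ => G (proj z) := hG.comp continuous_proj.measurable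
  rw [strip, Measure.volume_eq_prod, ← Measure.prod_restrict, Measure.restrict_univ,
    lintegral_prod _ hGp.aemeasurable, Measure.volume_eq_prod,
    lintegral_prod _ hG.aemeasurable, ← lintegral_const_mul' _ _ (ENNReal.natCast_ne_top _)]
  exact lintegral_mono fun t => setLIntegral_Ioc_coe_le (g := fun x => G (t, x)) _ _

lemma mem_strip {N : ℕ} {z : ℝ × ℝ} (h : |z.2| ≤ N) : z ∈ strip N := by
  have := abs_le.1 h
  refine ⟨Set.mem_univ _, by linarith, ?_⟩
  push_cast
  linarith

/-- The triangle integral over a strip is of order `η²`. -/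
lemma exists_setLIntegral_triangle_le (N : ℕ) : ∃ C > 0, ∀ η > 0,
    ∫⁻ y in strip N, ∫⁻ z in strip N, ENNReal.ofReal (invSqrt (proj y) ^ 4 * invSqrt (proj z) ^ 4 *
      (decay η (proj y) * decay η (proj z) * decay η (proj y - proj z))) ≤
        ENNReal.ofReal (C * η ^ 2) := by
  obtain ⟨C, hC, hUV⟩ := exists_lintegral_weightFive_mul_weightThree_le
  refine ⟨8 * ((2 * N + 2 : ℕ) ^ 2 * C), by positivity, fun η hη => ?_⟩
  set u : ℝ × UnitAddCircle → ℝ≥0∞ := fun z => ENNReal.ofReal (weightFive η z) with hu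
  set v : ℝ × UnitAddCircle → ℝ≥0∞ := fun z => ENNReal.ofReal (weightThree η z) with hv
  have hum : Measurable u := (measurable_weightFive η).ennreal_ofReal
  have hvm : Measurable v := (measurable_weightThree η).ennreal_ofReal
  set m : ℝ≥0∞ := ((2 * N + 2 : ℕ) : ℝ≥0∞) with hm
  set U := ∫⁻ z, u z with hU
  set V := ∫⁻ z, v z with hV
  have hpt : ∀ᵐ y : ℝ × ℝ, ∀ᵐ z : ℝ × ℝ, ENNReal.ofReal
      (invSqrt (proj y) ^ 4 * invSqrt (proj z) ^ 4 *
        (decay η (proj y) * decay η (proj z) * decay η (proj y - proj z))) ≤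
      2 * (u (proj y) * v (proj z) + v (proj y) * u (proj z) +
        v (proj y) * u (proj y - proj z) + u (proj y - proj z) * v (proj z)) := by
    have hne : ∀ c : ℝ, ∀ᵐ z : ℝ × ℝ, z.1 ≠ c := fun c =>
      (Measure.quasiMeasurePreserving_fst (μ := (volume : Measure ℝ))
        (ν := (volume : Measure ℝ))).ae (Measure.ae_ne volume c)
    filter_upwards [hne 0] with y hy
    filter_upwards [hne 0, hne y.1] with z hz hyz
    have h := triangle_weight_le hη (y := proj y) (z := proj z)
      (fun h0 => hy (congrArg Prod.fst h0)) (fun h0 => hz (congrArg Prod.fst h0))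
      (fun h0 => hyz (congrArg Prod.fst h0).symm)
    refine (ENNReal.ofReal_le_ofReal h).trans (le_of_eq ?_)
    have p : ∀ w, 0 ≤ weightFive η w := fun w =>
      mul_nonneg (pow_nonneg (invSqrt_nonneg w) 5) (decay_pos hη w).le
    have q : ∀ w, 0 ≤ weightThree η w := fun w =>
      mul_nonneg (pow_nonneg (invSqrt_nonneg w) 3) (sq_nonneg _)
    have p1 := p (proj y); have p2 := p (proj z); have p3 := p (proj y - proj z)
    have q1 := q (proj y); have q2 := q (proj z)
    simp only [hu, hv]
    rw [ENNReal.ofReal_mul (by norm_num), ENNReal.ofReal_add (by positivity) (by positivity),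
      ENNReal.ofReal_add (by positivity) (by positivity),
      ENNReal.ofReal_add (by positivity) (by positivity), ENNReal.ofReal_mul p1,
      ENNReal.ofReal_mul p2, ENNReal.ofReal_mul p3, ENNReal.ofReal_mul p3,
      mul_comm (ENNReal.ofReal (weightFive η (proj z))),
      mul_comm (ENNReal.ofReal (weightFive η (proj y - proj z)))
        (ENNReal.ofReal (weightThree η (proj y)))]
    simp
  set ν : Measure (ℝ × ℝ) := volume.restrict (strip N) with hν
  have hpm := continuous_proj.measurable
  have bound : ∀ {g : ℝ × UnitAddCircle → ℝ≥0∞}, Measurable g →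
      ∫⁻ z, g (proj z) ∂ν ≤ m * ∫⁻ z, g z := fun hg => setLIntegral_strip_le hg N
  have hu' : Measurable fun z : ℝ × ℝ => u (proj z) := hum.comp hpm
  have hv' : Measurable fun z : ℝ × ℝ => v (proj z) := hvm.comp hpm
  have hd' : Measurable fun p : (ℝ × ℝ) × (ℝ × ℝ) => u (proj p.1 - proj p.2) :=
    hum.comp ((hpm.comp measurable_fst).sub (hpm.comp measurable_snd))
  have m₁ : Measurable fun p : (ℝ × ℝ) × (ℝ × ℝ) => u (proj p.1) * v (proj p.2) :=
    (hu'.comp measurable_fst).mul (hv'.comp measurable_snd)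
  have m₂ : Measurable fun p : (ℝ × ℝ) × (ℝ × ℝ) => v (proj p.1) * u (proj p.2) :=
    (hv'.comp measurable_fst).mul (hu'.comp measurable_snd)
  have m₃ : Measurable fun p : (ℝ × ℝ) × (ℝ × ℝ) => v (proj p.1) * u (proj p.1 - proj p.2) :=
    (hv'.comp measurable_fst).mul hd'
  have m₄ : Measurable fun p : (ℝ × ℝ) × (ℝ × ℝ) => u (proj p.1 - proj p.2) * v (proj p.2) :=
    hd'.mul (hv'.comp measurable_snd)
  have m₁₂ : Measurable fun p : (ℝ × ℝ) × (ℝ × ℝ) => u (proj p.1) * v (proj p.2) +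
      v (proj p.1) * u (proj p.2) := m₁.add m₂
  have m₁₂₃ : Measurable fun p : (ℝ × ℝ) × (ℝ × ℝ) => u (proj p.1) * v (proj p.2) +
      v (proj p.1) * u (proj p.2) + v (proj p.1) * u (proj p.1 - proj p.2) := m₁₂.add m₃
  have i₁ : ∫⁻ p, u (proj p.1) * v (proj p.2) ∂(ν.prod ν) ≤ m ^ 2 * (U * V) := by
    rw [lintegral_prod_mul hu'.aemeasurable hv'.aemeasurable]
    exact (mul_le_mul' (bound hum) (bound hvm)).trans (le_of_eq (by ring))
  have i₂ : ∫⁻ p, v (proj p.1) * u (proj p.2) ∂(ν.prod ν) ≤ m ^ 2 * (U * V) := by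
    rw [lintegral_prod_mul hv'.aemeasurable hu'.aemeasurable]
    exact (mul_le_mul' (bound hvm) (bound hum)).trans (le_of_eq (by ring))
  have i₃ : ∫⁻ p, v (proj p.1) * u (proj p.1 - proj p.2) ∂(ν.prod ν) ≤ m ^ 2 * (U * V) := by
    rw [lintegral_prod _ m₃.aemeasurable]
    calc _ ≤ ∫⁻ y, v (proj y) * (m * U) ∂ν := by
          refine lintegral_mono fun y => ?_
          simp only
          rw [lintegral_const_mul' _ _ ENNReal.ofReal_ne_top]
          gcongr
          refine (bound (hum.comp (measurable_const.sub measurable_id))).trans (le_of_eq ?_)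
          exact congrArg _ (lintegral_sub_left_eq_self u (proj y))
      _ ≤ m * V * (m * U) := by
          rw [lintegral_mul_const _ hv']
          gcongr
          exact bound hvm
      _ = _ := by ring
  have i₄ : ∫⁻ p, u (proj p.1 - proj p.2) * v (proj p.2) ∂(ν.prod ν) ≤ m ^ 2 * (U * V) := by
    rw [lintegral_prod_symm _ m₄.aemeasurable]
    calc _ ≤ ∫⁻ z, (m * U) * v (proj z) ∂ν := by
          refine lintegral_mono fun z => ?_
          simp only
          rw [lintegral_mul_const' _ _ ENNReal.ofReal_ne_top]
          gcongr
          refine (bound (hum.comp (measurable_id.sub measurable_const))).trans (le_of_eq ?_)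
          exact congrArg _ (lintegral_sub_right_eq_self u (proj z))
      _ ≤ m * U * (m * V) := by
          rw [lintegral_const_mul _ hv']
          gcongr
          exact bound hvm
      _ = _ := by ring
  have hle : ν ≪ volume := Measure.restrict_le_self.absolutelyContinuous
  calc _ ≤ ∫⁻ y, ∫⁻ z, 2 * (u (proj y) * v (proj z) + v (proj y) * u (proj z) +
        v (proj y) * u (proj y - proj z) + u (proj y - proj z) * v (proj z)) ∂ν ∂ν := by
        refine lintegral_mono_ae ?_
        filter_upwards [hle.ae_le hpt] with y hy
        exact lintegral_mono_ae (hle.ae_le hy)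
    _ = ∫⁻ p, 2 * (u (proj p.1) * v (proj p.2) + v (proj p.1) * u (proj p.2) +
        v (proj p.1) * u (proj p.1 - proj p.2) + u (proj p.1 - proj p.2) * v (proj p.2))
          ∂(ν.prod ν) :=
        (lintegral_prod _ ((m₁₂₃.add m₄).const_mul 2).aemeasurable).symm
    _ = 2 * (((∫⁻ p, u (proj p.1) * v (proj p.2) ∂(ν.prod ν)) +
          (∫⁻ p, v (proj p.1) * u (proj p.2) ∂(ν.prod ν)) +
          (∫⁻ p, v (proj p.1) * u (proj p.1 - proj p.2) ∂(ν.prod ν))) +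
          ∫⁻ p, u (proj p.1 - proj p.2) * v (proj p.2) ∂(ν.prod ν)) := by
        rw [lintegral_const_mul' _ _ (by simp)]
        congr 1
        rw [lintegral_add_left m₁₂₃, lintegral_add_left m₁₂,
          lintegral_add_left m₁]
    _ ≤ 2 * (m ^ 2 * (U * V) + m ^ 2 * (U * V) + m ^ 2 * (U * V) + m ^ 2 * (U * V)) := by gcongr
    _ = 8 * (m ^ 2 * (U * V)) := by ring
    _ ≤ 8 * (m ^ 2 * ENNReal.ofReal (C * η ^ 2)) := by
        gcongr
        exact hUV η hη
    _ = _ := by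
        have e8 : (8 : ℝ≥0∞) = ENNReal.ofReal 8 := by simp
        have em : m = ENNReal.ofReal (2 * N + 2 : ℕ) := by rw [hm, ENNReal.ofReal_natCast]
        rw [e8, em, ← ENNReal.ofReal_pow (by positivity), ← ENNReal.ofReal_mul (by positivity),
          ← ENNReal.ofReal_mul (by positivity)]
        congr 1
        ring

/-! ### The renormalisation constant -/

lemma invSqrt_pow_four (z : ℝ × UnitAddCircle) : invSqrt z ^ 4 = (parNorm z ^ 2)⁻¹ := by
  rw [invSqrt, inv_pow, show 4 = 2 * 2 by rfl, pow_mul, Real.sq_sqrt (parNorm_nonneg z)]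

/-- The integral defining the renormalisation constant converges absolutely and is of
order `ε²`. -/
lemma exists_abs_integral_renormIntegrand_le {Ω : Type*} [MeasurableSpace Ω] {P : Measure Ω}
    [IsProbabilityMeasure P] {ξ : (ℝ × UnitAddCircle → ℝ) → Ω → ℝ}
    (hξ : IsWhiteNoise ξ volume P) {F : ℝ → ℝ} (hF : IsAdmissibleNonlinearity F)
    {ρ : ℝ × ℝ → ℝ} (hρ : IsMollifier ρ) {K : ℝ × ℝ → ℝ} (hK : IsTruncatedHeatKernel K) :
    ∃ W > 0, ∀ ε ∈ Set.Ioo (0 : ℝ) 1, ∀ x : ℝ × ℝ,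
      (∀ y z : ℝ × ℝ, Integrable (tripleProduct P ξ ρ F ε x y z) P) ∧
      Integrable (renormIntegrand P ξ ρ F K ε x) ∧
      |∫ yz, renormIntegrand P ξ ρ F K ε x yz| ≤ W * ε ^ 2 := by
  obtain ⟨T, hT, hE⟩ := exists_abs_integral_tripleProduct_le hξ hF hρ
  obtain ⟨A', hA'⟩ := hK.exists_abs_spaceDeriv_le
  obtain ⟨N, hN⟩ := hK.exists_spaceDeriv_ne_zero_imp
  obtain ⟨C, hC, htri⟩ := exists_setLIntegral_triangle_le N
  set A := max A' 1 with hA_def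
  have hA : 0 < A := by positivity
  -- the bound may fail at the origin, where `0⁻¹ = 0`; the null set `{y.1 = 0}` is left out
  have hKb : ∀ y : ℝ × ℝ, y.1 ≠ 0 → |spaceDeriv K y| ≤ A * invSqrt (proj y) ^ 4 := fun y hy => by
    have h0 : 0 < parNorm (proj y) := parNorm_pos fun h => hy (congrArg Prod.fst h)
    rw [invSqrt_pow_four, ← div_eq_mul_inv, le_div_iff₀ (by positivity)]
    exact (hA' y).trans (le_max_left _ _)
  refine ⟨A ^ 2 * T * C, by positivity, fun ε hε x => ?_⟩
  have hε0 := hε.1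
  obtain ⟨hEm, hEb⟩ := hE ε hε x
  have hKm := hK.measurable_spaceDeriv
  have hm : Measurable (renormIntegrand P ξ ρ F K ε x) := by
    refine Measurable.mul ?_ hEm
    exact (hKm.comp (measurable_const.sub measurable_fst)).mul
      (hKm.comp (measurable_const.sub measurable_snd))
  -- the integrand in the coordinates `x - y`, `x - z`
  set J : (ℝ × ℝ) × (ℝ × ℝ) → ℝ := fun p => renormIntegrand P ξ ρ F K ε x ((x, x) - p) with hJ
  have hJm : Measurable J := hm.comp (measurable_const.sub measurable_id)
  have hJ_eq : ∀ y z, J (y, z) = spaceDeriv K y * spaceDeriv K z *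
      ∫ ω, tripleProduct P ξ ρ F ε x (x - y) (x - z) ω ∂P := fun y z => by
    simp [hJ, renormIntegrand]
  have hJb : ∀ y z : ℝ × ℝ, y.1 ≠ 0 → z.1 ≠ 0 → ‖J (y, z)‖ₑ ≤ ENNReal.ofReal (A ^ 2 * T) *
      ENNReal.ofReal (invSqrt (proj y) ^ 4 * invSqrt (proj z) ^ 4 *
        (decay ε (proj y) * decay ε (proj z) * decay ε (proj y - proj z))) := by
    intro y z hy hz
    have hE := (hEb (x - y) (x - z)).2
    rw [proj_sub, proj_sub, sub_sub_cancel, sub_sub_cancel, sub_sub_sub_cancel_left,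
      ← neg_sub (proj y) (proj z), decay_neg] at hE
    have q1 := invSqrt_nonneg (proj y)
    have q2 := invSqrt_nonneg (proj z)
    rw [hJ_eq, Real.enorm_eq_ofReal_abs, ← ENNReal.ofReal_mul (by positivity), abs_mul, abs_mul]
    refine ENNReal.ofReal_le_ofReal ?_
    calc _ ≤ (A * invSqrt (proj y) ^ 4) * (A * invSqrt (proj z) ^ 4) *
          (T * (decay ε (proj y) * decay ε (proj z) * decay ε (proj y - proj z))) := by
          gcongr
          · exact hKb y hy
          · exact hKb z hz
      _ = _ := by ring
  have hz0 : ∀ y, y ∉ strip N → spaceDeriv K y = 0 := fun y hy => by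
    by_contra h
    exact hy (mem_strip (hN y h).2)
  have hinv : (volume : Measure ((ℝ × ℝ) × (ℝ × ℝ))).IsAddHaarMeasure :=
    inferInstanceAs ((volume : Measure (ℝ × ℝ)).prod (volume : Measure (ℝ × ℝ))).IsAddHaarMeasure
  have hlint : ∫⁻ yz, ‖renormIntegrand P ξ ρ F K ε x yz‖ₑ ≤
      ENNReal.ofReal (A ^ 2 * T * C * ε ^ 2) := by
    calc ∫⁻ yz, ‖renormIntegrand P ξ ρ F K ε x yz‖ₑ = ∫⁻ p, ‖J p‖ₑ :=
          (lintegral_sub_left_eq_self (fun yz => ‖renormIntegrand P ξ ρ F K ε x yz‖ₑ)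
            ((x, x) : (ℝ × ℝ) × (ℝ × ℝ))).symm
      _ = ∫⁻ y, ∫⁻ z, ‖J (y, z)‖ₑ := by
          rw [Measure.volume_eq_prod, lintegral_prod _ hJm.enorm.aemeasurable]
      _ = ∫⁻ y in strip N, ∫⁻ z in strip N, ‖J (y, z)‖ₑ := by
          rw [← setLIntegral_eq_of_support_subset (s := strip N)]
          · refine lintegral_congr fun y => (setLIntegral_eq_of_support_subset fun z hz => ?_).symm
            by_contra h
            exact hz (by simp [hJ_eq, hz0 z h])
          · intro y hy
            by_contra h
            exact hy (by simp [hJ_eq, hz0 y h])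
      _ ≤ ∫⁻ y in strip N, ∫⁻ z in strip N, ENNReal.ofReal (A ^ 2 * T) *
          ENNReal.ofReal (invSqrt (proj y) ^ 4 * invSqrt (proj z) ^ 4 *
            (decay ε (proj y) * decay ε (proj z) * decay ε (proj y - proj z))) := by
          have hne : ∀ᵐ z : ℝ × ℝ, z.1 ≠ 0 :=
            (Measure.quasiMeasurePreserving_fst (μ := (volume : Measure ℝ))
              (ν := (volume : Measure ℝ))).ae (Measure.ae_ne volume 0)
          refine lintegral_mono_ae ?_
          filter_upwards [ae_restrict_of_ae hne] with y hy
          refine lintegral_mono_ae ?_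
          filter_upwards [ae_restrict_of_ae hne] with z hz
          exact hJb y z hy hz
      _ = ENNReal.ofReal (A ^ 2 * T) * ∫⁻ y in strip N, ∫⁻ z in strip N,
          ENNReal.ofReal (invSqrt (proj y) ^ 4 * invSqrt (proj z) ^ 4 *
            (decay ε (proj y) * decay ε (proj z) * decay ε (proj y - proj z))) := by
          rw [← lintegral_const_mul' _ _ ENNReal.ofReal_ne_top]
          refine lintegral_congr fun y => ?_
          rw [lintegral_const_mul' _ _ ENNReal.ofReal_ne_top]
      _ ≤ ENNReal.ofReal (A ^ 2 * T) * ENNReal.ofReal (C * ε ^ 2) := by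
          gcongr
          exact htri ε hε0
      _ = _ := by
          rw [← ENNReal.ofReal_mul (by positivity)]
          congr 1
          ring
  refine ⟨fun y z => (hEb y z).1, ⟨hm.aestronglyMeasurable, hlint.trans_lt ENNReal.ofReal_lt_top⟩,
    ?_⟩
  rw [← ENNReal.ofReal_le_ofReal_iff (by positivity), ← Real.enorm_eq_ofReal_abs]
  exact (enorm_integral_le_lintegral_enorm _).trans hlint

end KPZRenorm

theorem mainTheorem8
    {Ω₀ : Type*} [MeasurableSpace Ω₀] (P₀ : Measure Ω₀) [IsProbabilityMeasure P₀]
    {Ω : Type*} [MeasurableSpace Ω] (P : Measure Ω) [IsProbabilityMeasure P]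
    (ξ₀ : (ℝ × ℝ → ℝ) → Ω₀ → ℝ) (hξ₀ : KPZRenorm.IsWhiteNoise ξ₀ volume P₀)
    (ξ : (ℝ × UnitAddCircle → ℝ) → Ω → ℝ) (hξ : KPZRenorm.IsWhiteNoise ξ volume P)
    (F : ℝ → ℝ) (hF : KPZRenorm.IsAdmissibleNonlinearity F)
    (ρ : ℝ × ℝ → ℝ) (hρ : KPZRenorm.IsMollifier ρ)
    (K : ℝ × ℝ → ℝ) (hK : KPZRenorm.IsTruncatedHeatKernel K)
    (a : ℝ) (ha : a = KPZRenorm.couplingConst P₀ ξ₀ ρ F) (ha0 : a ≠ 0) :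
    ∃ B : ℝ, ∀ ε ∈ Set.Ioo (0 : ℝ) 1, ∀ x : ℝ × ℝ,
      (∀ y z : ℝ × ℝ, Integrable (KPZRenorm.tripleProduct P ξ ρ F ε x y z) P) ∧
      Integrable (KPZRenorm.renormIntegrand P ξ ρ F K ε x) ∧
      |KPZRenorm.renormConst P ξ ρ F K a ε x| ≤ B := by
  obtain ⟨W, -, h⟩ := KPZRenorm.exists_abs_integral_renormIntegrand_le hξ hF hρ hK
  refine ⟨|1 / (2 * a ^ 3)| * W, fun ε hε x => ?_⟩
  obtain ⟨h1, h2, h3⟩ := h ε hε x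
  refine ⟨h1, h2, ?_⟩
  have hε2 : 0 < ε ^ 2 := pow_pos hε.1 2
  calc |KPZRenorm.renormConst P ξ ρ F K a ε x|
      = |1 / (2 * a ^ 3)| * (|∫ yz, KPZRenorm.renormIntegrand P ξ ρ F K ε x yz| / ε ^ 2) := by
        rw [KPZRenorm.renormConst, ← abs_of_pos hε2, ← abs_div, ← abs_mul, abs_of_pos hε2]
        congr 1
        field_simp
    _ ≤ |1 / (2 * a ^ 3)| * W := by
        gcongr
        rwa [div_le_iff₀ hε2]
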